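/- **Setting.** Let $f:\mathbb R\to\mathbb R$ be smooth and constant (with one and the same constant) outside a bounded interval, and suppose that $f(0)=0$, that $f'$ attains its minimum exactly at $0$, that $f'(0)<0$, and that $f'''(0)>0$. Put $t_0=1/f'(0)<0$ and $\beta_3=\frac16 t_0^4 f'''(0)>0$. For $t<0$ and $x\in\mathbb R$ let $\mathfrak u(t,x)$ be the unique real solution of $t\mathfrak u-\beta_3\mathfrak u^3=x$, and let $\mathfrak m=(|t|+3\beta_3\mathfrak u^2)^{-1}$ and $\mathfrak d=\mathfrak m^{-1/2}$. The homogeneous outer components $u_{k,\ell}$ ($k,\ell\in\mathbb Z_{\ge0}$) of the viscous Burgers equation $\partial_t u=-u\,\partial_x u+\nu\,\partial_x^2u$ with datum $f$ at time $t_0$ are defined for $t<0$ as follows. First, $u_{0,0}=\mathfrak u$. For $(k,\ell)\neq(0,0)$, recursively, $$u_{k,\ell}=u^F_{k,\ell}+C_{k,\ell}\,\mathfrak u^{\ell+3-4k}\,\mathfrak m ,\qquad u^F_{k,\ell}(t,\cdot)=\mathfrak m\int_{-\infty}^t \mathfrak m(s,\mathfrak u)^{-1}F_{k,\ell}(s,\mathfrak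 u)\,ds ,$$ where the integral is taken along the curve $s\mapsto(s,s\mathfrak u-\beta_3\mathfrak u^3)$ with $\mathfrak u$ fixed, and $F_{k,\ell}$ is the sum $$-\frac12\sum\partial_x(u_{k',\ell'}u_{k'',\ell''})+\partial_x^2u_{k-1,\ell}$$ over all $k'+k''=k$, $\ell'+\ell''=\ell$ with $(k',\ell')\ne(0,0)\ne(k'',\ell'')$ (no last term if $k=0$). Hence $$\partial_t u_{k,\ell}=-\frac12\sum_{k'+k''=k,\ \ell'+\ell''=\ell}\partial_x(u_{k',\ell'}u_{k'',\ell''})+\partial_x^2u_{k-1,\ell}.$$ If $n=\ell+3-4k\ge0$, the constant $C_{k,\ell}$ is the one for which $\sum_{\ell'\le\ell}u_{k,\ell'}(t_0,\cdot)$ has at $x=0$ the same Taylor coefficient of $x^n$ as $f$ (if $k=0$) or as $0$ (if $k\ge1$). If $n<0$, then $C_{k,\ell}=0$. In the inner coordinates $T=\nu^{-1/2}t$, $X=\nu^{-3/4}x$ the rescaled functions $$U_{k,\ell}(T,X)=\nu^{k-(\ell+1)/4}u_{k,\ell}(\nu^{1/2}T,\nu^{3/4}X),\qquad \mathfrak D(T,X)=\nu^{-1/4}\mathfrak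 d(\nu^{1/2}T,\nu^{3/4}X)$$ do not depend on $\nu>0$. Let $U_{[k],\ell}=\sum_{k'=0}^kU_{k',\ell}$, let $Q=(-1,0)\times(-1,1)$, and let $Q^c$ be its complement in $(-\infty,0)\times\mathbb R$. The inner hierarchy is $$\partial_TU_\ell=-\frac12\sum_{\ell'+\ell''=\ell}\partial_X(U_{\ell'}U_{\ell''})+\partial_X^2U_\ell,\qquad \ell\in\mathbb Z_{\ge0},\tag{1}$$ which for $\ell=0$ is the viscous Burgers equation with unit viscosity and for $\ell\ge1$ is a linear advection–diffusion equation for $U_\ell$, given $U_0,\dots,U_{\ell-1}$. Solutions of (1) on $\mathbb R^2$ are understood to be classical and to grow at most polynomially in $X$, locally uniformly in $T$. **Proposition 3.2.** For each $\ell\in\mathbb Z_{\ge0}$ there exists a unique solution $U_\ell$ of (1) on $\mathbb R^2$ such that for all $i,k\in\mathbb Z_{\ge0}$ there is a constant $C$, depending only on $i,k,\ell$ and $f$, with $$\big|\partial_X^i(U_\ell-U_{[k],\ell})\big|\le C\,\mathfrak D^{-(3i+4k-\ell+3)}\quad\text{on }Q^c.\tag{2}$$ The functions $U_\ell$ are smooth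 on $\mathbb R^2$. Moreover, given $U_0,\dots,U_{\ell-1}$, the function $U_\ell$ is the unique solution of the $\ell$-th equation (1) on $\mathbb R^2$ that satisfies (2) for some $k\ge\ell/4$ and each $i\in\{0,1\}$. Likewise, every classical solution of the $\ell$-th equation on $(-\infty,0)\times\mathbb R$ alone, without any growth condition, that satisfies (2) for some $k\ge\ell/4$ and each $i\in\{0,1\}$ coincides with $U_\ell$ there. -/

import Mathlib

open scoped ContDiff

namespace ShockFormation

/-! ### The initial datum -/

/-- The standing assumptions on the initial datum `f`: it is smooth, it is equal to one constant
outside a bounded interval, its slope is minimal exactly at `0`, where it is negative and where the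
third derivative is positive, and `f 0 = 0` (normalisation by a Galilean transformation). -/
structure IsShockDatum (f : ℝ → ℝ) : Prop where
  smooth : ContDiff ℝ ∞ f
  const_outside : ∃ c L : ℝ, 0 < L ∧ ∀ x ∉ Set.Icc (-L) L, f x = c
  slope_neg : deriv f 0 < 0
  slope_unique_min : ∀ x, x ≠ 0 → deriv f 0 < deriv f x
  nondegenerate : 0 < iteratedDeriv 3 f 0
  gauge : f 0 = 0

/-- The initial time `t₀ = (min f')⁻¹ < 0`; the inviscid shock forms at time `0`. -/
noncomputable def startTime (f : ℝ → ℝ) : ℝ := (deriv f 0)⁻¹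

/-- The coefficient `β₃ = t₀⁴ f'''(0) / 6 > 0`. -/
noncomputable def beta₃ (f : ℝ → ℝ) : ℝ := 1 / 6 * startTime f ^ 4 * iteratedDeriv 3 f 0

/-! ### The inverse cubic profile, its slope, and the distance to the origin -/

/-- The profile `𝔲`: the unique real solution `y` of `t y - β y³ = x`, for `t ≤ 0` and `β > 0`. -/
noncomputable def profile (β t x : ℝ) : ℝ := Classical.epsilon fun y : ℝ => t * y - β * y ^ 3 = x

/-- The slope `𝔪 = (|t| + 3 β 𝔲²)⁻¹`. -/
noncomputable def slope (β t x : ℝ) : ℝ := (|t| + 3 * β * profile β t x ^ 2)⁻¹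

/-- The distance `𝔡 = 𝔪 ^ (-1/2) = (|t| + 3 β 𝔲²) ^ (1/2)`. -/
noncomputable def dist (β t x : ℝ) : ℝ := √(|t| + 3 * β * profile β t x ^ 2)

theorem profile_unique {β t y z : ℝ} (hβ : 0 < β) (ht : t ≤ 0)
    (h : t * y - β * y ^ 3 = t * z - β * z ^ 3) : y = z := by
  by_contra hne
  have h1 : (y - z) * (-t + β * (y ^ 2 + y * z + z ^ 2)) = 0 := by linear_combination -h
  have h2 : -t + β * (y ^ 2 + y * z + z ^ 2) = 0 :=
    (mul_eq_zero.1 h1).resolve_left (sub_ne_zero.2 hne)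
  have h3 : 0 < (y - z) ^ 2 := by exact pow_two_pos_of_ne_zero (sub_ne_zero.2 hne)
  nlinarith [mul_pos hβ h3, mul_nonneg hβ.le (sq_nonneg (y + z))]

theorem profile_spec {β t : ℝ} (hβ : 0 < β) (ht : t ≤ 0) (x : ℝ) :
    t * profile β t x - β * profile β t x ^ 3 = x := by
  refine Classical.epsilon_spec (p := fun y : ℝ => t * y - β * y ^ 3 = x) ?_
  set M : ℝ := 1 + |x| / β with hM
  have hx0 : 0 ≤ |x| / β := by positivity
  have hM1 : 1 ≤ M := by linarith
  have hbM : |x| ≤ β * M := by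
    rw [hM, mul_add, mul_div_cancel₀ _ hβ.ne']; linarith
  have hM3 : M ≤ M ^ 3 := by nlinarith [mul_nonneg (sub_nonneg.2 hM1) (sub_nonneg.2 hM1)]
  have hbM3 : β * M ≤ β * M ^ 3 := mul_le_mul_of_nonneg_left hM3 hβ.le
  have hc : ContinuousOn (fun y : ℝ => t * y - β * y ^ 3) (Set.Icc (-M) M) := by fun_prop
  have hle : -M ≤ M := by linarith
  obtain ⟨y, -, hy⟩ := intermediate_value_Icc' hle hc (show x ∈ Set.Icc _ _ from
    ⟨by nlinarith [neg_abs_le x], by nlinarith [le_abs_self x]⟩)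
  exact ⟨y, hy⟩

theorem profile_eq {β t x y : ℝ} (hβ : 0 < β) (ht : t ≤ 0) (h : t * y - β * y ^ 3 = x) :
    profile β t x = y :=
  profile_unique hβ ht ((profile_spec hβ ht x).trans h.symm)

/-! ### The homogeneous outer components -/

/-- The particular solution `v` of `∂ₜ v = -∂ₓ (𝔲 v) + F` that is obtained by integrating from
`t = -∞` along the characteristics `s ↦ (s, s y - β y³)` of `𝔲`, on which `𝔲 = y` is constant:
`v = 𝔪 ∫_{-∞}^t 𝔪(s, 𝔲)⁻¹ F(s, 𝔲) ds`. -/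
noncomputable def characteristicIntegral (β : ℝ) (F : ℝ → ℝ → ℝ) (t x : ℝ) : ℝ :=
  slope β t x * ∫ s in Set.Iic t,
    (slope β s (s * profile β t x - β * profile β t x ^ 3))⁻¹ *
      F s (s * profile β t x - β * profile β t x ^ 3)

/-- The solution `𝔲ⁿ 𝔪` of the unforced equation `∂ₜ v = -∂ₓ (𝔲 v)`. -/
noncomputable def unforced (β : ℝ) (n : ℕ) (t x : ℝ) : ℝ := profile β t x ^ n * slope β t x

/-- The coefficient of `xⁿ` in the Taylor series of `g` at `0`. -/
noncomputable def taylorCoeff (n : ℕ) (g : ℝ → ℝ) : ℝ := iteratedDeriv n g 0 / n.factorial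

/-- The datum at time `t₀` of the `k`-th term of the outer expansion: `f` for `k = 0` and `0` for
`k ≥ 1`. -/
noncomputable def outerDatum (f : ℝ → ℝ) (k : ℕ) : ℝ → ℝ := if k = 0 then f else 0

/-- The multiple of `𝔲ⁿ 𝔪`, `n = ℓ + 3 - 4k`, that has to be added to `w` in order that the
coefficient of `xⁿ` at time `t₀` becomes that of the datum of the `k`-th outer term. It is `0` if
`ℓ + 3 - 4k < 0`. -/
noncomputable def matchingCoeff (f : ℝ → ℝ) (k ℓ : ℕ) (w : ℝ → ℝ) : ℝ :=
  if 4 * k ≤ ℓ + 3 then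
    (taylorCoeff (ℓ + 3 - 4 * k) (outerDatum f k) - taylorCoeff (ℓ + 3 - 4 * k) w) /
      taylorCoeff (ℓ + 3 - 4 * k) (unforced (beta₃ f) (ℓ + 3 - 4 * k) (startTime f))
  else 0

/-- The homogeneous outer components `u_{k,ℓ}`. One has `u_{0,0} = 𝔲`, and for `(k, ℓ) ≠ (0, 0)`
the component `u_{k,ℓ}` is the solution of
`∂ₜ u_{k,ℓ} = -1/2 ∑_{k'+k''=k, ℓ'+ℓ''=ℓ} ∂ₓ (u_{k',ℓ'} u_{k'',ℓ''}) + ∂ₓ² u_{k-1,ℓ}`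
(no last term if `k = 0`) of the form `u_{k,ℓ}^F + C_{k,ℓ} 𝔲^(ℓ+3-4k) 𝔪`. Here `u_{k,ℓ}^F` is the
particular solution for the forcing `F` that collects all terms but the two that contain `u_{k,ℓ}`,
whose sum is `-∂ₓ (𝔲 u_{k,ℓ})`. The constant `C_{k,ℓ}` is chosen such that
`∑_{ℓ' ≤ ℓ} u_{k,ℓ'} (t₀, ·)` and the datum of the `k`-th outer term have the same coefficient of
`x^(ℓ+3-4k)` at `x = 0`; it is `0` if this exponent is negative. -/
noncomputable def outerComponent (f : ℝ → ℝ) (k ℓ : ℕ) : ℝ → ℝ → ℝ :=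
  if k + ℓ = 0 then profile (beta₃ f)
  else
    let F : ℝ → ℝ → ℝ := fun t x =>
      -(1 / 2) * (∑ p ∈ Finset.HasAntidiagonal.antidiagonal k, ∑ q ∈ Finset.HasAntidiagonal.antidiagonal ℓ,
        if _h : p.1 + q.1 < k + ℓ ∧ p.2 + q.2 < k + ℓ then
          deriv (fun z => outerComponent f p.1 q.1 t z * outerComponent f p.2 q.2 t z) x
        else 0)
      + (if _h : 0 < k then iteratedDeriv 2 (outerComponent f (k - 1) ℓ t) x else 0)
    let uF : ℝ → ℝ → ℝ := characteristicIntegral (beta₃ f) F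
    let C : ℝ := matchingCoeff f k ℓ
      (fun x => (∑ j : Fin ℓ, outerComponent f k j (startTime f) x) + uF (startTime f) x)
    fun t x => uF t x + C * unforced (beta₃ f) (ℓ + 3 - 4 * k) t x
termination_by k + ℓ
decreasing_by all_goals omega

/-- `ν^(k-(ℓ+1)/4) u_{k,ℓ}(ν^(1/2) T, ν^(3/4) X)`: the outer component `u_{k,ℓ}` in the inner
coordinates `T = ν^(-1/2) t`, `X = ν^(-3/4) x`, rescaled by the factor belonging to the `ℓ`-th inner
term. By `rescaledComponent_eq` below, it does not depend on `ν > 0`. -/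
noncomputable def rescaledComponent (f : ℝ → ℝ) (ν : ℝ) (k ℓ : ℕ) (T X : ℝ) : ℝ :=
  ν ^ ((k : ℝ) - ((ℓ : ℝ) + 1) / 4) *
    outerComponent f k ℓ (ν ^ (1 / 2 : ℝ) * T) (ν ^ (3 / 4 : ℝ) * X)

/-! ### The rescaled components do not depend on `ν` -/

/-- Homogeneity with respect to `(t, x) ↦ (c² t, c³ x)`, for `c > 0`, on `t < 0`. -/
def IsHomogeneous (r : ℤ) (g : ℝ → ℝ → ℝ) : Prop :=
  ∀ c t x : ℝ, 0 < c → t < 0 → g (c ^ 2 * t) (c ^ 3 * x) = c ^ r * g t x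

theorem IsHomogeneous.mul {r s : ℤ} {g h : ℝ → ℝ → ℝ} (hg : IsHomogeneous r g)
    (hh : IsHomogeneous s h) : IsHomogeneous (r + s) (fun t x => g t x * h t x) := by
  intro c t x hc ht
  simp only [hg c t x hc ht, hh c t x hc ht, zpow_add₀ hc.ne']
  ring

theorem IsHomogeneous.deriv {r : ℤ} {g : ℝ → ℝ → ℝ} (hg : IsHomogeneous r g) :
    IsHomogeneous (r - 3) (fun t x => deriv (g t) x) := by
  intro c t x hc ht
  have h1 : (fun z => g (c ^ 2 * t) (c ^ 3 * z)) = fun z => c ^ r * g t z :=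
    funext fun z => hg c t z hc ht
  have h2 := congrFun (congrArg _root_.deriv h1) x
  rw [deriv_comp_mul_left (c ^ 3) (g (c ^ 2 * t)) x, deriv_const_mul_field, smul_eq_mul] at h2
  have h3 : c ^ r = c ^ 3 * c ^ (r - 3) := by
    rw [← zpow_natCast, ← zpow_add₀ hc.ne']; congr 1; push_cast; ring
  rw [h3, mul_assoc] at h2
  exact mul_left_cancel₀ (pow_ne_zero 3 hc.ne') h2

theorem profile_homogeneous {β : ℝ} (hβ : 0 < β) : IsHomogeneous 1 (profile β) := by
  intro c t x hc ht
  refine profile_eq hβ (by nlinarith [pow_pos hc 2]) ?_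
  rw [zpow_one]
  linear_combination c ^ 3 * profile_spec hβ ht.le x

theorem slope_homogeneous {β : ℝ} (hβ : 0 < β) : IsHomogeneous (-2) (slope β) := by
  intro c t x hc ht
  simp only [slope, profile_homogeneous hβ c t x hc ht, zpow_one, abs_mul, abs_pow, abs_of_pos hc]
  rw [show c ^ 2 * |t| + 3 * β * (c * profile β t x) ^ 2
    = c ^ 2 * (|t| + 3 * β * profile β t x ^ 2) by ring, mul_inv, zpow_neg]
  rfl

theorem characteristicIntegral_homogeneous {β : ℝ} (hβ : 0 < β) {r : ℤ} {F : ℝ → ℝ → ℝ}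
    (hF : IsHomogeneous r F) : IsHomogeneous (r + 2) (characteristicIntegral β F) := by
  intro c t x hc ht
  have hc2 : 0 < c ^ 2 := pow_pos hc 2
  simp only [characteristicIntegral, slope_homogeneous hβ c t x hc ht,
    profile_homogeneous hβ c t x hc ht, zpow_one]
  set y := profile β t x
  have key : ∫ s in Set.Iic (c ^ 2 * t), (slope β s (s * (c * y) - β * (c * y) ^ 3))⁻¹ *
        F s (s * (c * y) - β * (c * y) ^ 3)
      = c ^ 2 * (c ^ 2 * c ^ r) *
        ∫ s in Set.Iic t, (slope β s (s * y - β * y ^ 3))⁻¹ * F s (s * y - β * y ^ 3) := by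
    rw [mul_assoc, ← MeasureTheory.integral_const_mul]
    have h := MeasureTheory.Measure.setIntegral_comp_smul_of_pos MeasureTheory.volume
      (fun s => (slope β s (s * (c * y) - β * (c * y) ^ 3))⁻¹ *
        F s (s * (c * y) - β * (c * y) ^ 3)) (Set.Iic t) hc2
    rw [LinearOrderedField.smul_Iic hc2, Module.finrank_self, pow_one, smul_eq_mul,
      eq_comm, inv_mul_eq_iff_eq_mul₀ hc2.ne'] at h
    simp only [smul_eq_mul] at h
    rw [h]
    congr 1
    refine MeasureTheory.setIntegral_congr_fun measurableSet_Iic fun s hs => ?_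
    have hs0 : s < 0 := lt_of_le_of_lt hs ht
    have e : c ^ 2 * s * (c * y) - β * (c * y) ^ 3 = c ^ 3 * (s * y - β * y ^ 3) := by ring
    simp only [e, slope_homogeneous hβ c s _ hc hs0, hF c s _ hc hs0, mul_inv, zpow_neg, inv_inv]
    rw [show (c : ℝ) ^ (2 : ℤ) = c ^ 2 from rfl]
    ring
  rw [key, zpow_add₀ hc.ne', zpow_neg, show (c : ℝ) ^ (2 : ℤ) = c ^ 2 from rfl]
  field_simp

theorem beta₃_pos {f : ℝ → ℝ} (hf : IsShockDatum f) : 0 < beta₃ f := by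
  have h : startTime f ≠ 0 := inv_ne_zero hf.slope_neg.ne
  have h4 : 0 < startTime f ^ 4 := by positivity
  have := hf.nondegenerate
  unfold beta₃
  positivity

theorem outerComponent_homogeneous {f : ℝ → ℝ} (hf : IsShockDatum f) (k ℓ : ℕ) :
    IsHomogeneous ((ℓ : ℤ) - 4 * k + 1) (outerComponent f k ℓ) := by
  induction hn : k + ℓ using Nat.strong_induction_on generalizing k ℓ with
  | _ n ih =>
  have hβ := beta₃_pos hf
  rw [outerComponent]
  by_cases h0 : k + ℓ = 0
  · obtain ⟨rfl, rfl⟩ : k = 0 ∧ ℓ = 0 := by omega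
    simpa using profile_homogeneous hβ
  · rw [if_neg h0]
    intro c t x hc ht
    simp only []
    have hC : ∀ w, matchingCoeff f k ℓ w * unforced (beta₃ f) (ℓ + 3 - 4 * k) (c ^ 2 * t) (c ^ 3 * x)
        = c ^ ((ℓ : ℤ) - 4 * k + 1) *
          (matchingCoeff f k ℓ w * unforced (beta₃ f) (ℓ + 3 - 4 * k) t x) := by
      intro w
      by_cases hk : 4 * k ≤ ℓ + 3
      · rw [unforced, unforced, profile_homogeneous hβ c t x hc ht,
          slope_homogeneous hβ c t x hc ht, zpow_one, mul_pow]
        rw [show (ℓ : ℤ) - 4 * k + 1 = ((ℓ + 3 - 4 * k : ℕ) : ℤ) + (-2) by omega,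
          zpow_add₀ hc.ne', zpow_natCast]
        ring
      · simp [matchingCoeff, hk]
    rw [hC, mul_add]
    congr 1
    rw [show (ℓ : ℤ) - 4 * k + 1 = ((ℓ : ℤ) - 4 * k - 1) + 2 by ring]
    refine characteristicIntegral_homogeneous hβ ?_ c t x hc ht
    clear hC ht hc x t c
    intro c t x hc ht
    beta_reduce
    rw [mul_add]
    refine congrArg₂ (· + ·) ?_ ?_
    · rw [mul_left_comm]
      refine congrArg (fun z => -(1 / 2) * z) ?_
      rw [Finset.mul_sum]
      refine Finset.sum_congr rfl fun p hp => ?_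
      rw [Finset.mul_sum]
      refine Finset.sum_congr rfl fun q hq => ?_
      have hp' := Finset.HasAntidiagonal.mem_antidiagonal.1 hp
      have hq' := Finset.HasAntidiagonal.mem_antidiagonal.1 hq
      split_ifs with h
      · have := ((ih _ (by omega) p.1 q.1 rfl).mul (ih _ (by omega) p.2 q.2 rfl)).deriv c t x hc ht
        refine this.trans ?_
        congr 2
        omega
      · simp
    · split_ifs with h
      · have := (ih _ (by omega) (k - 1) ℓ rfl).deriv.deriv c t x hc ht
        simp only [iteratedDeriv_succ, iteratedDeriv_zero]
        refine this.trans ?_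
        congr 2
        omega
      · simp

theorem rescaledComponent_eq {f : ℝ → ℝ} (hf : IsShockDatum f) {ν : ℝ} (hν : 0 < ν) (k ℓ : ℕ)
    {T : ℝ} (hT : T < 0) (X : ℝ) :
    rescaledComponent f ν k ℓ T X = outerComponent f k ℓ T X := by
  have hc : 0 < ν ^ (1 / 4 : ℝ) := Real.rpow_pos_of_pos hν _
  have h2 : ν ^ (1 / 2 : ℝ) = (ν ^ (1 / 4 : ℝ)) ^ 2 := by
    rw [← Real.rpow_mul_natCast hν.le]; norm_num
  have h3 : ν ^ (3 / 4 : ℝ) = (ν ^ (1 / 4 : ℝ)) ^ 3 := by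
    rw [← Real.rpow_mul_natCast hν.le]; norm_num
  rw [rescaledComponent, h2, h3, outerComponent_homogeneous hf k ℓ _ T X hc hT, ← mul_assoc,
    ← Real.rpow_mul_intCast hν.le, ← Real.rpow_add hν]
  convert one_mul _ using 2
  convert Real.rpow_zero ν using 2
  push_cast
  ring

theorem rescaledDist_eq {f : ℝ → ℝ} (hf : IsShockDatum f) {ν : ℝ} (hν : 0 < ν)
    {T : ℝ} (hT : T < 0) (X : ℝ) :
    ν ^ (-1 / 4 : ℝ) * dist (beta₃ f) (ν ^ (1 / 2 : ℝ) * T) (ν ^ (3 / 4 : ℝ) * X)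
      = dist (beta₃ f) T X := by
  have hc : 0 < ν ^ (1 / 4 : ℝ) := Real.rpow_pos_of_pos hν _
  have h2 : ν ^ (1 / 2 : ℝ) = (ν ^ (1 / 4 : ℝ)) ^ 2 := by
    rw [← Real.rpow_mul_natCast hν.le]; norm_num
  have h3 : ν ^ (3 / 4 : ℝ) = (ν ^ (1 / 4 : ℝ)) ^ 3 := by
    rw [← Real.rpow_mul_natCast hν.le]; norm_num
  have h1 : ν ^ (-1 / 4 : ℝ) = (ν ^ (1 / 4 : ℝ))⁻¹ := by
    rw [← Real.rpow_neg hν.le]; norm_num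
  rw [h1, h2, h3]
  set c := ν ^ (1 / 4 : ℝ)
  simp only [dist, profile_homogeneous (beta₃_pos hf) c T X hc hT, zpow_one, abs_mul, abs_pow,
    abs_of_pos hc]
  rw [show c ^ 2 * |T| + 3 * beta₃ f * (c * profile (beta₃ f) T X) ^ 2
    = c ^ 2 * (|T| + 3 * beta₃ f * profile (beta₃ f) T X ^ 2) by ring,
    Real.sqrt_mul (by positivity), Real.sqrt_sq hc.le, inv_mul_cancel_left₀ hc.ne']

/-! ### The inner hierarchy -/

/-- The rescaled component `U_{k,ℓ}(T, X) = ν^(k-(ℓ+1)/4) u_{k,ℓ}(ν^(1/2) T, ν^(3/4) X)`, written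
without the irrelevant parameter `ν`. -/
noncomputable def innerComponent (f : ℝ → ℝ) (k ℓ : ℕ) (T X : ℝ) : ℝ := outerComponent f k ℓ T X

/-- The distance `𝔇(T, X) = ν^(-1/4) 𝔡(ν^(1/2) T, ν^(3/4) X)`, written without the irrelevant
parameter `ν`. -/
noncomputable def innerDist (f : ℝ → ℝ) (T X : ℝ) : ℝ := dist (beta₃ f) T X

/-- The partial sum `U_{[k],ℓ} = ∑_{k' ≤ k} U_{k',ℓ}`. -/
noncomputable def innerPartialSum (f : ℝ → ℝ) (k ℓ : ℕ) (T X : ℝ) : ℝ :=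
  ∑ k' ∈ Finset.range (k + 1), innerComponent f k' ℓ T X

/-- The complement of the rectangle `Q = (-1, 0) × (-1, 1)` in the half-plane `T < 0`. -/
def rectangleCompl : Set (ℝ × ℝ) := {z | z.1 < 0} \ (Set.Ioo (-1) 0 ×ˢ Set.Ioo (-1) 1)

/-- The bound `|∂_X^i (V - U_{[k],ℓ})| ≤ C 𝔇 ^ (-(3i + 4k - ℓ + 3))` on the complement of `Q`, for
some constant `C`. -/
def FarFieldBound (f : ℝ → ℝ) (V : ℝ → ℝ → ℝ) (ℓ i k : ℕ) : Prop :=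
  ∃ C : ℝ, ∀ T X : ℝ, (T, X) ∈ rectangleCompl →
    |iteratedDeriv i (fun x => V T x - innerPartialSum f k ℓ T x) X| ≤
      C * innerDist f T X ^ (-(3 * (i : ℤ) + 4 * (k : ℤ) - (ℓ : ℤ) + 3))

/-- The `ℓ`-th equation
`∂_T U_ℓ = -1/2 ∑_{ℓ'+ℓ''=ℓ} ∂_X (U_{ℓ'} U_{ℓ''}) + ∂_X² U_ℓ` of the inner hierarchy, at all times
`T ∈ J`. For `ℓ = 0` this is the viscous Burgers equation with unit viscosity; for `ℓ ≥ 1` it is a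
linear advection-diffusion equation for `U_ℓ`, given the `U_{ℓ'}` with `ℓ' < ℓ`. -/
def SolvesInnerEquation (J : Set ℝ) (U : ℕ → ℝ → ℝ → ℝ) (ℓ : ℕ) : Prop :=
  ∀ T ∈ J, ∀ X : ℝ,
    deriv (fun s => U ℓ s X) T =
      -(1 / 2) * (∑ p ∈ Finset.HasAntidiagonal.antidiagonal ℓ,
        deriv (fun x => U p.1 T x * U p.2 T x) X) + iteratedDeriv 2 (U ℓ T) X

/-- The regularity of a classical solution of a parabolic equation on `J × ℝ`, `J` open: the
derivatives `∂_T V`, `∂_X V`, `∂_X² V` exist, and they and `V` are continuous on `J × ℝ`. -/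
def IsClassicalOn (J : Set ℝ) (V : ℝ → ℝ → ℝ) : Prop :=
  (∀ T ∈ J, ∀ X : ℝ, DifferentiableAt ℝ (fun s => V s X) T) ∧
  (∀ T ∈ J, ContDiff ℝ 2 (V T)) ∧
  ContinuousOn (fun z : ℝ × ℝ => V z.1 z.2) (J ×ˢ Set.univ) ∧
  ContinuousOn (fun z : ℝ × ℝ => deriv (fun s => V s z.2) z.1) (J ×ˢ Set.univ) ∧
  ContinuousOn (fun z : ℝ × ℝ => deriv (V z.1) z.2) (J ×ˢ Set.univ) ∧
  ContinuousOn (fun z : ℝ × ℝ => iteratedDeriv 2 (V z.1) z.2) (J ×ˢ Set.univ)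

/-- Polynomial growth in `X`, locally uniformly in `T`. -/
def HasPolynomialGrowth (V : ℝ → ℝ → ℝ) : Prop :=
  ∀ R : ℝ, ∃ (C : ℝ) (N : ℕ), ∀ T ∈ Set.Icc (-R) R, ∀ X : ℝ, |V T X| ≤ C * (1 + |X|) ^ N

/-- `U` is a sequence of smooth solutions, of polynomial growth in `X` locally uniformly in `T`, of
all the equations of the inner hierarchy on `ℝ²`, and all the far-field bounds hold. -/
def IsInnerExpansion (f : ℝ → ℝ) (U : ℕ → ℝ → ℝ → ℝ) : Prop :=
  ∀ ℓ : ℕ, ContDiff ℝ ∞ (fun z : ℝ × ℝ => U ℓ z.1 z.2) ∧ HasPolynomialGrowth (U ℓ) ∧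
    SolvesInnerEquation Set.univ U ℓ ∧ ∀ i k : ℕ, FarFieldBound f (U ℓ) ℓ i k

end ShockFormation

namespace ShockFormation

open Filter Topology Set

/-! ### Smooth functions on a strip -/

/-! Existence. The Cole–Hopf transformation makes the inner solutions explicit. For every y the
weight exp(-Xy/2 + Ty²/4 - βy⁴/8) solves the heat equation in (T, X). So does the formal series Φ =
∑ ε^ℓ ∫ P_ℓ(y) weight dy for any polynomials P_ℓ with P_0 = 1, and the coefficients of U = -2 ∂_X Φ
/ Φ solve the inner hierarchy (`solvesInnerEquation_innerSol`). It remains to choose the P_ℓ so that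
U_ℓ matches the outer components. The right choice is P = exp(½ ∫ c), where c_j(y) = ∑_k C_{k,j}
y^(j+3-4k) for j ≥ 1 and c_0 = 0.

Matching compares an equation that both expansions satisfy. Integration by parts in y turns P' = ½ c
P into X - T U + β (U - 2∂_X)³ 1 = ∑_n c_n (U - 2∂_X)ⁿ 1, where c_n is the coefficient of yⁿ in c
(`famPow_equation`). On the outer side, ∑ κ^k ε^ℓ u_{k,ℓ} solves the Burgers equation with viscosity
κ. For such a solution U the operator ∂_T + U∂_X - κ∂_X² annihilates every (U - 2κ∂_X)ⁿ 1
(`flow_opPow`) as well as X - TU, hence also the residual of the same equation with 2κ∂_X in place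
of 2∂_X. Order by order, this residual is constant along the characteristics of 𝔲 and tends to 0 as
T → -∞, so it vanishes (`outerResidual_eq_zero`). The numerical values of the C_{k,ℓ} play no role.

Subtracting the two equations, the difference E of U_ℓ and a partial sum of outer components enters
with leading term (|T| + 3β𝔲²) E = E/𝔪, and the other terms containing E are smaller by a factor
𝔇⁻⁴. A bound of order r for E and all its derivatives thus improves to r - 4, until the order of the
truncation error is reached (`sym_gain`, `hasExp_innerSol`). Some initial order comes from the decay
of the moments of y - 𝔲 (`sym_centered`).

Uniqueness. For T < 0, if the difference Z of two solutions has a critical point in X, then there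
∂_T Z = -Z ∂_X U_0 + ∂_X² Z. The variance bound -∂_X U_0 ≤ 1/|T| (`neg_time_mul_variance_le`) shows
that -TZ cannot grow at a positive maximum. Since -TZ tends to 0 in the far field, Z ≤ 0, and by
symmetry Z = 0. For T ≥ 0 and ℓ ≥ 1 a maximum principle for a linear equation with drift of linear
growth suffices. For ℓ = 0, Cole–Hopf reduces the claim to uniqueness for the heat equation. The
Gaussian growth bound needed there holds because the transformed solution is positive and continues
to later times (`IsHeat.exists_le_exp_sq`). -/

theorem two_le_smooth : (2 : WithTop ℕ∞) ≤ ∞ :=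
  WithTop.coe_le_coe.2 (le_top : (2 : ℕ∞) ≤ ⊤)

/-- Joint smoothness of `g` at all points whose time lies in `J`. -/
def SmoothFor (J : Set ℝ) (g : ℝ → ℝ → ℝ) : Prop :=
  ∀ T ∈ J, ∀ X : ℝ, ContDiffAt ℝ ∞ (fun z : ℝ × ℝ => g z.1 z.2) (T, X)

section Smooth

variable {J : Set ℝ} {g h : ℝ → ℝ → ℝ}

theorem eventually_mem_times (hJ : IsOpen J) {T : ℝ} (hT : T ∈ J) (X : ℝ) :
    ∀ᶠ z : ℝ × ℝ in 𝓝 (T, X), z.1 ∈ J :=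
  continuous_fst.continuousAt.eventually (hJ.mem_nhds hT)

theorem SmoothFor.congr (hJ : IsOpen J) (hg : SmoothFor J g) (h' : ∀ T ∈ J, ∀ X, h T X = g T X) :
    SmoothFor J h := fun T hT X =>
  (hg T hT X).congr_of_eventuallyEq
    ((eventually_mem_times hJ hT X).mono fun z hz => h' z.1 hz z.2)

theorem SmoothFor.const (c : ℝ) : SmoothFor J (fun _ _ => c) := fun _ _ _ => contDiffAt_const

theorem SmoothFor.time : SmoothFor J (fun T _ => T) := fun _ _ _ => contDiffAt_fst

theorem SmoothFor.space : SmoothFor J (fun _ X => X) := fun _ _ _ => contDiffAt_snd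

theorem SmoothFor.add (hg : SmoothFor J g) (hh : SmoothFor J h) :
    SmoothFor J (fun T X => g T X + h T X) := fun T hT X => (hg T hT X).add (hh T hT X)

theorem SmoothFor.sub (hg : SmoothFor J g) (hh : SmoothFor J h) :
    SmoothFor J (fun T X => g T X - h T X) := fun T hT X => (hg T hT X).sub (hh T hT X)

theorem SmoothFor.mul (hg : SmoothFor J g) (hh : SmoothFor J h) :
    SmoothFor J (fun T X => g T X * h T X) := fun T hT X => (hg T hT X).mul (hh T hT X)

theorem SmoothFor.neg (hg : SmoothFor J g) : SmoothFor J (fun T X => -g T X) :=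
  fun T hT X => (hg T hT X).neg

theorem SmoothFor.pow (hg : SmoothFor J g) (n : ℕ) : SmoothFor J (fun T X => g T X ^ n) :=
  fun T hT X => (hg T hT X).pow n

theorem SmoothFor.sum {ι : Type*} {s : Finset ι} {G : ι → ℝ → ℝ → ℝ}
    (hG : ∀ i ∈ s, SmoothFor J (G i)) : SmoothFor J (fun T X => ∑ i ∈ s, G i T X) :=
  fun T hT X => ContDiffAt.sum fun i hi => hG i hi T hT X

theorem SmoothFor.contDiff (hg : SmoothFor J g) {T : ℝ} (hT : T ∈ J) : ContDiff ℝ ∞ (g T) := by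
  rw [contDiff_iff_contDiffAt]
  intro X
  exact (hg T hT X).comp X (contDiffAt_const.prodMk contDiffAt_id)

theorem SmoothFor.differentiableAt (hg : SmoothFor J g) {T : ℝ} (hT : T ∈ J) (X : ℝ) :
    DifferentiableAt ℝ (g T) X := (hg.contDiff hT).differentiable (by simp) X

theorem SmoothFor.hasDerivAt (hg : SmoothFor J g) {T : ℝ} (hT : T ∈ J) (X : ℝ) :
    HasDerivAt (g T) (deriv (g T) X) X := (hg.differentiableAt hT X).hasDerivAt

theorem SmoothFor.hasFDerivAt (hg : SmoothFor J g) {T : ℝ} (hT : T ∈ J) (X : ℝ) :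
    HasFDerivAt (fun z : ℝ × ℝ => g z.1 z.2) (fderiv ℝ (fun z : ℝ × ℝ => g z.1 z.2) (T, X))
      (T, X) := ((hg T hT X).differentiableAt (by simp)).hasFDerivAt

theorem SmoothFor.deriv_eq_fderiv (hg : SmoothFor J g) {T : ℝ} (hT : T ∈ J) (X : ℝ) :
    deriv (g T) X = fderiv ℝ (fun z : ℝ × ℝ => g z.1 z.2) (T, X) (0, 1) := by
  have h1 : HasDerivAt (fun x : ℝ => ((T, x) : ℝ × ℝ)) ((0 : ℝ), (1 : ℝ)) X :=
    (hasDerivAt_const X T).prodMk (hasDerivAt_id X)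
  exact ((hg.hasFDerivAt hT X).comp_hasDerivAt X h1).deriv

theorem SmoothFor.deriv_time_eq_fderiv (hg : SmoothFor J g) {T : ℝ} (hT : T ∈ J) (X : ℝ) :
    HasDerivAt (fun s => g s X) (fderiv ℝ (fun z : ℝ × ℝ => g z.1 z.2) (T, X) (1, 0)) T := by
  have h1 : HasDerivAt (fun s : ℝ => ((s, X) : ℝ × ℝ)) ((1 : ℝ), (0 : ℝ)) T :=
    (hasDerivAt_id T).prodMk (hasDerivAt_const T X)
  exact (hg.hasFDerivAt hT X).comp_hasDerivAt T h1

theorem SmoothFor.hasDerivAt_time (hg : SmoothFor J g) {T : ℝ} (hT : T ∈ J) (X : ℝ) :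
    HasDerivAt (fun s => g s X) (deriv (fun s => g s X) T) T :=
  (hg.deriv_time_eq_fderiv hT X).differentiableAt.hasDerivAt

theorem contDiffAt_fderiv_apply {G : ℝ × ℝ → ℝ} {z : ℝ × ℝ} (hG : ContDiffAt ℝ ∞ G z)
    (v : ℝ × ℝ) : ContDiffAt ℝ ∞ (fun z => fderiv ℝ G z v) z :=
  (hG.fderiv_right (m := ∞) (by simp)).clm_apply contDiffAt_const

theorem SmoothFor.dX (hJ : IsOpen J) (hg : SmoothFor J g) :
    SmoothFor J (fun T X => deriv (g T) X) := fun T hT X =>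
  (contDiffAt_fderiv_apply (hg T hT X) (0, 1)).congr_of_eventuallyEq
    ((eventually_mem_times hJ hT X).mono fun z hz => hg.deriv_eq_fderiv hz z.2)

theorem SmoothFor.dT (hJ : IsOpen J) (hg : SmoothFor J g) :
    SmoothFor J (fun T X => deriv (fun s => g s X) T) := fun T hT X =>
  (contDiffAt_fderiv_apply (hg T hT X) (1, 0)).congr_of_eventuallyEq
    ((eventually_mem_times hJ hT X).mono fun z hz => (hg.deriv_time_eq_fderiv hz z.2).deriv)

theorem SmoothFor.deriv_comm (hJ : IsOpen J) (hg : SmoothFor J g) {T : ℝ} (hT : T ∈ J) (X : ℝ) :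
    deriv (fun s => deriv (g s) X) T = deriv (fun x => deriv (fun s => g s x) T) X := by
  set G : ℝ × ℝ → ℝ := fun z => g z.1 z.2
  have hG2 : DifferentiableAt ℝ (fderiv ℝ G) (T, X) :=
    ((hg T hT X).fderiv_right (m := ∞) (by simp)).differentiableAt (by simp)
  have key : ∀ v w : ℝ × ℝ, fderiv ℝ (fun z => fderiv ℝ G z v) (T, X) w
      = fderiv ℝ (fderiv ℝ G) (T, X) w v := by
    intro v w
    rw [fderiv_clm_apply hG2 (differentiableAt_const v)]
    simp
  have hsymm : IsSymmSndFDerivAt ℝ G (T, X) :=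
    (hg T hT X).isSymmSndFDerivAt (by simpa using two_le_smooth)
  have e1 := ((hg.dX hJ).deriv_time_eq_fderiv hT X).deriv
  have e2 := (hg.dT hJ).deriv_eq_fderiv hT X
  rw [e1, e2]
  have c1 : fderiv ℝ (fun z : ℝ × ℝ => deriv (g z.1) z.2) (T, X)
      = fderiv ℝ (fun z => fderiv ℝ G z (0, 1)) (T, X) :=
    Filter.EventuallyEq.fderiv_eq
      ((eventually_mem_times hJ hT X).mono fun z hz => hg.deriv_eq_fderiv hz z.2)
  have c2 : fderiv ℝ (fun z : ℝ × ℝ => deriv (fun s => g s z.2) z.1) (T, X)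
      = fderiv ℝ (fun z => fderiv ℝ G z (1, 0)) (T, X) :=
    Filter.EventuallyEq.fderiv_eq
      ((eventually_mem_times hJ hT X).mono fun z hz => (hg.deriv_time_eq_fderiv hz z.2).deriv)
  rw [c1, c2, key, key]
  exact hsymm _ _

theorem smoothFor_univ_iff : SmoothFor univ g ↔ ContDiff ℝ ∞ (fun z : ℝ × ℝ => g z.1 z.2) := by
  rw [contDiff_iff_contDiffAt]
  exact ⟨fun H z => H z.1 (mem_univ _) z.2, fun H T _ X => H (T, X)⟩

theorem SmoothFor.mono {J' : Set ℝ} (hg : SmoothFor J g) (h : J' ⊆ J) : SmoothFor J' g :=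
  fun T hT X => hg T (h hT) X

theorem SmoothFor.isClassicalOn (hJ : IsOpen J) (hg : SmoothFor J g) : IsClassicalOn J g := by
  have hc : ∀ {k : ℝ → ℝ → ℝ}, SmoothFor J k →
      ContinuousOn (fun z : ℝ × ℝ => k z.1 z.2) (J ×ˢ univ) := fun hk z hz =>
    (hk z.1 hz.1 z.2).continuousAt.continuousWithinAt
  refine ⟨fun T hT X => (hg.hasDerivAt_time hT X).differentiableAt,
    fun T hT => (hg.contDiff hT).of_le two_le_smooth, hc hg, hc (hg.dT hJ),
    hc (hg.dX hJ), ?_⟩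
  have := hc ((hg.dX hJ).dX hJ)
  simpa only [iteratedDeriv_succ, iteratedDeriv_zero] using this

end Smooth

/-! ### The maximum principle on a bounded rectangle -/

/-- If the second derivative were positive, the critical point would also be a local minimum. The
function would then be locally constant, with second derivative 0. -/
theorem iteratedDeriv_two_nonpos_of_isLocalMax {f : ℝ → ℝ} {x : ℝ} (hf : ContinuousAt f x)
    (hx : IsLocalMax f x) : iteratedDeriv 2 f x ≤ 0 := by
  have h2 : iteratedDeriv 2 f = deriv (deriv f) := by
    simp only [iteratedDeriv_succ, iteratedDeriv_zero]
  rw [h2]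
  by_contra! hpos
  have hmin := isLocalMin_of_deriv_deriv_pos hpos hx.deriv_eq_zero hf
  have hconst : f =ᶠ[𝓝 x] fun _ => f x := by
    filter_upwards [hx, hmin] with y h1 h2 using le_antisymm h1 h2
  have h3 : deriv f =ᶠ[𝓝 x] fun _ => 0 := by
    have := hconst.deriv
    simpa using this
  have := h3.deriv_eq
  simp at this
  linarith

/-- A function on `[a, b] × [-L, L]`, centred at `Y`, that is nonpositive on the parabolic boundary
and cannot have a positive interior maximum is nonpositive. -/
theorem nonpos_of_no_positive_max {Z : ℝ → ℝ → ℝ} {a b p q : ℝ}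
    (hcont : ContinuousOn (fun z : ℝ × ℝ => Z z.1 z.2) (Icc a b ×ˢ Icc p q))
    (hT : ∀ T ∈ Ioc a b, ∀ X ∈ Ioo p q, DifferentiableAt ℝ (fun s => Z s X) T)
    (h0 : ∀ X ∈ Icc p q, Z a X ≤ 0)
    (hp : ∀ T ∈ Icc a b, Z T p ≤ 0) (hq : ∀ T ∈ Icc a b, Z T q ≤ 0)
    (hmax : ∀ T ∈ Ioc a b, ∀ X ∈ Ioo p q, 0 < Z T X → deriv (Z T) X = 0 →
      iteratedDeriv 2 (Z T) X ≤ 0 → 0 ≤ deriv (fun s => Z s X) T → False) :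
    ∀ T ∈ Icc a b, ∀ X ∈ Icc p q, Z T X ≤ 0 := by
  intro T hTm X hX
  by_contra! hpos
  obtain ⟨z, hz, hzmax⟩ := (isCompact_Icc.prod isCompact_Icc).exists_isMaxOn
    ⟨(T, X), hTm, hX⟩ hcont
  have hzpos : 0 < Z z.1 z.2 := lt_of_lt_of_le hpos (hzmax (a := (T, X)) ⟨hTm, hX⟩)
  have ha : a < z.1 := lt_of_le_of_ne hz.1.1 fun h => by
    have := h0 z.2 hz.2
    rw [h] at this
    linarith
  have hp' : p < z.2 := lt_of_le_of_ne hz.2.1 fun h => by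
    have := hp z.1 hz.1
    rw [h] at this
    linarith
  have hq' : z.2 < q := lt_of_le_of_ne hz.2.2 fun h => by
    have := hq z.1 hz.1
    rw [← h] at this
    linarith
  have hloc : IsLocalMax (Z z.1) z.2 := by
    filter_upwards [Ioo_mem_nhds hp' hq'] with x hx
    exact hzmax (a := (z.1, x)) ⟨hz.1, hx.1.le, hx.2.le⟩
  have hcx : ContinuousAt (Z z.1) z.2 := by
    have h1 : ContinuousOn (fun x => Z z.1 x) (Icc p q) :=
      hcont.comp (f := fun x => (z.1, x)) (by fun_prop) fun x hx => ⟨hz.1, hx⟩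
    exact h1.continuousAt (Icc_mem_nhds hp' hq')
  refine hmax z.1 ⟨ha, hz.1.2⟩ z.2 ⟨hp', hq'⟩ hzpos hloc.deriv_eq_zero
    (iteratedDeriv_two_nonpos_of_isLocalMax hcx hloc) ?_
  have hd := (hT z.1 ⟨ha, hz.1.2⟩ z.2 ⟨hp', hq'⟩).hasDerivAt
  -- The maximum may lie at the final time, so only difference quotients from the left are
  -- available.
  have hs := hd.hasDerivWithinAt (s := Iio z.1)
  rw [hasDerivWithinAt_iff_tendsto_slope' (by simp)] at hs
  refine ge_of_tendsto hs ?_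
  have : Ioo a z.1 ∈ 𝓝[<] z.1 := Ioo_mem_nhdsLT ha
  filter_upwards [this] with s hs
  rw [slope_def_field]
  refine div_nonneg_of_nonpos ?_ (by linarith [hs.2])
  have := hzmax (a := (s, z.2)) ⟨⟨hs.1.le, hs.2.le.trans hz.1.2⟩, hz.2⟩
  simpa using this

/-! ### Calculus of the inverse cubic profile -/

section Profile

variable {β T X : ℝ}

theorem width_pos (hβ : 0 < β) (hT : T < 0) (y : ℝ) : 0 < -T + 3 * β * y ^ 2 := by
  have : 0 ≤ 3 * β * y ^ 2 := by positivity
  linarith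

theorem slope_eq (hT : T < 0) : slope β T X = (-T + 3 * β * profile β T X ^ 2)⁻¹ := by
  rw [slope, abs_of_neg hT]

theorem slope_pos (hβ : 0 < β) (hT : T < 0) (X : ℝ) : 0 < slope β T X := by
  rw [slope_eq hT]
  exact inv_pos.2 (width_pos hβ hT _)

theorem slope_mul_width (hβ : 0 < β) (hT : T < 0) (X : ℝ) :
    slope β T X * (-T + 3 * β * profile β T X ^ 2) = 1 := by
  rw [slope_eq hT]
  exact inv_mul_cancel₀ (width_pos hβ hT _).ne'

/-- The inverse function theorem applies to (T, y) ↦ (T, Ty - βy³), whose Jacobian T - 3βy² is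
negative. The local inverse is the profile because the cubic has only one real root. -/
theorem smoothFor_profile (hβ : 0 < β) : SmoothFor (Iio 0) (profile β) := by
  intro T hT X
  have hT' : T < 0 := hT
  set y := profile β T X with hy
  set F : ℝ × ℝ → ℝ × ℝ := fun z => (z.1, z.1 * z.2 - β * z.2 ^ 3) with hF
  have hFs : ContDiffAt ℝ ∞ F (T, y) := by
    refine ContDiff.contDiffAt ?_
    simp only [hF]
    fun_prop
  have hne : T - 3 * β * y ^ 2 ≠ 0 := by
    have := width_pos hβ hT' y
    intro h
    linarith
  set F' : (ℝ × ℝ) ≃L[ℝ] (ℝ × ℝ) := (ContinuousLinearEquiv.refl ℝ ℝ).skewProd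
    (ContinuousLinearEquiv.unitsEquivAut ℝ (Units.mk0 _ hne)) (y • ContinuousLinearMap.id ℝ ℝ)
  have hFd : HasFDerivAt F (F' : (ℝ × ℝ) →L[ℝ] (ℝ × ℝ)) (T, y) := by
    have h1 : HasFDerivAt (fun z : ℝ × ℝ => z.1) (ContinuousLinearMap.fst ℝ ℝ ℝ) (T, y) :=
      hasFDerivAt_fst
    have h2 : HasFDerivAt (fun z : ℝ × ℝ => z.2) (ContinuousLinearMap.snd ℝ ℝ ℝ) (T, y) :=
      hasFDerivAt_snd
    have h3 := h1.prodMk ((h1.mul h2).sub ((h2.pow 3).const_mul β))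
    refine h3.congr_fderiv ?_
    ext <;> simp [F']
    ring
  have hstrict := hFs.hasStrictFDerivAt' hFd (by simp)
  have hsm := hFs.to_localInverse hFd (by simp)
  have hFe : F (T, y) = (T, X) := by
    simp only [hF, hy]
    rw [profile_spec hβ hT'.le]
  have hri := hstrict.eventually_right_inverse
  rw [hFe] at hsm hri
  refine (contDiffAt_snd.comp (T, X) hsm).congr_of_eventuallyEq ?_
  filter_upwards [hri, eventually_mem_times isOpen_Iio hT X] with z hz hzT
  have e1 := congrArg Prod.fst hz
  have e2 := congrArg Prod.snd hz
  simp only [hF] at e1 e2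
  refine profile_eq hβ (le_of_lt hzT) ?_
  rw [e1] at e2
  exact e2

theorem smoothFor_slope (hβ : 0 < β) : SmoothFor (Iio 0) (slope β) := by
  refine SmoothFor.congr isOpen_Iio
    (g := fun T X => (-T + 3 * β * profile β T X ^ 2)⁻¹) ?_ fun T hT X => slope_eq hT
  intro T hT X
  exact ((SmoothFor.time.neg.add ((SmoothFor.const (3 * β)).mul
    ((smoothFor_profile hβ).pow 2))) T hT X).inv (width_pos hβ hT _).ne'

theorem hasDerivAt_profile (hβ : 0 < β) (hT : T < 0) (X : ℝ) :
    HasDerivAt (profile β T) (-slope β T X) X := by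
  have h := (smoothFor_profile hβ).hasDerivAt hT X
  have h1 := (h.const_mul T).sub ((h.pow 3).const_mul β)
  have h2 : HasDerivAt (fun x => T * profile β T x - β * profile β T x ^ 3) 1 X := by
    have : (fun x => T * profile β T x - β * profile β T x ^ 3) = fun x => x :=
      funext fun x => profile_spec hβ hT.le x
    rw [this]
    exact hasDerivAt_id X
  have h3 := h1.unique h2
  have h4 := slope_mul_width hβ hT X
  convert h using 1
  have hw := (width_pos hβ hT (profile β T X)).ne'
  refine mul_right_cancel₀ hw ?_
  rw [neg_mul, h4]
  simp at h3
  linear_combination h3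

theorem hasDerivAt_profile_time (hβ : 0 < β) (hT : T < 0) (X : ℝ) :
    HasDerivAt (fun s => profile β s X) (profile β T X * slope β T X) T := by
  have h := (smoothFor_profile hβ).hasDerivAt_time hT X
  have h1 := ((hasDerivAt_id T).mul h).sub ((h.pow 3).const_mul β)
  have h2 : HasDerivAt (fun s => s * profile β s X - β * profile β s X ^ 3) 0 T := by
    refine (hasDerivAt_const T X).congr_of_eventuallyEq ?_
    filter_upwards [Iio_mem_nhds hT] with s hs using profile_spec hβ (le_of_lt hs) X
  have h3 := h1.unique h2
  have h4 := slope_mul_width hβ hT X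
  convert h using 1
  have hw := (width_pos hβ hT (profile β T X)).ne'
  refine mul_right_cancel₀ hw ?_
  rw [mul_assoc, h4]
  simp at h3
  linear_combination h3

theorem hasDerivAt_slope (hβ : 0 < β) (hT : T < 0) (X : ℝ) :
    HasDerivAt (slope β T) (6 * β * profile β T X * slope β T X ^ 3) X := by
  have h := hasDerivAt_profile hβ hT X
  have hw := (width_pos hβ hT (profile β T X)).ne'
  have h1 := (((h.pow 2).const_mul (3 * β)).const_add (-T)).inv hw
  have h2 : slope β T = fun x => (-T + 3 * β * profile β T x ^ 2)⁻¹ := funext fun x => slope_eq hT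
  rw [h2]
  refine h1.congr_deriv ?_
  rw [slope_eq hT]
  simp
  field_simp
  try ring

theorem hasDerivAt_slope_time (hβ : 0 < β) (hT : T < 0) (X : ℝ) :
    HasDerivAt (fun s => slope β s X)
      (slope β T X ^ 2 - 6 * β * profile β T X ^ 2 * slope β T X ^ 3) T := by
  have h := hasDerivAt_profile_time hβ hT X
  have hw := (width_pos hβ hT (profile β T X)).ne'
  have h1 := ((hasDerivAt_id T).neg.add ((h.pow 2).const_mul (3 * β))).inv hw
  have h2 : (fun s => slope β s X) =ᶠ[𝓝 T] fun s => (-s + 3 * β * profile β s X ^ 2)⁻¹ := by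
    filter_upwards [Iio_mem_nhds hT] with s hs using slope_eq hs
  refine (h1.congr_of_eventuallyEq h2).congr_deriv ?_
  rw [slope_eq hT]
  simp
  field_simp
  ring

theorem profile_char (hβ : 0 < β) (hT : T < 0) (y : ℝ) : profile β T (T * y - β * y ^ 3) = y :=
  profile_eq hβ hT.le rfl

theorem slope_char (hβ : 0 < β) (hT : T < 0) (y : ℝ) :
    slope β T (T * y - β * y ^ 3) = (-T + 3 * β * y ^ 2)⁻¹ := by
  rw [slope_eq hT, profile_char hβ hT]

theorem dist_sq_eq (hβ : 0 < β) : dist β T X ^ 2 = |T| + 3 * β * profile β T X ^ 2 :=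
  Real.sq_sqrt (by positivity)

theorem dist_pos (hβ : 0 < β) (hT : T < 0) : 0 < dist β T X := by
  refine Real.sqrt_pos.2 ?_
  rw [abs_of_neg hT]
  exact width_pos hβ hT _

theorem slope_eq_dist (hβ : 0 < β) : slope β T X = dist β T X ^ (-2 : ℤ) := by
  rw [slope, zpow_neg, show dist β T X ^ (2 : ℤ) = dist β T X ^ 2 from rfl, dist_sq_eq hβ]

theorem abs_profile_le_dist (hβ : 0 < β) : |profile β T X| ≤ √(3 * β)⁻¹ * dist β T X := by
  rw [dist, ← Real.sqrt_mul (by positivity), ← Real.sqrt_sq_eq_abs]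
  refine Real.sqrt_le_sqrt ?_
  have : 0 ≤ (3 * β)⁻¹ * |T| := by positivity
  rw [mul_add, ← mul_assoc, inv_mul_cancel₀ (by positivity)]
  linarith

theorem sqrt_le_dist (hβ : 0 < β) : √|T| ≤ dist β T X :=
  Real.sqrt_le_sqrt (by have : 0 ≤ 3 * β * profile β T X ^ 2 := by positivity
                        linarith)

/-- On the complement of the rectangle the distance to the origin is bounded below. -/
theorem exists_le_dist (hβ : 0 < β) :
    ∃ c : ℝ, 0 < c ∧ ∀ T X, (T, X) ∈ rectangleCompl → c ≤ dist β T X := by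
  -- The threshold is chosen such that |T| ≤ 1 and |𝔲| < a ≤ 1 force |X| ≤ |𝔲| + β|𝔲|³ < 1, which
  -- puts the point into the rectangle.
  set a : ℝ := (1 + β)⁻¹ with ha
  have hβ1 : 0 < 1 + β := by linarith
  have ha0 : 0 < a := inv_pos.2 hβ1
  have ha1 : a ≤ 1 := inv_le_one_of_one_le₀ (by linarith)
  refine ⟨min 1 (√(3 * β * a ^ 2)), lt_min one_pos (Real.sqrt_pos.2 (by positivity)), ?_⟩
  rintro T X ⟨hT, hQ⟩
  have hT' : T < 0 := hT
  by_cases h1 : T ≤ -1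
  · refine (min_le_left _ _).trans ?_
    refine le_trans ?_ (sqrt_le_dist hβ)
    rw [Real.one_le_sqrt, abs_of_neg hT']
    linarith
  · push Not at h1
    refine (min_le_right _ _).trans (Real.sqrt_le_sqrt ?_)
    have hX : 1 ≤ |X| := by
      by_contra! hX
      exact hQ ⟨⟨h1, hT'⟩, abs_lt.1 hX⟩
    have hu : a ≤ |profile β T X| := by
      by_contra! hlt
      have hs := profile_spec hβ hT'.le X
      set y := profile β T X
      have h2 : |X| ≤ |T| * |y| + β * |y| ^ 3 := by
        rw [← hs]
        refine (abs_sub _ _).trans ?_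
        rw [abs_mul, abs_mul, abs_pow, abs_of_pos hβ]
      have h3 : |T| ≤ 1 := by rw [abs_of_neg hT']; linarith
      have h4 : |y| ^ 3 ≤ |y| := by
        have := abs_nonneg y
        nlinarith [mul_nonneg this this]
      have h5 : |X| < (1 + β) * a := by
        nlinarith [abs_nonneg y]
      rw [ha, mul_inv_cancel₀ hβ1.ne'] at h5
      linarith
    have := pow_le_pow_left₀ ha0.le hu 2
    rw [sq_abs] at this
    have h6 : 3 * β * a ^ 2 ≤ 3 * β * profile β T X ^ 2 :=
      mul_le_mul_of_nonneg_left this (by positivity)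
    linarith [abs_nonneg T]

end Profile

/-! ### Symbol classes: decay of all space derivatives in the far field -/

/-- `g` is smooth in space at negative times, and its space derivatives of order `i ≤ n` are
`O(𝔇 ^ (r - 3 i))` on the complement of the rectangle. -/
def SymUpTo (β : ℝ) (n : ℕ) (r : ℤ) (g : ℝ → ℝ → ℝ) : Prop :=
  (∀ T < 0, ContDiff ℝ ∞ (g T)) ∧ ∀ i ≤ n, ∃ C : ℝ, ∀ T X : ℝ, (T, X) ∈ rectangleCompl →
    |iteratedDeriv i (g T) X| ≤ C * dist β T X ^ (r - 3 * (i : ℤ))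

/-- `SymUpTo` for all orders of differentiation. -/
def Sym (β : ℝ) (r : ℤ) (g : ℝ → ℝ → ℝ) : Prop := ∀ n, SymUpTo β n r g

section Sym

variable {β : ℝ} {n : ℕ} {r s : ℤ} {g h : ℝ → ℝ → ℝ}

theorem time_neg_of_mem {T X : ℝ} (h : (T, X) ∈ rectangleCompl) : T < 0 := h.1

theorem SymUpTo.exists_nonneg (hβ : 0 < β) (hg : SymUpTo β n r g) {i : ℕ} (hi : i ≤ n) :
    ∃ C : ℝ, 0 ≤ C ∧ ∀ T X : ℝ, (T, X) ∈ rectangleCompl →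
      |iteratedDeriv i (g T) X| ≤ C * dist β T X ^ (r - 3 * (i : ℤ)) := by
  obtain ⟨C, hC⟩ := hg.2 i hi
  refine ⟨|C|, abs_nonneg C, fun T X hz => (hC T X hz).trans ?_⟩
  have := dist_pos (X := X) hβ (time_neg_of_mem hz)
  exact mul_le_mul_of_nonneg_right (le_abs_self C) (by positivity)

theorem SymUpTo.congr (hg : SymUpTo β n r g) (h' : ∀ T < 0, ∀ X, h T X = g T X) :
    SymUpTo β n r h := by
  have e : ∀ T < 0, h T = g T := fun T hT => funext (h' T hT)
  refine ⟨fun T hT => e T hT ▸ hg.1 T hT, fun i hi => ?_⟩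
  obtain ⟨C, hC⟩ := hg.2 i hi
  exact ⟨C, fun T X hz => e T (time_neg_of_mem hz) ▸ hC T X hz⟩

theorem SymUpTo.zero : SymUpTo β n r (fun _ _ => 0) :=
  ⟨fun _ _ => contDiff_const, fun i _ => ⟨0, fun T X _ => by
    rw [show iteratedDeriv i (fun _ : ℝ => (0 : ℝ)) X = 0 by simp]
    simp⟩⟩

theorem contDiffAt_of_smooth {f : ℝ → ℝ} (hf : ContDiff ℝ ∞ f) (i : ℕ) (x : ℝ) :
    ContDiffAt ℝ i f x :=
  (hf.of_le (WithTop.coe_le_coe.2 (le_top : (i : ℕ∞) ≤ ⊤))).contDiffAt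

theorem SymUpTo.add (hg : SymUpTo β n r g) (hh : SymUpTo β n r h) :
    SymUpTo β n r (fun T X => g T X + h T X) := by
  refine ⟨fun T hT => (hg.1 T hT).add (hh.1 T hT), fun i hi => ?_⟩
  obtain ⟨C, hC⟩ := hg.2 i hi
  obtain ⟨D, hD⟩ := hh.2 i hi
  refine ⟨C + D, fun T X hz => ?_⟩
  have hT := time_neg_of_mem hz
  rw [show (fun T X => g T X + h T X) T = g T + h T from rfl, iteratedDeriv_add
    (contDiffAt_of_smooth (hg.1 T hT) i X) (contDiffAt_of_smooth (hh.1 T hT) i X), add_mul]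
  exact (abs_add_le _ _).trans (add_le_add (hC T X hz) (hD T X hz))

theorem SymUpTo.mul (hβ : 0 < β) (hg : SymUpTo β n r g) (hh : SymUpTo β n s h) :
    SymUpTo β n (r + s) (fun T X => g T X * h T X) := by
  refine ⟨fun T hT => (hg.1 T hT).mul (hh.1 T hT), fun i hi => ?_⟩
  have hG : ∀ j : ℕ, ∃ C : ℝ, 0 ≤ C ∧ (j ≤ n → ∀ T X : ℝ, (T, X) ∈ rectangleCompl →
      |iteratedDeriv j (g T) X| ≤ C * dist β T X ^ (r - 3 * (j : ℤ))) := fun j => by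
    by_cases hj : j ≤ n
    · obtain ⟨C, h0, hC⟩ := hg.exists_nonneg hβ hj
      exact ⟨C, h0, fun _ => hC⟩
    · exact ⟨0, le_rfl, fun h => absurd h hj⟩
  have hH : ∀ j : ℕ, ∃ C : ℝ, 0 ≤ C ∧ (j ≤ n → ∀ T X : ℝ, (T, X) ∈ rectangleCompl →
      |iteratedDeriv j (h T) X| ≤ C * dist β T X ^ (s - 3 * (j : ℤ))) := fun j => by
    by_cases hj : j ≤ n
    · obtain ⟨C, h0, hC⟩ := hh.exists_nonneg hβ hj
      exact ⟨C, h0, fun _ => hC⟩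
    · exact ⟨0, le_rfl, fun h => absurd h hj⟩
  choose C hC0 hC using hG
  choose D hD0 hD using hH
  refine ⟨∑ j ∈ Finset.range (i + 1), (i.choose j : ℝ) * (C j * D (i - j)), fun T X hz => ?_⟩
  have hT := time_neg_of_mem hz
  have hd := dist_pos (X := X) hβ hT
  rw [show (fun T X => g T X * h T X) T = g T * h T from rfl, iteratedDeriv_mul
    (contDiffAt_of_smooth (hg.1 T hT) i X) (contDiffAt_of_smooth (hh.1 T hT) i X),
    Finset.sum_mul]
  refine (Finset.abs_sum_le_sum_abs _ _).trans (Finset.sum_le_sum fun j hj => ?_)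
  have hji : j ≤ i := Nat.lt_succ_iff.1 (Finset.mem_range.1 hj)
  rw [abs_mul, abs_mul, Nat.abs_cast, mul_assoc, mul_assoc]
  refine mul_le_mul_of_nonneg_left ?_ (by positivity)
  have e : dist β T X ^ (r + s - 3 * (i : ℤ)) = dist β T X ^ (r - 3 * (j : ℤ)) *
      dist β T X ^ (s - 3 * ((i - j : ℕ) : ℤ)) := by
    rw [← zpow_add₀ hd.ne']
    congr 1
    omega
  rw [e]
  calc _ ≤ (C j * dist β T X ^ (r - 3 * (j : ℤ))) *
        (D (i - j) * dist β T X ^ (s - 3 * ((i - j : ℕ) : ℤ))) :=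
        mul_le_mul (hC j (hji.trans hi) T X hz) (hD (i - j) ((Nat.sub_le _ _).trans hi) T X hz)
          (abs_nonneg _) (mul_nonneg (hC0 j) (by positivity))
    _ = _ := by ring

/-- Weakening the order needs a positive lower bound for 𝔇. This is why the rectangle next to the
origin is removed. -/
theorem SymUpTo.mono (hβ : 0 < β) (hg : SymUpTo β n r g) (hrs : r ≤ s) : SymUpTo β n s g := by
  refine ⟨hg.1, fun i hi => ?_⟩
  obtain ⟨c, hc, hcd⟩ := exists_le_dist hβ
  obtain ⟨C, hC0, hC⟩ := hg.exists_nonneg hβ hi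
  refine ⟨C * (c ^ (s - r))⁻¹, fun T X hz => (hC T X hz).trans ?_⟩
  have hd := dist_pos (X := X) hβ (time_neg_of_mem hz)
  rw [mul_assoc]
  refine mul_le_mul_of_nonneg_left ?_ hC0
  rw [show s - 3 * (i : ℤ) = (s - r) + (r - 3 * (i : ℤ)) by ring, zpow_add₀ hd.ne', ← mul_assoc]
  refine le_mul_of_one_le_left (by positivity) ?_
  rw [inv_mul_eq_div, one_le_div (by positivity)]
  exact zpow_le_zpow_left₀ (by omega) hc.le (hcd T X hz)

theorem SymUpTo.of_le {m : ℕ} (hg : SymUpTo β n r g) (hm : m ≤ n) : SymUpTo β m r g :=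
  ⟨hg.1, fun i hi => hg.2 i (hi.trans hm)⟩

theorem SymUpTo.dX (hg : SymUpTo β (n + 1) r g) :
    SymUpTo β n (r - 3) (fun T X => deriv (g T) X) := by
  refine ⟨fun T hT => ?_, fun i hi => ?_⟩
  · exact ((contDiff_infty_iff_deriv (𝕜 := ℝ)).1 (hg.1 T hT)).2
  · obtain ⟨C, hC⟩ := hg.2 (i + 1) (by omega)
    refine ⟨C, fun T X hz => ?_⟩
    have := hC T X hz
    rw [iteratedDeriv_succ'] at this
    convert this using 3
    push_cast
    ring

/-- The induction step of all symbol estimates: it applies whenever the derivative is expressed by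
functions that are already controlled to order n. -/
theorem SymUpTo.succ (h0 : SymUpTo β 0 r g)
    (h1 : SymUpTo β n (r - 3) (fun T X => deriv (g T) X)) : SymUpTo β (n + 1) r g := by
  refine ⟨h0.1, fun i hi => ?_⟩
  cases i with
  | zero => exact h0.2 0 le_rfl
  | succ i =>
    obtain ⟨C, hC⟩ := h1.2 i (by omega)
    refine ⟨C, fun T X hz => ?_⟩
    rw [iteratedDeriv_succ']
    convert hC T X hz using 3
    push_cast
    ring

theorem SymUpTo.of_bound (hs : ∀ T < 0, ContDiff ℝ ∞ (g T)) {C : ℝ}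
    (hC : ∀ T < 0, ∀ X, |g T X| ≤ C * dist β T X ^ r) : SymUpTo β 0 r g := by
  refine ⟨hs, fun i hi => ⟨C, fun T X hz => ?_⟩⟩
  obtain rfl : i = 0 := by omega
  simpa using hC T (time_neg_of_mem hz) X

theorem SymUpTo.const (c : ℝ) : SymUpTo β n 0 (fun _ _ => c) := by
  have h0 : SymUpTo β 0 0 (fun _ _ => c) :=
    SymUpTo.of_bound (C := |c|) (fun _ _ => contDiff_const) (by simp)
  cases n with
  | zero => exact h0
  | succ n =>
    refine h0.succ ?_
    simp only [deriv_const]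
    exact SymUpTo.zero

theorem Sym.congr (hg : Sym β r g) (h' : ∀ T < 0, ∀ X, h T X = g T X) : Sym β r h :=
  fun n => (hg n).congr h'

theorem Sym.zero : Sym β r (fun _ _ => 0) := fun _ => SymUpTo.zero

theorem Sym.const (c : ℝ) : Sym β 0 (fun _ _ => c) := fun _ => SymUpTo.const c

theorem Sym.add (hg : Sym β r g) (hh : Sym β r h) : Sym β r (fun T X => g T X + h T X) :=
  fun n => (hg n).add (hh n)

theorem Sym.mul (hβ : 0 < β) (hg : Sym β r g) (hh : Sym β s h) :
    Sym β (r + s) (fun T X => g T X * h T X) := fun n => (hg n).mul hβ (hh n)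

theorem Sym.mono (hβ : 0 < β) (hg : Sym β r g) (hrs : r ≤ s) : Sym β s g :=
  fun n => (hg n).mono hβ hrs

theorem Sym.dX (hg : Sym β r g) : Sym β (r - 3) (fun T X => deriv (g T) X) :=
  fun n => (hg (n + 1)).dX

theorem Sym.contDiff (hg : Sym β r g) {T : ℝ} (hT : T < 0) : ContDiff ℝ ∞ (g T) := (hg 0).1 T hT

theorem Sym.differentiableAt (hg : Sym β r g) {T : ℝ} (hT : T < 0) (X : ℝ) :
    DifferentiableAt ℝ (g T) X := (hg.contDiff hT).differentiable (by simp) X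

theorem SymUpTo.const_mul (hβ : 0 < β) (c : ℝ) (hg : SymUpTo β n r g) :
    SymUpTo β n r (fun T X => c * g T X) := by
  simpa using (SymUpTo.const c).mul hβ hg

theorem Sym.const_mul (hβ : 0 < β) (c : ℝ) (hg : Sym β r g) : Sym β r (fun T X => c * g T X) :=
  fun n => (hg n).const_mul hβ c

theorem SymUpTo.sub (hβ : 0 < β) (hg : SymUpTo β n r g) (hh : SymUpTo β n r h) :
    SymUpTo β n r (fun T X => g T X - h T X) :=
  (hg.add (hh.const_mul hβ (-1))).congr fun T _ X => by ring

theorem Sym.sub (hβ : 0 < β) (hg : Sym β r g) (hh : Sym β r h) :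
    Sym β r (fun T X => g T X - h T X) := fun n => (hg n).sub hβ (hh n)

theorem Sym.sum {ι : Type*} {s : Finset ι} {G : ι → ℝ → ℝ → ℝ} (hG : ∀ i ∈ s, Sym β r (G i)) :
    Sym β r (fun T X => ∑ i ∈ s, G i T X) := by
  classical
  induction s using Finset.induction_on with
  | empty => simpa using Sym.zero
  | insert a s ha ih =>
    simp only [Finset.sum_insert ha]
    exact (hG a (Finset.mem_insert_self a s)).add
      (ih fun i hi => hG i (Finset.mem_insert_of_mem hi))

theorem Sym.pow (hβ : 0 < β) (hg : Sym β r g) (k : ℕ) : Sym β (k * r) (fun T X => g T X ^ k) := by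
  induction k with
  | zero => simpa using Sym.const 1
  | succ k ih =>
    have := ih.mul hβ hg
    simp only [← pow_succ] at this
    convert this using 1
    push_cast
    ring

/-- The relations ∂_X 𝔲 = -𝔪 and ∂_X 𝔪 = 6β𝔲𝔪³ close up, and both lower the order by exactly 3.
Hence a simultaneous induction starting from the pointwise bounds. -/
theorem symUpTo_profile_slope (hβ : 0 < β) (n : ℕ) :
    SymUpTo β n 1 (profile β) ∧ SymUpTo β n (-2) (slope β) := by
  have hu0 : SymUpTo β 0 1 (profile β) := SymUpTo.of_bound (C := √(3 * β)⁻¹)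
    (fun T hT => (smoothFor_profile hβ).contDiff hT) fun T hT X => by
      simpa using abs_profile_le_dist hβ
  have hm0 : SymUpTo β 0 (-2) (slope β) := SymUpTo.of_bound (C := 1)
    (fun T hT => (smoothFor_slope hβ).contDiff hT) fun T hT X => by
      rw [abs_of_pos (slope_pos hβ hT X), slope_eq_dist hβ, one_mul]
  induction n with
  | zero => exact ⟨hu0, hm0⟩
  | succ n ih =>
    refine ⟨hu0.succ ?_, hm0.succ ?_⟩
    · exact (ih.2.const_mul hβ (-1)).congr fun T hT X => by
        rw [(hasDerivAt_profile hβ hT X).deriv]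
        ring
    · have := (((ih.1.const_mul hβ (6 * β)).mul hβ ih.2).mul hβ ih.2).mul hβ ih.2
      refine this.congr fun T hT X => ?_
      rw [(hasDerivAt_slope hβ hT X).deriv]
      ring

theorem sym_profile (hβ : 0 < β) : Sym β 1 (profile β) := fun n => (symUpTo_profile_slope hβ n).1

theorem sym_slope (hβ : 0 < β) : Sym β (-2) (slope β) := fun n => (symUpTo_profile_slope hβ n).2

end Sym

/-! ### Polynomials in the profile and the slope -/

/-- The functions that agree at negative times with linear combinations of the monomials
`𝔲 ^ a * 𝔪 ^ b` with `a - 2 b = w` and `b ≥ B`. -/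
inductive ProfilePoly (β : ℝ) (w : ℤ) (B : ℕ) : (ℝ → ℝ → ℝ) → Prop
  | mono (c : ℝ) (a b : ℕ) (hw : (a : ℤ) - 2 * b = w) (hb : B ≤ b) :
      ProfilePoly β w B (fun T X => c * (profile β T X ^ a * slope β T X ^ b))
  | zero : ProfilePoly β w B (fun _ _ => 0)
  | add {g h : ℝ → ℝ → ℝ} (hg : ProfilePoly β w B g) (hh : ProfilePoly β w B h) :
      ProfilePoly β w B (fun T X => g T X + h T X)
  | congr {g h : ℝ → ℝ → ℝ} (hg : ProfilePoly β w B g) (he : ∀ T < 0, ∀ X, h T X = g T X) :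
      ProfilePoly β w B h

namespace ProfilePoly

variable {β : ℝ} {w v : ℤ} {B B' : ℕ} {g h : ℝ → ℝ → ℝ}

theorem weaken (hg : ProfilePoly β w B g) (hB : B' ≤ B) : ProfilePoly β w B' g := by
  induction hg with
  | mono c a b hw hb => exact .mono c a b hw (hB.trans hb)
  | zero => exact .zero
  | add _ _ ih1 ih2 => exact ih1.add ih2
  | congr _ he ih => exact ih.congr he

theorem const_mul (c : ℝ) (hg : ProfilePoly β w B g) :
    ProfilePoly β w B (fun T X => c * g T X) := by
  induction hg with
  | mono d a b hw hb => exact (ProfilePoly.mono (c * d) a b hw hb).congr fun T _ X => by ring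
  | zero => exact ProfilePoly.zero.congr fun T _ X => by ring
  | add _ _ ih1 ih2 => exact (ih1.add ih2).congr fun T _ X => by ring
  | congr _ he ih => exact ih.congr fun T hT X => by rw [he T hT X]

theorem sum {ι : Type*} {s : Finset ι} {G : ι → ℝ → ℝ → ℝ}
    (hG : ∀ i ∈ s, ProfilePoly β w B (G i)) : ProfilePoly β w B (fun T X => ∑ i ∈ s, G i T X) := by
  classical
  induction s using Finset.induction_on with
  | empty => simpa using ProfilePoly.zero
  | insert a s ha ih =>
    simp only [Finset.sum_insert ha]
    exact (hG a (Finset.mem_insert_self a s)).add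
      (ih fun i hi => hG i (Finset.mem_insert_of_mem hi))

theorem mul (hg : ProfilePoly β w B g) (hh : ProfilePoly β v B' h) :
    ProfilePoly β (w + v) (B + B') (fun T X => g T X * h T X) := by
  induction hg with
  | mono c a b hw hb =>
    induction hh with
    | mono c' a' b' hw' hb' =>
      exact (ProfilePoly.mono (c * c') (a + a') (b + b') (by push_cast; omega) (by omega)).congr
        fun T _ X => by ring
    | zero => exact ProfilePoly.zero.congr fun T _ X => by ring
    | add _ _ ih1 ih2 => exact (ih1.add ih2).congr fun T _ X => by ring
    | congr _ he ih => exact ih.congr fun T hT X => by rw [he T hT X]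
  | zero => exact ProfilePoly.zero.congr fun T _ X => by ring
  | add _ _ ih1 ih2 => exact (ih1.add ih2).congr fun T _ X => by ring
  | congr _ he ih => exact ih.congr fun T hT X => by rw [he T hT X]

theorem smoothFor (hβ : 0 < β) (hg : ProfilePoly β w B g) : SmoothFor (Iio 0) g := by
  induction hg with
  | mono c a b hw hb =>
    exact (SmoothFor.const c).mul (((smoothFor_profile hβ).pow a).mul ((smoothFor_slope hβ).pow b))
  | zero => exact SmoothFor.const 0
  | add _ _ ih1 ih2 => exact ih1.add ih2
  | congr _ he ih => exact ih.congr isOpen_Iio he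

theorem sym (hβ : 0 < β) (hg : ProfilePoly β w B g) : Sym β w g := by
  induction hg with
  | mono c a b hw hb =>
    have := (((sym_profile hβ).pow hβ a).mul hβ ((sym_slope hβ).pow hβ b)).const_mul hβ c
    rwa [show (a : ℤ) * 1 + b * -2 = w by omega] at this
  | zero => exact Sym.zero
  | add _ _ ih1 ih2 => exact ih1.add ih2
  | congr _ he ih => exact ih.congr he

theorem hasDerivAt_monomial (hβ : 0 < β) {T : ℝ} (hT : T < 0) (X : ℝ) (a b : ℕ) :
    HasDerivAt (fun X => profile β T X ^ a * slope β T X ^ b)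
      (-(a : ℝ) * (profile β T X ^ (a - 1) * slope β T X ^ (b + 1)) +
        6 * β * b * (profile β T X ^ (a + 1) * slope β T X ^ (b + 2))) X := by
  have h := ((hasDerivAt_profile hβ hT X).pow a).mul ((hasDerivAt_slope hβ hT X).pow b)
  refine h.congr_deriv ?_
  cases b with
  | zero => simp; ring
  | succ b => simp; ring

/-- A derivative that falls on 𝔲 produces one new factor 𝔪, and one that falls on 𝔪 produces two.
The number of guaranteed factors thus rises by at least one. -/
theorem dX (hβ : 0 < β) (hg : ProfilePoly β w B g) :
    ProfilePoly β (w - 3) (B + 1) (fun T X => deriv (g T) X) := by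
  induction hg with
  | mono c a b hw hb =>
    have h2 : ProfilePoly β (w - 3) (B + 1) (fun T X => c * (6 * β * b) *
        (profile β T X ^ (a + 1) * slope β T X ^ (b + 2))) :=
      ProfilePoly.mono _ _ _ (by push_cast; omega) (by omega)
    have h1 : ProfilePoly β (w - 3) (B + 1) (fun T X => -c * a *
        (profile β T X ^ (a - 1) * slope β T X ^ (b + 1))) := by
      -- For a = 0 the exponent a - 1 is truncated, but the coefficient -c a vanishes.
      cases a with
      | zero => exact ProfilePoly.zero.congr fun T _ X => by simp
      | succ a => exact ProfilePoly.mono _ _ _ (by push_cast at hw ⊢; omega) (by omega)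
    refine (h1.add h2).congr fun T hT X => ?_
    rw [((hasDerivAt_monomial hβ hT X a b).const_mul c).deriv]
    ring
  | zero => exact ProfilePoly.zero.congr fun T _ X => by simp
  | @add g h hg hh ih1 ih2 =>
    refine (ih1.add ih2).congr fun T hT X => ?_
    exact (((hg.smoothFor hβ).hasDerivAt hT X).add ((hh.smoothFor hβ).hasDerivAt hT X)).deriv
  | @congr g h _ he ih => exact ih.congr fun T hT X => by rw [funext (he T hT)]

/-- Differentiation of a function with a factor `𝔪` yields two further factors, except where it
acts on powers of `𝔲`. -/
theorem dX_dX_profile (hβ : 0 < β) :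
    ProfilePoly β (-5) 3 (fun T X => deriv (fun x => deriv (profile β T) x) X) := by
  refine (ProfilePoly.mono (-(6 * β)) 1 3 (by norm_num) le_rfl).congr fun T hT X => ?_
  have : (fun x => deriv (profile β T) x) = fun x => -slope β T x :=
    funext fun x => (hasDerivAt_profile hβ hT x).deriv
  rw [this]
  refine (hasDerivAt_slope hβ hT X).neg.deriv.trans ?_
  ring

/-- Along the characteristics of the profile a function with a factor `𝔪` tends to `0` as
`t → -∞`. -/
theorem tendsto_char (hβ : 0 < β) (hg : ProfilePoly β w B g) (hB : 1 ≤ B) (y : ℝ) :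
    Tendsto (fun T => g T (T * y - β * y ^ 3)) atBot (𝓝 0) := by
  have hev : ∀ᶠ T : ℝ in atBot, T < 0 := eventually_lt_atBot 0
  induction hg with
  | mono c a b hw hb =>
    have h1 : Tendsto (fun T : ℝ => (-T + 3 * β * y ^ 2)⁻¹) atBot (𝓝 0) :=
      (tendsto_atTop_add_const_right _ _ tendsto_neg_atBot_atTop).inv_tendsto_atTop
    have h2 := ((h1.pow b).const_mul (y ^ a)).const_mul c
    rw [zero_pow (by omega), mul_zero, mul_zero] at h2
    refine h2.congr' ?_
    filter_upwards [hev] with T hT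
    rw [profile_char hβ hT, slope_char hβ hT]
  | zero => exact tendsto_const_nhds
  | add _ _ ih1 ih2 => simpa using ih1.add ih2
  | congr _ he ih =>
    refine ih.congr' ?_
    filter_upwards [hev] with T hT
    rw [he T hT]

/-- Two factors 𝔪 outweigh one factor 1/𝔪. Applied to the forced part of an outer component, this
leaves only the free constant in the limit. -/
theorem tendsto_char_div_slope (hβ : 0 < β) (hg : ProfilePoly β w B g) (hB : 2 ≤ B) (y : ℝ) :
    Tendsto (fun T => (-T + 3 * β * y ^ 2) * g T (T * y - β * y ^ 3)) atBot (𝓝 0) := by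
  have hev : ∀ᶠ T : ℝ in atBot, T < 0 := eventually_lt_atBot 0
  induction hg with
  | mono c a b hw hb =>
    have h1 : Tendsto (fun T : ℝ => (-T + 3 * β * y ^ 2)⁻¹) atBot (𝓝 0) :=
      (tendsto_atTop_add_const_right _ _ tendsto_neg_atBot_atTop).inv_tendsto_atTop
    have h2 := ((h1.pow (b - 1)).const_mul (y ^ a)).const_mul c
    rw [zero_pow (by omega), mul_zero, mul_zero] at h2
    refine h2.congr' ?_
    filter_upwards [hev] with T hT
    have hw' := (width_pos hβ hT y).ne'
    rw [profile_char hβ hT, slope_char hβ hT]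
    obtain ⟨b, rfl⟩ : ∃ b', b = b' + 1 := ⟨b - 1, by omega⟩
    rw [Nat.add_sub_cancel, pow_succ (-T + 3 * β * y ^ 2)⁻¹ b]
    field_simp
  | zero => simp
  | add _ _ ih1 ih2 => simpa [mul_add] using ih1.add ih2
  | congr _ he ih =>
    refine ih.congr' ?_
    filter_upwards [hev] with T hT
    rw [he T hT]

end ProfilePoly

end ShockFormation

namespace ShockFormation

open Filter Topology Set MeasureTheory

/-! ### Integration along characteristics -/

section Characteristic

variable {β : ℝ}

theorem hasDerivAt_width_inv_pow {w s : ℝ} (hw : 0 < -s + w) (b : ℕ) :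
    HasDerivAt (fun s : ℝ => (-s + w)⁻¹ ^ (b + 1) / (b + 1)) ((-s + w)⁻¹ ^ (b + 2)) s := by
  have h := (((hasDerivAt_id s).neg.add_const w).inv hw.ne').pow (b + 1)
  refine (h.div_const ((b : ℝ) + 1)).congr_deriv ?_
  have : (b : ℝ) + 1 ≠ 0 := by positivity
  simp
  field_simp
  ring

theorem tendsto_width_inv_pow (w : ℝ) (b : ℕ) :
    Tendsto (fun s : ℝ => (-s + w)⁻¹ ^ (b + 1) / (b + 1)) atBot (𝓝 0) := by
  have h1 : Tendsto (fun s : ℝ => (-s + w)⁻¹) atBot (𝓝 0) :=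
    (tendsto_atTop_add_const_right _ _ tendsto_neg_atBot_atTop).inv_tendsto_atTop
  simpa using (h1.pow (b + 1)).div_const ((b : ℝ) + 1)

theorem integrableOn_width_inv_pow {w T : ℝ} (hw : 0 ≤ w) (hT : T < 0) (b : ℕ) :
    IntegrableOn (fun s : ℝ => (-s + w)⁻¹ ^ (b + 2)) (Iic T) := by
  -- After the reflection s ↦ -s the integrand is, up to sign, the derivative of a decreasing
  -- function with limit 0 at infinity.
  have h : IntegrableOn (fun s : ℝ => -(s + w)⁻¹ ^ (b + 2)) (Ioi (-T)) := by
    refine integrableOn_Ioi_deriv_of_nonpos' (g := fun s => (s + w)⁻¹ ^ (b + 1) / (b + 1)) (l := 0)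
      (fun s hs => ?_) (fun s hs => ?_) ?_
    · have hs' : -T ≤ s := hs
      have h1 := (hasDerivAt_width_inv_pow (w := w) (s := -s) (by linarith) b).comp s
        (hasDerivAt_neg s)
      simpa [Function.comp_def] using h1
    · have hs' : -T < s := hs
      have : 0 ≤ (s + w)⁻¹ := inv_nonneg.2 (by linarith)
      simp only [Left.neg_nonpos_iff]
      positivity
    · have := (tendsto_width_inv_pow w b).comp tendsto_neg_atTop_atBot
      simpa [Function.comp_def] using this
  have h2 := (Measure.measurePreserving_neg (volume : Measure ℝ)).integrableOn_comp_preimage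
    (Homeomorph.neg ℝ).measurableEmbedding |>.2 h.neg
  have h3 : (Neg.neg : ℝ → ℝ) ⁻¹' Ioi (-T) = Iio T := by
    ext s
    simp
  rw [h3] at h2
  rw [integrableOn_Iic_iff_integrableOn_Iio]
  simpa [Function.comp_def] using h2

theorem integral_width_inv_pow {w T : ℝ} (hw : 0 ≤ w) (hT : T < 0) (b : ℕ) :
    ∫ s in Iic T, (-s + w)⁻¹ ^ (b + 2) = (-T + w)⁻¹ ^ (b + 1) / (b + 1) := by
  have := integral_Iic_of_hasDerivAt_of_tendsto' (a := T) (m := 0)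
    (f := fun s => (-s + w)⁻¹ ^ (b + 1) / (b + 1)) (f' := fun s => (-s + w)⁻¹ ^ (b + 2))
    (fun s hs => hasDerivAt_width_inv_pow
      (by have : s ≤ T := hs
          linarith) b)
    (integrableOn_width_inv_pow hw hT b) (tendsto_width_inv_pow w b)
  simpa using this

theorem hasDerivAt_monomial_time (hβ : 0 < β) {T : ℝ} (hT : T < 0) (X : ℝ) (a b : ℕ) :
    HasDerivAt (fun s => profile β s X ^ a * slope β s X ^ b)
      (((a : ℝ) + b) * (profile β T X ^ a * slope β T X ^ (b + 1)) -
        6 * β * b * (profile β T X ^ (a + 2) * slope β T X ^ (b + 2))) T := by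
  have h := ((hasDerivAt_profile_time hβ hT X).pow a).mul ((hasDerivAt_slope_time hβ hT X).pow b)
  refine h.congr_deriv ?_
  cases a with
  | zero => cases b with
    | zero => simp
    | succ b => simp; ring
  | succ a => cases b with
    | zero => simp; ring
    | succ b => simp; ring

/-- The transport operator `∂ₜ v + ∂ₓ (𝔲 v)` on monomials in `𝔲` and `𝔪`. -/
theorem transport_monomial (hβ : 0 < β) {T : ℝ} (hT : T < 0) (X : ℝ) (c : ℝ) (a b : ℕ) :
    deriv (fun s => c * (profile β s X ^ a * slope β s X ^ b)) T +
      deriv (fun x => profile β T x * (c * (profile β T x ^ a * slope β T x ^ b))) X =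
    c * ((b : ℝ) - 1) * (profile β T X ^ a * slope β T X ^ (b + 1)) := by
  rw [((hasDerivAt_monomial_time hβ hT X a b).const_mul c).deriv]
  have h := (ProfilePoly.hasDerivAt_monomial hβ hT X (a + 1) b).const_mul c
  have e : (fun x => profile β T x * (c * (profile β T x ^ a * slope β T x ^ b)))
      = fun x => c * (profile β T x ^ (a + 1) * slope β T x ^ b) := by
    funext x
    ring
  rw [e, h.deriv]
  simp
  ring

/-- On a characteristic 𝔲 = y is fixed and 𝔪 = (-s + 3βy²)⁻¹, so the monomial 𝔲^a 𝔪^b integrates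
explicitly to 𝔲^a 𝔪^(b-1) / (b - 2). The condition b ≥ 3 makes the integral converge. Integrability
is carried along because additivity of the integral depends on it. -/
theorem ProfilePoly.characteristicIntegral_spec (hβ : 0 < β) {w : ℤ} {B : ℕ} {g : ℝ → ℝ → ℝ}
    (hg : ProfilePoly β w B g) (hB : 3 ≤ B) :
    (∀ T < 0, ∀ y : ℝ, IntegrableOn (fun s => (slope β s (s * y - β * y ^ 3))⁻¹ *
      g s (s * y - β * y ^ 3)) (Iic T)) ∧
    ProfilePoly β (w + 2) (B - 1) (characteristicIntegral β g) ∧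
    ∀ T < 0, ∀ X : ℝ, deriv (fun s => characteristicIntegral β g s X) T +
      deriv (fun x => profile β T x * characteristicIntegral β g T x) X = g T X := by
  induction hg with
  | mono c a b hw hb =>
    obtain ⟨d, rfl⟩ : ∃ d, b = d + 3 := ⟨b - 3, by omega⟩
    have hint : ∀ T < 0, ∀ y : ℝ, EqOn (fun s => (slope β s (s * y - β * y ^ 3))⁻¹ *
        (c * (profile β s (s * y - β * y ^ 3) ^ a * slope β s (s * y - β * y ^ 3) ^ (d + 3))))
        (fun s => c * y ^ a * (-s + 3 * β * y ^ 2)⁻¹ ^ (d + 2)) (Iic T) := by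
      intro T hT y s hs
      have hs0 : s < 0 := lt_of_le_of_lt hs hT
      have hne := (width_pos hβ hs0 y).ne'
      simp only [profile_char hβ hs0, slope_char hβ hs0]
      rw [pow_succ (-s + 3 * β * y ^ 2)⁻¹ (d + 2)]
      field_simp
    have hformula : ∀ T < 0, ∀ X, characteristicIntegral β (fun T X => c * (profile β T X ^ a *
        slope β T X ^ (d + 3))) T X =
        c / (d + 1) * (profile β T X ^ a * slope β T X ^ (d + 2)) := by
      intro T hT X
      rw [characteristicIntegral, setIntegral_congr_fun measurableSet_Iic (hint T hT _),
        integral_const_mul, integral_width_inv_pow (by positivity) hT, ← slope_eq hT]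
      ring
    have h3 : (d : ℝ) + 1 ≠ 0 := by positivity
    refine ⟨fun T hT y => ?_, ?_, fun T hT X => ?_⟩
    · rw [integrableOn_congr_fun (hint T hT y) measurableSet_Iic]
      exact (integrableOn_width_inv_pow (by positivity) hT d).const_mul _
    · exact (ProfilePoly.mono (c / (d + 1)) a (d + 2) (by push_cast at hw ⊢; omega)
        (by omega)).congr hformula
    · have e1 : (fun s => characteristicIntegral β (fun T X => c * (profile β T X ^ a *
        slope β T X ^ (d + 3))) s X) =ᶠ[𝓝 T]
          fun s => c / (d + 1) * (profile β s X ^ a * slope β s X ^ (d + 2)) := by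
        filter_upwards [Iio_mem_nhds hT] with s hs using hformula s hs X
      rw [e1.deriv_eq]
      simp only [hformula T hT]
      rw [transport_monomial hβ hT]
      push_cast
      field_simp
      ring
  | zero =>
    have h0 : characteristicIntegral β (fun _ _ => 0) = fun _ _ => 0 := by
      funext T X
      simp [characteristicIntegral]
    rw [h0]
    refine ⟨fun T _ y => ?_, ProfilePoly.zero, fun T _ X => by simp⟩
    simp
  | @add g h hg hh ih1 ih2 =>
    obtain ⟨i1, p1, d1⟩ := ih1
    obtain ⟨i2, p2, d2⟩ := ih2
    have hadd : ∀ T < 0, ∀ X, characteristicIntegral β (fun T X => g T X + h T X) T X =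
        characteristicIntegral β g T X + characteristicIntegral β h T X := by
      intro T hT X
      simp only [characteristicIntegral, mul_add]
      rw [integral_add (i1 T hT _) (i2 T hT _), mul_add]
    refine ⟨fun T hT y => ?_, (p1.add p2).congr hadd, fun T hT X => ?_⟩
    · simp only [mul_add]
      exact (i1 T hT y).add (i2 T hT y)
    · have e1 : (fun s => characteristicIntegral β (fun T X => g T X + h T X) s X) =ᶠ[𝓝 T]
          fun s => characteristicIntegral β g s X + characteristicIntegral β h s X := by
        filter_upwards [Iio_mem_nhds hT] with s hs using hadd s hs X
      rw [e1.deriv_eq]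
      simp only [hadd T hT]
      have s1 := p1.smoothFor hβ
      have s2 := p2.smoothFor hβ
      have hu := smoothFor_profile hβ
      have t1 := ((s1.hasDerivAt_time hT X).add (s2.hasDerivAt_time hT X)).deriv
      have t2 := (((hu.mul s1).hasDerivAt hT X).add ((hu.mul s2).hasDerivAt hT X)).deriv
      have e2 : (fun x => profile β T x * (characteristicIntegral β g T x +
          characteristicIntegral β h T x)) = (fun x => profile β T x *
          characteristicIntegral β g T x) + fun x => profile β T x *
          characteristicIntegral β h T x := by
        funext x
        simp [mul_add]
      rw [e2, t2]
      refine (congrArg₂ (· + ·) t1 rfl).trans ?_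
      rw [← d1 T hT X, ← d2 T hT X]
      ring
  | @congr g h hg he ih =>
    obtain ⟨i1, p1, d1⟩ := ih
    have hcongr : ∀ T < 0, ∀ y : ℝ, EqOn (fun s => (slope β s (s * y - β * y ^ 3))⁻¹ *
        h s (s * y - β * y ^ 3)) (fun s => (slope β s (s * y - β * y ^ 3))⁻¹ *
        g s (s * y - β * y ^ 3)) (Iic T) := by
      intro T hT y s hs
      simp only
      rw [he s (lt_of_le_of_lt hs hT)]
    have heq : ∀ T < 0, ∀ X, characteristicIntegral β h T X = characteristicIntegral β g T X := by
      intro T hT X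
      rw [characteristicIntegral, setIntegral_congr_fun measurableSet_Iic (hcongr T hT _)]
      rfl
    refine ⟨fun T hT y => ?_, p1.congr heq, fun T hT X => ?_⟩
    · rw [integrableOn_congr_fun (hcongr T hT y) measurableSet_Iic]
      exact i1 T hT y
    · have e1 : (fun s => characteristicIntegral β h s X) =ᶠ[𝓝 T]
          fun s => characteristicIntegral β g s X := by
        filter_upwards [Iio_mem_nhds hT] with s hs using heq s hs X
      rw [e1.deriv_eq]
      simp only [heq T hT]
      rw [d1 T hT X, he T hT X]

end Characteristic

end ShockFormation

namespace ShockFormation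

open Filter Topology Set

/-! ### The outer components as polynomials in the profile and the slope -/

section Outer

variable {f : ℝ → ℝ}

/-- The sum of all the terms in the equation of `u_{k,ℓ}` that do not contain `u_{k,ℓ}`. -/
noncomputable def outerForcing (f : ℝ → ℝ) (k ℓ : ℕ) (t x : ℝ) : ℝ :=
  -(1 / 2) * (∑ p ∈ Finset.HasAntidiagonal.antidiagonal k,
    ∑ q ∈ Finset.HasAntidiagonal.antidiagonal ℓ,
      if _h : p.1 + q.1 < k + ℓ ∧ p.2 + q.2 < k + ℓ then
        deriv (fun z => outerComponent f p.1 q.1 t z * outerComponent f p.2 q.2 t z) x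
      else 0)
    + (if _h : 0 < k then iteratedDeriv 2 (outerComponent f (k - 1) ℓ t) x else 0)

theorem outerComponent_zero_zero (f : ℝ → ℝ) : outerComponent f 0 0 = profile (beta₃ f) := by
  rw [outerComponent]
  simp

/-- The matching condition at time t₀ is forgotten here. All that follows uses only the form of the
component and the vanishing of the constant when its exponent would be negative. -/
theorem outerComponent_eq (f : ℝ → ℝ) {k ℓ : ℕ} (h : k + ℓ ≠ 0) :
    ∃ C : ℝ, (ℓ + 3 < 4 * k → C = 0) ∧ outerComponent f k ℓ = fun t x =>
      characteristicIntegral (beta₃ f) (outerForcing f k ℓ) t x +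
        C * unforced (beta₃ f) (ℓ + 3 - 4 * k) t x := by
  refine ⟨matchingCoeff f k ℓ (fun x => (∑ j : Fin ℓ, outerComponent f k j (startTime f) x) +
    characteristicIntegral (beta₃ f) (outerForcing f k ℓ) (startTime f) x), fun hk => ?_, ?_⟩
  · rw [matchingCoeff, if_neg (by omega)]
  · rw [outerComponent, if_neg h]
    rfl

/-- The side condition excludes exactly the two index pairs with a factor u_{0,0}. They are distinct
because (k, ℓ) ≠ (0, 0), and together they form the transport term. -/
theorem sum_antidiagonal_antidiagonal_split {M : Type*} [AddCommGroup M] {k ℓ : ℕ} (h : k + ℓ ≠ 0)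
    (a : ℕ → ℕ → ℕ → ℕ → M) :
    ∑ p ∈ Finset.HasAntidiagonal.antidiagonal k, ∑ q ∈ Finset.HasAntidiagonal.antidiagonal ℓ,
      a p.1 q.1 p.2 q.2 =
    (∑ p ∈ Finset.HasAntidiagonal.antidiagonal k, ∑ q ∈ Finset.HasAntidiagonal.antidiagonal ℓ,
      if _h : p.1 + q.1 < k + ℓ ∧ p.2 + q.2 < k + ℓ then a p.1 q.1 p.2 q.2 else 0)
      + (a 0 0 k ℓ + a k ℓ 0 0) := by
  classical
  simp only [← Finset.sum_product']
  set S := Finset.HasAntidiagonal.antidiagonal k ×ˢ Finset.HasAntidiagonal.antidiagonal ℓ with hS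
  rw [← sub_eq_iff_eq_add', ← Finset.sum_sub_distrib]
  have hmem : ∀ x ∈ S, x.1.1 + x.1.2 = k ∧ x.2.1 + x.2.2 = ℓ := fun x hx => by
    rw [hS, Finset.mem_product] at hx
    exact ⟨Finset.HasAntidiagonal.mem_antidiagonal.1 hx.1,
      Finset.HasAntidiagonal.mem_antidiagonal.1 hx.2⟩
  have hsub : ({((0, k), (0, ℓ)), ((k, 0), (ℓ, 0))} : Finset ((ℕ × ℕ) × (ℕ × ℕ))) ⊆ S := by
    intro x hx
    simp only [Finset.mem_insert, Finset.mem_singleton] at hx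
    rcases hx with rfl | rfl <;> simp [hS]
  rw [← Finset.sum_subset hsub, Finset.sum_pair]
  · simp
  · simp only [ne_eq, Prod.mk.injEq]
    omega
  · rintro ⟨⟨p1, p2⟩, ⟨q1, q2⟩⟩ hx hnot
    have hx' := hmem _ hx
    simp only [Finset.mem_insert, Finset.mem_singleton, Prod.mk.injEq, not_or] at hnot hx'
    rw [dif_pos (by simp only; omega)]
    simp

/-- Every component but 𝔲 has a factor 𝔪. A differentiated product of two of them has three factors
𝔪, and so has a twice differentiated component. The forcing can therefore be integrated from -∞, and
at least two factors remain in the result. -/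
theorem outerComponent_spec_aux (hf : IsShockDatum f) (k ℓ : ℕ) (h : k + ℓ ≠ 0) :
    ProfilePoly (beta₃ f) ((ℓ : ℤ) + 1 - 4 * k - 2) 3 (outerForcing f k ℓ) ∧
    ProfilePoly (beta₃ f) ((ℓ : ℤ) + 1 - 4 * k) 1 (outerComponent f k ℓ) := by
  induction hn : k + ℓ using Nat.strong_induction_on generalizing k ℓ with
  | _ n ih =>
  have hβ := beta₃_pos hf
  have hF : ProfilePoly (beta₃ f) ((ℓ : ℤ) + 1 - 4 * k - 2) 3 (outerForcing f k ℓ) := by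
    refine ProfilePoly.add (ProfilePoly.const_mul _ (ProfilePoly.sum fun p hp =>
      ProfilePoly.sum fun q hq => ?_)) ?_
    · have hp' := Finset.HasAntidiagonal.mem_antidiagonal.1 hp
      have hq' := Finset.HasAntidiagonal.mem_antidiagonal.1 hq
      split_ifs with hlt
      · have h1 := (ih _ (by omega) p.1 q.1 (by omega) rfl).2
        have h2 := (ih _ (by omega) p.2 q.2 (by omega) rfl).2
        have h3 := (h1.mul h2).dX hβ
        rwa [show ((q.1 : ℤ) + 1 - 4 * p.1 + (q.2 + 1 - 4 * p.2) - 3)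
          = ((ℓ : ℤ) + 1 - 4 * k - 2) by omega] at h3
      · exact ProfilePoly.zero
    · split_ifs with hk
      · simp only [iteratedDeriv_succ, iteratedDeriv_zero]
        -- The exception u_{0,0} = 𝔲 has no factor 𝔪, but its second derivative -6β𝔲𝔪³ has three.
        by_cases h0 : k - 1 + ℓ = 0
        · obtain ⟨rfl, rfl⟩ : k = 1 ∧ ℓ = 0 := by omega
          have := ProfilePoly.dX_dX_profile hβ
          simpa [outerComponent_zero_zero] using this
        · have h1 := (((ih _ (by omega) (k - 1) ℓ h0 rfl).2).dX hβ).dX hβ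
          rwa [show ((ℓ : ℤ) + 1 - 4 * ((k - 1 : ℕ) : ℤ) - 3 - 3)
            = ((ℓ : ℤ) + 1 - 4 * k - 2) by omega] at h1
      · exact ProfilePoly.zero
  refine ⟨hF, ?_⟩
  obtain ⟨C, hC0, hC⟩ := outerComponent_eq f h
  rw [hC]
  have h1 := (hF.characteristicIntegral_spec hβ le_rfl).2.1.weaken (B' := 1) (by omega)
  rw [sub_add_cancel] at h1
  refine h1.add ?_
  by_cases hk : ℓ + 3 < 4 * k
  · rw [hC0 hk]
    exact ProfilePoly.zero.congr fun T _ X => by simp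
  · exact (ProfilePoly.mono C (ℓ + 3 - 4 * k) 1 (by omega) le_rfl).congr fun T _ X => by
      simp [unforced]

theorem profilePoly_outerComponent (hf : IsShockDatum f) {k ℓ : ℕ} (h : k + ℓ ≠ 0) :
    ProfilePoly (beta₃ f) ((ℓ : ℤ) + 1 - 4 * k) 1 (outerComponent f k ℓ) :=
  (outerComponent_spec_aux hf k ℓ h).2

theorem profilePoly_profile (β : ℝ) : ProfilePoly β 1 0 (profile β) :=
  (ProfilePoly.mono 1 1 0 (by norm_num) le_rfl).congr fun T _ X => by simp

theorem profilePoly_outerComponent_zero (hf : IsShockDatum f) (k ℓ : ℕ) :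
    ProfilePoly (beta₃ f) ((ℓ : ℤ) + 1 - 4 * k) 0 (outerComponent f k ℓ) := by
  by_cases h : k + ℓ = 0
  · obtain ⟨rfl, rfl⟩ : k = 0 ∧ ℓ = 0 := by omega
    simpa [outerComponent_zero_zero] using profilePoly_profile (beta₃ f)
  · exact (profilePoly_outerComponent hf h).weaken (by omega)

theorem smoothFor_outerComponent (hf : IsShockDatum f) (k ℓ : ℕ) :
    SmoothFor (Iio 0) (outerComponent f k ℓ) :=
  (profilePoly_outerComponent_zero hf k ℓ).smoothFor (beta₃_pos hf)

/-- The differential equations of the outer components. -/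
theorem outerComponent_pde (hf : IsShockDatum f) (k ℓ : ℕ) {T : ℝ} (hT : T < 0) (X : ℝ) :
    deriv (fun s => outerComponent f k ℓ s X) T =
      -(1 / 2) * (∑ p ∈ Finset.HasAntidiagonal.antidiagonal k,
        ∑ q ∈ Finset.HasAntidiagonal.antidiagonal ℓ,
          deriv (fun z => outerComponent f p.1 q.1 T z * outerComponent f p.2 q.2 T z) X) +
      (if 0 < k then iteratedDeriv 2 (outerComponent f (k - 1) ℓ T) X else 0) := by
  have hβ := beta₃_pos hf
  by_cases h : k + ℓ = 0
  · obtain ⟨rfl, rfl⟩ : k = 0 ∧ ℓ = 0 := by omega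
    have hu := hasDerivAt_profile hβ hT X
    simp only [Finset.Nat.antidiagonal_zero, Finset.sum_singleton, outerComponent_zero_zero,
      lt_irrefl, if_false, add_zero]
    have h2 : deriv (fun z => profile (beta₃ f) T z * profile (beta₃ f) T z) X = _ :=
      (hu.mul hu).deriv
    rw [(hasDerivAt_profile_time hβ hT X).deriv, h2]
    ring
  · obtain ⟨C, hC0, hC⟩ := outerComponent_eq f h
    obtain ⟨-, p1, d1⟩ := (outerComponent_spec_aux hf k ℓ h).1.characteristicIntegral_spec hβ le_rfl
    have d2 : deriv (fun s => C * unforced (beta₃ f) (ℓ + 3 - 4 * k) s X) T +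
        deriv (fun x => profile (beta₃ f) T x * (C * unforced (beta₃ f) (ℓ + 3 - 4 * k) T x)) X
        = 0 := by
      have := transport_monomial hβ hT X C (ℓ + 3 - 4 * k) 1
      simpa [unforced] using this
    have su := smoothFor_profile hβ
    have s1 := p1.smoothFor hβ
    have s2 : SmoothFor (Iio 0) (fun T X => C * unforced (beta₃ f) (ℓ + 3 - 4 * k) T X) :=
      (SmoothFor.const C).mul ((su.pow _).mul (smoothFor_slope hβ))
    have e1 : deriv (fun s => outerComponent f k ℓ s X) T +
        deriv (fun x => profile (beta₃ f) T x * outerComponent f k ℓ T x) X =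
        outerForcing f k ℓ T X := by
      rw [hC]
      have t1 := ((s1.hasDerivAt_time hT X).add (s2.hasDerivAt_time hT X)).deriv
      have t2 := (((su.mul s1).hasDerivAt hT X).add ((su.mul s2).hasDerivAt hT X)).deriv
      have e2 : (fun x => profile (beta₃ f) T x * (characteristicIntegral (beta₃ f)
          (outerForcing f k ℓ) T x + C * unforced (beta₃ f) (ℓ + 3 - 4 * k) T x)) =
          (fun x => profile (beta₃ f) T x * characteristicIntegral (beta₃ f)
          (outerForcing f k ℓ) T x) + fun x => profile (beta₃ f) T x *
          (C * unforced (beta₃ f) (ℓ + 3 - 4 * k) T x) := by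
        funext x
        simp [mul_add]
      rw [e2, t2]
      refine (congrArg₂ (· + ·) t1 rfl).trans ?_
      linear_combination d1 T hT X + d2
    rw [sum_antidiagonal_antidiagonal_split h (fun a b c d => deriv (fun z =>
      outerComponent f a b T z * outerComponent f c d T z) X)]
    rw [← sub_eq_iff_eq_add.2 e1.symm]
    rw [outerForcing]
    simp only [outerComponent_zero_zero, dite_eq_ite]
    have e3 : (fun z => outerComponent f k ℓ T z * profile (beta₃ f) T z) =
        fun z => profile (beta₃ f) T z * outerComponent f k ℓ T z := funext fun z => mul_comm _ _
    rw [e3]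
    ring

/-- The behaviour of the outer components along the characteristics of the profile as
`t → -∞`. -/
theorem exists_outerCoeff (hf : IsShockDatum f) : ∃ C : ℕ → ℕ → ℝ,
    ∀ k ℓ, k + ℓ ≠ 0 → (ℓ + 3 < 4 * k → C k ℓ = 0) ∧ ∀ y : ℝ,
      Tendsto (fun T => (-T + 3 * beta₃ f * y ^ 2) * outerComponent f k ℓ T
        (T * y - beta₃ f * y ^ 3)) atBot (𝓝 (C k ℓ * y ^ (ℓ + 3 - 4 * k))) := by
  have hβ := beta₃_pos hf
  have key : ∀ k ℓ, ∃ C : ℝ, k + ℓ ≠ 0 → (ℓ + 3 < 4 * k → C = 0) ∧ ∀ y : ℝ,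
      Tendsto (fun T => (-T + 3 * beta₃ f * y ^ 2) * outerComponent f k ℓ T
        (T * y - beta₃ f * y ^ 3)) atBot (𝓝 (C * y ^ (ℓ + 3 - 4 * k))) := by
    intro k ℓ
    by_cases h : k + ℓ = 0
    · exact ⟨0, fun h' => absurd h h'⟩
    obtain ⟨C, hC0, hC⟩ := outerComponent_eq f h
    refine ⟨C, fun _ => ⟨hC0, fun y => ?_⟩⟩
    -- The forced part has two factors 𝔪 and disappears in the limit. The unforced part contributes
    -- exactly C yⁿ at each time.
    have h1 := ((outerComponent_spec_aux hf k ℓ h).1.characteristicIntegral_spec hβ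
      le_rfl).2.1.tendsto_char_div_slope hβ (by omega) y
    have h2 := h1.add_const (C * y ^ (ℓ + 3 - 4 * k))
    rw [zero_add] at h2
    refine h2.congr' ?_
    filter_upwards [eventually_lt_atBot (0 : ℝ)] with T hT
    have hw := (width_pos hβ hT y).ne'
    rw [hC]
    simp only [unforced, profile_char hβ hT, slope_char hβ hT]
    field_simp
  choose C hC using key
  exact ⟨C, hC⟩

end Outer

/-! ### Formal double power series with coefficients depending on time and space -/

/-- Formal power series in `κ` (counting viscosity) and `ε` (counting the inner order). -/
abbrev DoubleSeries : Type := PowerSeries (PowerSeries ℝ)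

namespace DoubleSeries

/-- The coefficient of `κ ^ k ε ^ ℓ`. -/
noncomputable def cf (k ℓ : ℕ) (F : DoubleSeries) : ℝ := PowerSeries.coeff ℓ (PowerSeries.coeff k F)

/-- The series with given coefficients. -/
noncomputable def ofCoeff (a : ℕ → ℕ → ℝ) : DoubleSeries :=
  PowerSeries.mk fun k => PowerSeries.mk fun ℓ => a k ℓ

/-- Constant series. -/
noncomputable def sc (c : ℝ) : DoubleSeries := PowerSeries.C (PowerSeries.C c)

/-- The variable that counts viscosity. -/
noncomputable def visc : DoubleSeries := PowerSeries.X

variable {F G : DoubleSeries} {k ℓ : ℕ}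

theorem ext_cf (h : ∀ k ℓ, cf k ℓ F = cf k ℓ G) : F = G :=
  PowerSeries.ext fun k => PowerSeries.ext fun ℓ => h k ℓ

@[simp] theorem cf_ofCoeff (a : ℕ → ℕ → ℝ) (k ℓ : ℕ) : cf k ℓ (ofCoeff a) = a k ℓ := by
  simp [cf, ofCoeff]

@[simp] theorem cf_add : cf k ℓ (F + G) = cf k ℓ F + cf k ℓ G := by simp [cf]

@[simp] theorem cf_sub : cf k ℓ (F - G) = cf k ℓ F - cf k ℓ G := by simp [cf]

@[simp] theorem cf_zero : cf k ℓ (0 : DoubleSeries) = 0 := by simp [cf]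

@[simp] theorem cf_sum {ι : Type*} (s : Finset ι) (H : ι → DoubleSeries) :
    cf k ℓ (∑ i ∈ s, H i) = ∑ i ∈ s, cf k ℓ (H i) := by simp [cf, map_sum]

theorem cf_mul : cf k ℓ (F * G) = ∑ p ∈ Finset.HasAntidiagonal.antidiagonal k,
    ∑ q ∈ Finset.HasAntidiagonal.antidiagonal ℓ, cf p.1 q.1 F * cf p.2 q.2 G := by
  simp [cf, PowerSeries.coeff_mul, map_sum]

@[simp] theorem cf_sc_mul (c : ℝ) : cf k ℓ (sc c * F) = c * cf k ℓ F := by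
  simp [cf, sc, PowerSeries.coeff_C_mul]

theorem cf_one : cf k ℓ (1 : DoubleSeries) = if k = 0 ∧ ℓ = 0 then 1 else 0 := by
  by_cases hk : k = 0 <;> by_cases hl : ℓ = 0 <;> simp [cf, PowerSeries.coeff_one, hk, hl]

theorem cf_sc (c : ℝ) : cf k ℓ (sc c) = if k = 0 ∧ ℓ = 0 then c else 0 := by
  have := cf_sc_mul (k := k) (ℓ := ℓ) (F := 1) c
  rw [mul_one] at this
  rw [this, cf_one]
  simp

theorem cf_visc_mul : cf k ℓ (visc * F) = if 0 < k then cf (k - 1) ℓ F else 0 := by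
  cases k with
  | zero => simp [cf, visc]
  | succ k => simp [cf, visc, PowerSeries.coeff_succ_X_mul]

theorem two_eq_sc : (2 : DoubleSeries) = sc 2 := by simp only [sc, map_ofNat]

/-- Coefficientwise differentiation. -/
def HasCoeffDeriv (F : ℝ → DoubleSeries) (F' : DoubleSeries) (x : ℝ) : Prop :=
  ∀ k ℓ, HasDerivAt (fun y => cf k ℓ (F y)) (cf k ℓ F') x

theorem HasCoeffDeriv.mul {F G : ℝ → DoubleSeries} {F' G' : DoubleSeries} {x : ℝ}
    (hF : HasCoeffDeriv F F' x) (hG : HasCoeffDeriv G G' x) :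
    HasCoeffDeriv (fun y => F y * G y) (F' * G x + F x * G') x := by
  intro k ℓ
  simp only [cf_mul, cf_add, ← Finset.sum_add_distrib]
  exact HasDerivAt.fun_sum fun p _ => HasDerivAt.fun_sum fun q _ =>
    (hF p.1 q.1).mul (hG p.2 q.2)

/-- Smoothness of all coefficients at negative times. -/
def SmoothCoeff (F : ℝ → ℝ → DoubleSeries) : Prop :=
  ∀ k ℓ, SmoothFor (Iio 0) (fun T X => cf k ℓ (F T X))

/-- The coefficientwise space derivative. -/
noncomputable def dX (F : ℝ → ℝ → DoubleSeries) (T X : ℝ) : DoubleSeries :=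
  ofCoeff fun k ℓ => deriv (fun x => cf k ℓ (F T x)) X

/-- The coefficientwise time derivative. -/
noncomputable def dT (F : ℝ → ℝ → DoubleSeries) (T X : ℝ) : DoubleSeries :=
  ofCoeff fun k ℓ => deriv (fun s => cf k ℓ (F s X)) T

section

variable {F G : ℝ → ℝ → DoubleSeries} {T : ℝ}

theorem SmoothCoeff.hasCoeffDeriv (hF : SmoothCoeff F) (hT : T < 0) (X : ℝ) :
    HasCoeffDeriv (F T) (dX F T X) X := fun k ℓ => by
  simpa [dX] using (hF k ℓ).hasDerivAt hT X

theorem SmoothCoeff.hasCoeffDeriv_time (hF : SmoothCoeff F) (hT : T < 0) (X : ℝ) :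
    HasCoeffDeriv (fun s => F s X) (dT F T X) T := fun k ℓ => by
  simpa [dT] using (hF k ℓ).hasDerivAt_time hT X

theorem dX_eq {X : ℝ} {F' : DoubleSeries} (h : HasCoeffDeriv (F T) F' X) : dX F T X = F' :=
  ext_cf fun k ℓ => by simpa [dX] using (h k ℓ).deriv

theorem dT_eq {X : ℝ} {F' : DoubleSeries} (h : HasCoeffDeriv (fun s => F s X) F' T) :
    dT F T X = F' :=
  ext_cf fun k ℓ => by simpa [dT] using (h k ℓ).deriv

theorem SmoothCoeff.dX (hF : SmoothCoeff F) : SmoothCoeff (dX F) := fun k ℓ => by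
  simpa [DoubleSeries.dX] using (hF k ℓ).dX isOpen_Iio

theorem SmoothCoeff.mul (hF : SmoothCoeff F) (hG : SmoothCoeff G) :
    SmoothCoeff (fun T X => F T X * G T X) := fun k ℓ => by
  simp only [cf_mul]
  exact SmoothFor.sum fun p _ => SmoothFor.sum fun q _ => (hF p.1 q.1).mul (hG p.2 q.2)

theorem SmoothCoeff.add (hF : SmoothCoeff F) (hG : SmoothCoeff G) :
    SmoothCoeff (fun T X => F T X + G T X) := fun k ℓ => by
  simpa using (hF k ℓ).add (hG k ℓ)

theorem SmoothCoeff.sub (hF : SmoothCoeff F) (hG : SmoothCoeff G) :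
    SmoothCoeff (fun T X => F T X - G T X) := fun k ℓ => by
  simpa using (hF k ℓ).sub (hG k ℓ)

theorem SmoothCoeff.const (A : DoubleSeries) : SmoothCoeff (fun _ _ => A) := fun _ _ =>
  SmoothFor.const _

theorem SmoothCoeff.sum {ι : Type*} {s : Finset ι} {H : ι → ℝ → ℝ → DoubleSeries}
    (hH : ∀ i ∈ s, SmoothCoeff (H i)) : SmoothCoeff (fun T X => ∑ i ∈ s, H i T X) := fun k ℓ => by
  simp only [cf_sum]
  exact SmoothFor.sum fun i hi => hH i hi k ℓ

theorem HasCoeffDeriv.add {F G : ℝ → DoubleSeries} {F' G' : DoubleSeries} {x : ℝ}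
    (hF : HasCoeffDeriv F F' x) (hG : HasCoeffDeriv G G' x) :
    HasCoeffDeriv (fun y => F y + G y) (F' + G') x := fun k ℓ => by
  simp only [cf_add]
  exact (hF k ℓ).add (hG k ℓ)

theorem HasCoeffDeriv.sub {F G : ℝ → DoubleSeries} {F' G' : DoubleSeries} {x : ℝ}
    (hF : HasCoeffDeriv F F' x) (hG : HasCoeffDeriv G G' x) :
    HasCoeffDeriv (fun y => F y - G y) (F' - G') x := fun k ℓ => by
  simp only [cf_sub]
  exact (hF k ℓ).sub (hG k ℓ)

theorem HasCoeffDeriv.const (A : DoubleSeries) (x : ℝ) : HasCoeffDeriv (fun _ => A) 0 x :=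
  fun k ℓ => by simpa using hasDerivAt_const x (cf k ℓ A)

theorem HasCoeffDeriv.const_mul {F : ℝ → DoubleSeries} {F' : DoubleSeries} {x : ℝ}
    (A : DoubleSeries) (hF : HasCoeffDeriv F F' x) : HasCoeffDeriv (fun y => A * F y) (A * F') x := by
  simpa using (HasCoeffDeriv.const A x).mul hF

theorem HasCoeffDeriv.sum {ι : Type*} {s : Finset ι} {H : ι → ℝ → DoubleSeries}
    {H' : ι → DoubleSeries} {x : ℝ} (hH : ∀ i ∈ s, HasCoeffDeriv (H i) (H' i) x) :
    HasCoeffDeriv (fun y => ∑ i ∈ s, H i y) (∑ i ∈ s, H' i) x := fun k ℓ => by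
  simp only [cf_sum]
  exact HasDerivAt.fun_sum fun i hi => hH i hi k ℓ

theorem HasCoeffDeriv.sc (x : ℝ) : HasCoeffDeriv (fun y => sc y) 1 x := fun k ℓ => by
  simp only [cf_sc, cf_one]
  split_ifs
  · exact hasDerivAt_id x
  · exact hasDerivAt_const x 0

theorem SmoothCoeff.time : SmoothCoeff (fun T _ => DoubleSeries.sc T) := fun k ℓ => by
  simp only [cf_sc]
  split_ifs
  · exact SmoothFor.time
  · exact SmoothFor.const 0

theorem SmoothCoeff.space : SmoothCoeff (fun _ X => DoubleSeries.sc X) := fun k ℓ => by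
  simp only [cf_sc]
  split_ifs
  · exact SmoothFor.space
  · exact SmoothFor.const 0

theorem dT_dX (hF : SmoothCoeff F) (hT : T < 0) (X : ℝ) :
    DoubleSeries.dT (DoubleSeries.dX F) T X = DoubleSeries.dX (DoubleSeries.dT F) T X := by
  refine ext_cf fun k ℓ => ?_
  simpa [DoubleSeries.dT, DoubleSeries.dX] using (hF k ℓ).deriv_comm isOpen_Iio hT X

/-- The operator `∂_T + U ∂_X - κ ∂_X²`. -/
noncomputable def flow (U F : ℝ → ℝ → DoubleSeries) (T X : ℝ) : DoubleSeries :=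
  DoubleSeries.dT F T X + U T X * DoubleSeries.dX F T X
    - visc * DoubleSeries.dX (DoubleSeries.dX F) T X

/-- `(U - 2 κ ∂_X) ^ n` applied to `1`. -/
noncomputable def opPow (U : ℝ → ℝ → DoubleSeries) : ℕ → ℝ → ℝ → DoubleSeries
  | 0 => fun _ _ => 1
  | n + 1 => fun T X => U T X * opPow U n T X - 2 * visc * DoubleSeries.dX (opPow U n) T X

theorem SmoothCoeff.opPow {U : ℝ → ℝ → DoubleSeries} (hU : SmoothCoeff U) (n : ℕ) :
    SmoothCoeff (opPow U n) := by
  induction n with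
  | zero => exact SmoothCoeff.const 1
  | succ n ih => exact (hU.mul ih).sub ((SmoothCoeff.const _).mul ih.dX)

/-- If `U` solves the Burgers equation with viscosity `κ`, then `∂_T + U ∂_X - κ ∂_X²` commutes
with `U - 2 κ ∂_X`. -/
theorem flow_opPow {U : ℝ → ℝ → DoubleSeries} (hU : SmoothCoeff U)
    (hB : ∀ T < 0, ∀ X, flow U U T X = 0) (n : ℕ) (T : ℝ) (hT : T < 0) (X : ℝ) :
    flow U (opPow U n) T X = 0 := by
  induction n generalizing T X with
  | zero =>
    have h1 : ∀ T X, DoubleSeries.dX (opPow U 0) T X = 0 := fun T X =>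
      dX_eq (HasCoeffDeriv.const 1 X)
    have h2 : DoubleSeries.dT (opPow U 0) T X = 0 := dT_eq (HasCoeffDeriv.const 1 T)
    have h3 : DoubleSeries.dX (DoubleSeries.dX (opPow U 0)) T X = 0 := by
      rw [show DoubleSeries.dX (opPow U 0) = fun _ _ => 0 from funext fun T => funext fun X => h1 T X]
      exact dX_eq (HasCoeffDeriv.const 0 X)
    rw [flow, h1, h2, h3]
    ring
  | succ n ih =>
    set a := opPow U n with ha
    have sa : SmoothCoeff a := hU.opPow n
    have dX1 : ∀ X, DoubleSeries.dX (opPow U (n + 1)) T X = DoubleSeries.dX U T X * a T X +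
        U T X * DoubleSeries.dX a T X - 2 * visc * DoubleSeries.dX (DoubleSeries.dX a) T X :=
      fun X => dX_eq (((hU.hasCoeffDeriv hT X).mul (sa.hasCoeffDeriv hT X)).sub
        ((sa.dX.hasCoeffDeriv hT X).const_mul _))
    have dX2 : DoubleSeries.dX (DoubleSeries.dX (opPow U (n + 1))) T X =
        (DoubleSeries.dX (DoubleSeries.dX U) T X * a T X +
          DoubleSeries.dX U T X * DoubleSeries.dX a T X) +
        (DoubleSeries.dX U T X * DoubleSeries.dX a T X +
          U T X * DoubleSeries.dX (DoubleSeries.dX a) T X) -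
        2 * visc * DoubleSeries.dX (DoubleSeries.dX (DoubleSeries.dX a)) T X := by
      refine dX_eq ?_
      rw [show DoubleSeries.dX (opPow U (n + 1)) T = _ from funext dX1]
      exact (((hU.dX.hasCoeffDeriv hT X).mul (sa.hasCoeffDeriv hT X)).add
        ((hU.hasCoeffDeriv hT X).mul (sa.dX.hasCoeffDeriv hT X))).sub
        ((sa.dX.dX.hasCoeffDeriv hT X).const_mul _)
    have dT1 : DoubleSeries.dT (opPow U (n + 1)) T X = DoubleSeries.dT U T X * a T X +
        U T X * DoubleSeries.dT a T X - 2 * visc * DoubleSeries.dT (DoubleSeries.dX a) T X :=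
      dT_eq (((hU.hasCoeffDeriv_time hT X).mul (sa.hasCoeffDeriv_time hT X)).sub
        ((sa.dX.hasCoeffDeriv_time hT X).const_mul _))
    have haT : ∀ X, DoubleSeries.dT a T X = visc * DoubleSeries.dX (DoubleSeries.dX a) T X -
        U T X * DoubleSeries.dX a T X := fun X => by
      have := ih T hT X
      rw [flow] at this
      linear_combination this
    have haXT : DoubleSeries.dT (DoubleSeries.dX a) T X =
        visc * DoubleSeries.dX (DoubleSeries.dX (DoubleSeries.dX a)) T X -
        (DoubleSeries.dX U T X * DoubleSeries.dX a T X +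
          U T X * DoubleSeries.dX (DoubleSeries.dX a) T X) := by
      rw [dT_dX sa hT]
      refine dX_eq ?_
      rw [show DoubleSeries.dT a T = _ from funext haT]
      exact ((sa.dX.dX.hasCoeffDeriv hT X).const_mul _).sub
        ((hU.hasCoeffDeriv hT X).mul (sa.dX.hasCoeffDeriv hT X))
    have hBu := hB T hT X
    rw [flow] at hBu ⊢
    rw [dX1, dX2, dT1, haXT, haT]
    -- The terms regroup as a · flow U + U · flow a - 2κ ∂_X (flow a). The last two vanish by the
    -- induction hypothesis, already inserted for the time derivatives of a.
    linear_combination a T X * hBu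

end

end DoubleSeries

end ShockFormation

namespace ShockFormation

open Filter Topology Set DoubleSeries

/-! ### The algebraic equation satisfied by the outer expansion -/

section OuterSeries

variable {f : ℝ → ℝ}

/-- The double series of all the outer components. -/
noncomputable def outerSeries (f : ℝ → ℝ) (T X : ℝ) : DoubleSeries :=
  ofCoeff fun k ℓ => outerComponent f k ℓ T X

theorem smoothCoeff_outerSeries (hf : IsShockDatum f) : SmoothCoeff (outerSeries f) := fun k ℓ => by
  simpa [outerSeries] using smoothFor_outerComponent hf k ℓ

theorem cf_dX_dX (F : ℝ → ℝ → DoubleSeries) (k ℓ : ℕ) (T X : ℝ) :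
    cf k ℓ (dX (dX F) T X) = iteratedDeriv 2 (fun x => cf k ℓ (F T x)) X := by
  simp [dX, iteratedDeriv_succ, iteratedDeriv_zero]

/-- The equations of the outer components are the coefficients of one Burgers equation with
viscosity κ: multiplication by κ shifts k - 1 to k. -/
theorem flow_outerSeries (hf : IsShockDatum f) (T : ℝ) (hT : T < 0) (X : ℝ) :
    flow (outerSeries f) (outerSeries f) T X = 0 := by
  have hs := smoothCoeff_outerSeries hf
  have hprod : ∀ k ℓ, cf k ℓ (2 * (outerSeries f T X * dX (outerSeries f) T X)) =
      ∑ p ∈ Finset.HasAntidiagonal.antidiagonal k, ∑ q ∈ Finset.HasAntidiagonal.antidiagonal ℓ,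
        deriv (fun z => outerComponent f p.1 q.1 T z * outerComponent f p.2 q.2 T z) X := by
    intro k ℓ
    have h1 := (hs.hasCoeffDeriv hT X).mul (hs.hasCoeffDeriv hT X) k ℓ
    have h2 : HasDerivAt (fun y => cf k ℓ (outerSeries f T y * outerSeries f T y))
        (∑ p ∈ Finset.HasAntidiagonal.antidiagonal k,
          ∑ q ∈ Finset.HasAntidiagonal.antidiagonal ℓ,
          deriv (fun z => outerComponent f p.1 q.1 T z * outerComponent f p.2 q.2 T z) X) X := by
      simp only [cf_mul, outerSeries, cf_ofCoeff]
      exact HasDerivAt.fun_sum fun p _ => HasDerivAt.fun_sum fun q _ =>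
        (((smoothFor_outerComponent hf p.1 q.1).mul
          (smoothFor_outerComponent hf p.2 q.2)).differentiableAt hT X).hasDerivAt
    rw [← h1.unique h2]
    congr 1
    ring
  refine ext_cf fun k ℓ => ?_
  have hp := hprod k ℓ
  rw [two_eq_sc, cf_sc_mul] at hp
  have hpde := outerComponent_pde hf k ℓ hT X
  rw [flow, cf_sub, cf_add, cf_visc_mul, cf_zero]
  have e1 : cf k ℓ (dT (outerSeries f) T X) = deriv (fun s => outerComponent f k ℓ s X) T := by
    simp [dT, outerSeries]
  have e2 : cf (k - 1) ℓ (dX (dX (outerSeries f)) T X) =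
      iteratedDeriv 2 (outerComponent f (k - 1) ℓ T) X := by
    rw [cf_dX_dX]
    simp [outerSeries]
  rw [e1, e2, hpde, ← hp]
  ring

/-- The coefficients of `(U - 2 κ ∂_X) ^ n` applied to `1`, for the outer expansion. -/
noncomputable def outerPow (f : ℝ → ℝ) (n k ℓ : ℕ) (T X : ℝ) : ℝ :=
  cf k ℓ (opPow (outerSeries f) n T X)

theorem outerPow_zero (f : ℝ → ℝ) (k ℓ : ℕ) (T X : ℝ) :
    outerPow f 0 k ℓ T X = if k = 0 ∧ ℓ = 0 then 1 else 0 := cf_one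

theorem outerPow_succ (f : ℝ → ℝ) (n k ℓ : ℕ) (T X : ℝ) :
    outerPow f (n + 1) k ℓ T X = ∑ p ∈ Finset.HasAntidiagonal.antidiagonal k,
      ∑ q ∈ Finset.HasAntidiagonal.antidiagonal ℓ,
        outerComponent f p.1 q.1 T X * outerPow f n p.2 q.2 T X -
      2 * (if 0 < k then deriv (outerPow f n (k - 1) ℓ T) X else 0) := by
  have h : opPow (outerSeries f) (n + 1) T X = outerSeries f T X * opPow (outerSeries f) n T X -
      2 * (visc * dX (opPow (outerSeries f) n) T X) := by
    rw [← mul_assoc]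
    rfl
  rw [outerPow, h, cf_sub, cf_mul, two_eq_sc, cf_sc_mul, cf_visc_mul]
  simp only [dX, cf_ofCoeff, outerSeries]
  rfl

theorem opPow_one (U : ℝ → ℝ → DoubleSeries) (T X : ℝ) : opPow U 1 T X = U T X := by
  have h1 : dX (opPow U 0) T X = 0 := dX_eq (HasCoeffDeriv.const 1 X)
  have h2 : opPow U 1 T X = U T X * 1 - 2 * visc * dX (opPow U 0) T X := rfl
  rw [h2, h1]
  ring

theorem outerPow_one (f : ℝ → ℝ) (k ℓ : ℕ) (T X : ℝ) :
    outerPow f 1 k ℓ T X = outerComponent f k ℓ T X := by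
  rw [outerPow, opPow_one, outerSeries, cf_ofCoeff]

/-- Only the coefficient with k = ℓ = 0, which is 𝔲ⁿ, lacks a factor 𝔪. In the recursion each
summand of another coefficient has a component other than 𝔲, a lower power's coefficient other than
the leading one, or an X-derivative. -/
theorem profilePoly_outerPow (hf : IsShockDatum f) (n k ℓ : ℕ) :
    ProfilePoly (beta₃ f) ((n : ℤ) + ℓ - 4 * k) (if k + ℓ = 0 then 0 else 1) (outerPow f n k ℓ) := by
  have hβ := beta₃_pos hf
  induction n generalizing k ℓ with
  | zero =>
    have : outerPow f 0 k ℓ = fun T X => if k = 0 ∧ ℓ = 0 then 1 else 0 :=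
      funext fun T => funext fun X => outerPow_zero f k ℓ T X
    rw [this]
    by_cases h : k + ℓ = 0
    · obtain ⟨rfl, rfl⟩ : k = 0 ∧ ℓ = 0 := by omega
      exact (ProfilePoly.mono 1 0 0 (by norm_num) (by simp)).congr fun T _ X => by simp
    · have h' : ¬(k = 0 ∧ ℓ = 0) := by omega
      simp only [h', if_false]
      exact ProfilePoly.zero
  | succ n ih =>
    have : outerPow f (n + 1) k ℓ = fun T X => ∑ p ∈ Finset.HasAntidiagonal.antidiagonal k,
        ∑ q ∈ Finset.HasAntidiagonal.antidiagonal ℓ,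
        outerComponent f p.1 q.1 T X * outerPow f n p.2 q.2 T X +
        (-2) * (if 0 < k then deriv (outerPow f n (k - 1) ℓ T) X else 0) :=
      funext fun T => funext fun X => by rw [outerPow_succ]; ring
    rw [this]
    refine ProfilePoly.add (ProfilePoly.sum fun p hp => ProfilePoly.sum fun q hq => ?_)
      (ProfilePoly.const_mul _ ?_)
    · have hp' := Finset.HasAntidiagonal.mem_antidiagonal.1 hp
      have hq' := Finset.HasAntidiagonal.mem_antidiagonal.1 hq
      have hw : ((q.1 : ℤ) + 1 - 4 * p.1) + ((n : ℤ) + q.2 - 4 * p.2) =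
          ((n + 1 : ℕ) : ℤ) + ℓ - 4 * k := by
        push_cast
        omega
      rw [← hw]
      by_cases h1 : p.1 + q.1 = 0
      · refine ((profilePoly_outerComponent_zero hf p.1 q.1).mul (ih p.2 q.2)).weaken ?_
        split_ifs <;> omega
      · refine ((profilePoly_outerComponent hf h1).mul (ih p.2 q.2)).weaken ?_
        split_ifs <;> omega
    · by_cases hk : 0 < k
      · simp only [hk, if_true]
        have h1 := (ih (k - 1) ℓ).dX hβ
        have hw : (n : ℤ) + ℓ - 4 * ((k - 1 : ℕ) : ℤ) - 3 = ((n + 1 : ℕ) : ℤ) + ℓ - 4 * k := by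
          push_cast
          omega
        rw [hw] at h1
        refine h1.weaken ?_
        split_ifs <;> omega
      · simp only [hk, if_false]
        exact ProfilePoly.zero

theorem outerPow_zero_zero (n : ℕ) (T X : ℝ) :
    outerPow f n 0 0 T X = profile (beta₃ f) T X ^ n := by
  induction n with
  | zero => simp [outerPow_zero]
  | succ n ih =>
    rw [outerPow_succ]
    simp only [Finset.Nat.antidiagonal_zero, Finset.sum_singleton, ih, outerComponent_zero_zero,
      lt_irrefl, if_false, pow_succ]
    ring

theorem tendsto_outerPow_char (hf : IsShockDatum f) (n k ℓ : ℕ) (y : ℝ) :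
    Tendsto (fun T => outerPow f n k ℓ T (T * y - beta₃ f * y ^ 3)) atBot
      (𝓝 (if k + ℓ = 0 then y ^ n else 0)) := by
  have hβ := beta₃_pos hf
  by_cases h : k + ℓ = 0
  · obtain ⟨rfl, rfl⟩ : k = 0 ∧ ℓ = 0 := by omega
    rw [if_pos rfl]
    refine tendsto_const_nhds.congr' ?_
    filter_upwards [eventually_lt_atBot (0 : ℝ)] with T hT
    rw [outerPow_zero_zero, profile_char hβ hT]
  · rw [if_neg h]
    have := profilePoly_outerPow hf n k ℓ
    rw [if_neg h] at this
    exact this.tendsto_char hβ le_rfl y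

/-- The coefficient with which `U ^ n`-type terms enter the algebraic equation of the expansion. -/
noncomputable def charCoeff (C : ℕ → ℕ → ℝ) (n k j : ℕ) : ℝ :=
  if 1 ≤ j ∧ 4 * k + n = j + 3 then C k j else 0

/-- At most one n satisfies 4k + n = ℓ + 3. For ℓ = 0 and k > 0 there is none, in accordance with C
k 0 = 0. -/
theorem sum_charCoeff (C : ℕ → ℕ → ℝ) {k ℓ N : ℕ} (h : k + ℓ ≠ 0) (hN : ℓ + 3 < N)
    (h0 : ℓ + 3 < 4 * k → C k ℓ = 0) (y : ℝ) :
    ∑ n ∈ Finset.range N, charCoeff C n k ℓ * y ^ n = C k ℓ * y ^ (ℓ + 3 - 4 * k) := by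
  by_cases hk : 4 * k ≤ ℓ + 3
  · rw [Finset.sum_eq_single (ℓ + 3 - 4 * k)]
    · rw [charCoeff, if_pos (by omega)]
    · intro n _ hn
      rw [charCoeff, if_neg (by omega), zero_mul]
    · intro hn
      exact absurd (Finset.mem_range.2 (by omega)) hn
  · rw [h0 (by omega), zero_mul]
    refine Finset.sum_eq_zero fun n _ => ?_
    rw [charCoeff, if_neg (by omega), zero_mul]

/-- The residual of the algebraic equation. -/
noncomputable def outerResidual (f : ℝ → ℝ) (C : ℕ → ℕ → ℝ) (N : ℕ) (T X : ℝ) : DoubleSeries :=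
  sc X - sc T * opPow (outerSeries f) 1 T X + sc (beta₃ f) * opPow (outerSeries f) 3 T X -
    ∑ n ∈ Finset.range N, ofCoeff (charCoeff C n) * opPow (outerSeries f) n T X

theorem cf_outerResidual (f : ℝ → ℝ) (C : ℕ → ℕ → ℝ) (N k ℓ : ℕ) (T X : ℝ) :
    cf k ℓ (outerResidual f C N T X) = (if k = 0 ∧ ℓ = 0 then X else 0) -
      T * outerPow f 1 k ℓ T X + beta₃ f * outerPow f 3 k ℓ T X -
      ∑ n ∈ Finset.range N, ∑ p ∈ Finset.HasAntidiagonal.antidiagonal k,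
        ∑ q ∈ Finset.HasAntidiagonal.antidiagonal ℓ,
          charCoeff C n p.1 q.1 * outerPow f n p.2 q.2 T X := by
  rw [outerResidual, cf_sub, cf_add, cf_sub, cf_sc, cf_sc_mul, cf_sc_mul, cf_sum]
  simp only [cf_mul, cf_ofCoeff]
  rfl

theorem smoothCoeff_outerResidual (hf : IsShockDatum f) (C : ℕ → ℕ → ℝ) (N : ℕ) :
    SmoothCoeff (outerResidual f C N) := by
  have hU := smoothCoeff_outerSeries hf
  exact ((SmoothCoeff.space.sub (SmoothCoeff.time.mul (hU.opPow 1))).add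
    ((SmoothCoeff.const _).mul (hU.opPow 3))).sub
    (SmoothCoeff.sum fun n _ => (SmoothCoeff.const _).mul (hU.opPow n))

theorem flow_outerResidual (hf : IsShockDatum f) (C : ℕ → ℕ → ℝ) (N : ℕ) (T : ℝ) (hT : T < 0)
    (X : ℝ) : flow (outerSeries f) (outerResidual f C N) T X = 0 := by
  have hU := smoothCoeff_outerSeries hf
  set a := opPow (outerSeries f) with ha
  have sa : ∀ n, SmoothCoeff (a n) := hU.opPow
  have hfl : ∀ n X, flow (outerSeries f) (a n) T X = 0 := fun n X =>
    flow_opPow hU (flow_outerSeries hf) n T hT X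
  have d1 : ∀ X, dX (outerResidual f C N) T X = 1 - sc T * dX (a 1) T X +
      sc (beta₃ f) * dX (a 3) T X -
      ∑ n ∈ Finset.range N, ofCoeff (charCoeff C n) * dX (a n) T X := fun X =>
    dX_eq ((((HasCoeffDeriv.sc X).sub (((sa 1).hasCoeffDeriv hT X).const_mul _)).add
      (((sa 3).hasCoeffDeriv hT X).const_mul _)).sub
      (HasCoeffDeriv.sum fun n _ => ((sa n).hasCoeffDeriv hT X).const_mul _))
  have d2 : dX (dX (outerResidual f C N)) T X = 0 - sc T * dX (dX (a 1)) T X +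
      sc (beta₃ f) * dX (dX (a 3)) T X -
      ∑ n ∈ Finset.range N, ofCoeff (charCoeff C n) * dX (dX (a n)) T X := by
    refine dX_eq ?_
    rw [show dX (outerResidual f C N) T = _ from funext d1]
    exact (((HasCoeffDeriv.const 1 X).sub (((sa 1).dX.hasCoeffDeriv hT X).const_mul _)).add
      (((sa 3).dX.hasCoeffDeriv hT X).const_mul _)).sub
      (HasCoeffDeriv.sum fun n _ => ((sa n).dX.hasCoeffDeriv hT X).const_mul _)
  have dt : dT (outerResidual f C N) T X = 0 - (1 * a 1 T X + sc T * dT (a 1) T X) +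
      sc (beta₃ f) * dT (a 3) T X -
      ∑ n ∈ Finset.range N, ofCoeff (charCoeff C n) * dT (a n) T X :=
    dT_eq ((((HasCoeffDeriv.const _ T).sub
      ((HasCoeffDeriv.sc T).mul ((sa 1).hasCoeffDeriv_time hT X))).add
      (((sa 3).hasCoeffDeriv_time hT X).const_mul _)).sub
      (HasCoeffDeriv.sum fun n _ => ((sa n).hasCoeffDeriv_time hT X).const_mul _))
  have ha1 : a 1 T X = outerSeries f T X := opPow_one _ T X
  have hsum : ∑ n ∈ Finset.range N, ofCoeff (charCoeff C n) * dT (a n) T X +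
      outerSeries f T X * ∑ n ∈ Finset.range N, ofCoeff (charCoeff C n) * dX (a n) T X -
      visc * ∑ n ∈ Finset.range N, ofCoeff (charCoeff C n) * dX (dX (a n)) T X = 0 := by
    rw [Finset.mul_sum, Finset.mul_sum, ← Finset.sum_add_distrib, ← Finset.sum_sub_distrib]
    refine Finset.sum_eq_zero fun n _ => ?_
    have := hfl n X
    rw [flow] at this
    linear_combination ofCoeff (charCoeff C n) * this
  have h1 := hfl 1 X
  have h3 := hfl 3 X
  rw [flow] at h1 h3 ⊢
  rw [d1, d2, dt]
  -- The flow of X is U and that of TU is U + T · flow U. They cancel because the first power is U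
  -- itself.
  linear_combination (-1 : DoubleSeries) * ha1 - sc T * h1 + sc (beta₃ f) * h3 - hsum

/-- Along a characteristic all non-leading coefficients of the powers tend to 0. Of the residual
there remain -T u_{k,ℓ}, with limit C_{k,ℓ} yⁿ for n = ℓ + 3 - 4k, and the same monomial from the
leading powers on the other side. -/
theorem tendsto_outerResidual_char (hf : IsShockDatum f) {C : ℕ → ℕ → ℝ}
    (hC : ∀ k ℓ, k + ℓ ≠ 0 → (ℓ + 3 < 4 * k → C k ℓ = 0) ∧ ∀ y : ℝ,
      Tendsto (fun T => (-T + 3 * beta₃ f * y ^ 2) * outerComponent f k ℓ T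
        (T * y - beta₃ f * y ^ 3)) atBot (𝓝 (C k ℓ * y ^ (ℓ + 3 - 4 * k))))
    {k ℓ N : ℕ} (hN : ℓ + 3 < N) (y : ℝ) :
    Tendsto (fun T => cf k ℓ (outerResidual f C N T (T * y - beta₃ f * y ^ 3))) atBot (𝓝 0) := by
  have hβ := beta₃_pos hf
  have hsum : Tendsto (fun T => ∑ n ∈ Finset.range N, ∑ p ∈ Finset.HasAntidiagonal.antidiagonal k,
        ∑ q ∈ Finset.HasAntidiagonal.antidiagonal ℓ,
          charCoeff C n p.1 q.1 * outerPow f n p.2 q.2 T (T * y - beta₃ f * y ^ 3)) atBot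
      (𝓝 (∑ n ∈ Finset.range N, charCoeff C n k ℓ * y ^ n)) := by
    refine tendsto_finsetSum _ fun n _ => ?_
    have : charCoeff C n k ℓ * y ^ n = ∑ p ∈ Finset.HasAntidiagonal.antidiagonal k,
        ∑ q ∈ Finset.HasAntidiagonal.antidiagonal ℓ,
          charCoeff C n p.1 q.1 * (if p.2 + q.2 = 0 then y ^ n else 0) := by
      rw [Finset.sum_eq_single (k, 0), Finset.sum_eq_single (ℓ, 0)]
      · simp
      · intro q hq hne
        have hq' := Finset.HasAntidiagonal.mem_antidiagonal.1 hq
        rw [if_neg, mul_zero]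
        intro h
        exact hne (Prod.ext (by simp only at h ⊢; omega) (by simp only at h ⊢; omega))
      · intro h
        exact absurd (Finset.HasAntidiagonal.mem_antidiagonal.2 (by simp)) h
      · intro p hp hne
        have hp' := Finset.HasAntidiagonal.mem_antidiagonal.1 hp
        refine Finset.sum_eq_zero fun q _ => ?_
        rw [if_neg, mul_zero]
        intro h
        exact hne (Prod.ext (by simp only; omega) (by simp only; omega))
      · intro h
        exact absurd (Finset.HasAntidiagonal.mem_antidiagonal.2 (by simp)) h
    rw [this]
    exact tendsto_finsetSum _ fun p _ => tendsto_finsetSum _ fun q _ =>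
      (tendsto_outerPow_char hf n p.2 q.2 y).const_mul _
  simp only [cf_outerResidual]
  by_cases h : k + ℓ = 0
  · obtain ⟨rfl, rfl⟩ : k = 0 ∧ ℓ = 0 := by omega
    refine tendsto_const_nhds.congr' ?_
    filter_upwards [eventually_lt_atBot (0 : ℝ)] with T hT
    simp only [outerPow_zero_zero, profile_char hβ hT, Finset.Nat.antidiagonal_zero,
      Finset.sum_singleton, charCoeff]
    simp
  · have hne : ¬(k = 0 ∧ ℓ = 0) := by omega
    obtain ⟨h0, hlim⟩ := hC k ℓ h
    have h1 := tendsto_outerPow_char hf 1 k ℓ y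
    have h3 := tendsto_outerPow_char hf 3 k ℓ y
    rw [if_neg h] at h1 h3
    rw [sum_charCoeff C h hN h0] at hsum
    -- Here -T u is written as (-T + 3βy²) u - 3βy² u, whose second term tends to 0.
    have htot := (((hlim y).sub (h1.const_mul (3 * beta₃ f * y ^ 2))).add
      (h3.const_mul (beta₃ f))).sub hsum
    simp only [mul_zero, sub_zero, add_zero, sub_self] at htot
    refine htot.congr' ?_
    filter_upwards [eventually_lt_atBot (0 : ℝ)] with T hT
    rw [outerPow_one, if_neg hne]
    ring

/-- Once the lower coefficients of the residual vanish, the coefficient equation of `flow` is the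
pure transport equation ∂_T R + 𝔲 ∂_X R = 0. So R is constant along characteristics, and its limit
at T = -∞ is 0. -/
theorem outerResidual_eq_zero (hf : IsShockDatum f) {C : ℕ → ℕ → ℝ}
    (hC : ∀ k ℓ, k + ℓ ≠ 0 → (ℓ + 3 < 4 * k → C k ℓ = 0) ∧ ∀ y : ℝ,
      Tendsto (fun T => (-T + 3 * beta₃ f * y ^ 2) * outerComponent f k ℓ T
        (T * y - beta₃ f * y ^ 3)) atBot (𝓝 (C k ℓ * y ^ (ℓ + 3 - 4 * k))))
    {k ℓ N : ℕ} (hN : ℓ + 3 < N) : ∀ T < 0, ∀ X, cf k ℓ (outerResidual f C N T X) = 0 := by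
  have hβ := beta₃_pos hf
  have hs := smoothCoeff_outerResidual hf C N
  induction hn : k + ℓ using Nat.strong_induction_on generalizing k ℓ with
  | _ n ih =>
  have hdX0 : ∀ T < 0, ∀ X, ∀ k' ℓ', ℓ' ≤ ℓ → k' + ℓ' < n →
      cf k' ℓ' (dX (outerResidual f C N) T X) = 0 := by
    intro T hT X k' ℓ' hl hlt
    have : (fun x => cf k' ℓ' (outerResidual f C N T x)) = fun _ => 0 :=
      funext fun x => ih _ hlt (by omega) rfl T hT x
    simp [dX, this]
  have htransport : ∀ T < 0, ∀ X, deriv (fun s => cf k ℓ (outerResidual f C N s X)) T +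
      profile (beta₃ f) T X * deriv (fun x => cf k ℓ (outerResidual f C N T x)) X = 0 := by
    intro T hT X
    have h := congrArg (cf k ℓ) (flow_outerResidual hf C N T hT X)
    rw [flow, cf_sub, cf_add, cf_zero, cf_visc_mul, cf_mul] at h
    have h2 : (if 0 < k then cf (k - 1) ℓ (dX (dX (outerResidual f C N)) T X) else 0) = 0 := by
      split_ifs with hk
      · have : (fun x => cf (k - 1) ℓ (dX (outerResidual f C N) T x)) = fun _ => 0 :=
          funext fun x => hdX0 T hT x (k - 1) ℓ le_rfl (by omega)
        rw [dX, cf_ofCoeff, this]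
        simp
      · rfl
    have h3 : ∑ p ∈ Finset.HasAntidiagonal.antidiagonal k,
        ∑ q ∈ Finset.HasAntidiagonal.antidiagonal ℓ,
          cf p.1 q.1 (outerSeries f T X) * cf p.2 q.2 (dX (outerResidual f C N) T X) =
        profile (beta₃ f) T X * cf k ℓ (dX (outerResidual f C N) T X) := by
      rw [Finset.sum_eq_single (0, k), Finset.sum_eq_single (0, ℓ)]
      · simp [outerSeries, outerComponent_zero_zero]
      · intro q hq hne
        have hq' := Finset.HasAntidiagonal.mem_antidiagonal.1 hq
        rw [hdX0 T hT X _ _ (by omega), mul_zero]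
        by_contra hlt
        exact hne (Prod.ext (by simp only at hlt ⊢; omega) (by simp only at hlt ⊢; omega))
      · intro h
        exact absurd (Finset.HasAntidiagonal.mem_antidiagonal.2 (by simp)) h
      · intro p hp hne
        have hp' := Finset.HasAntidiagonal.mem_antidiagonal.1 hp
        refine Finset.sum_eq_zero fun q hq => ?_
        have hq' := Finset.HasAntidiagonal.mem_antidiagonal.1 hq
        rw [hdX0 T hT X _ _ (by omega), mul_zero]
        by_contra hlt
        exact hne (Prod.ext (by simp only; omega) (by simp only; omega))
      · intro h
        exact absurd (Finset.HasAntidiagonal.mem_antidiagonal.2 (by simp)) h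
    rw [h2, h3] at h
    simpa [dX, dT] using h
  have hconst : ∀ y : ℝ, ∀ T < 0,
      cf k ℓ (outerResidual f C N T (T * y - beta₃ f * y ^ 3)) = 0 := by
    intro y T hT
    set φ : ℝ → ℝ := fun s => cf k ℓ (outerResidual f C N s (s * y - beta₃ f * y ^ 3)) with hφ
    have hd : ∀ s ∈ Iio (0 : ℝ), HasDerivAt φ 0 s := by
      intro s hs'
      have hs0 : s < 0 := hs'
      have hF := (hs k ℓ).hasFDerivAt hs0 (s * y - beta₃ f * y ^ 3)
      have hc : HasDerivAt (fun s : ℝ => ((s, s * y - beta₃ f * y ^ 3) : ℝ × ℝ)) (1, y) s := by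
        refine (hasDerivAt_id s).prodMk ?_
        simpa using ((hasDerivAt_id s).mul_const y).sub_const (beta₃ f * y ^ 3)
      have h1 := hF.comp_hasDerivAt s hc
      refine h1.congr_deriv ?_
      have e1 := (hs k ℓ).deriv_eq_fderiv hs0 (s * y - beta₃ f * y ^ 3)
      have e2 := ((hs k ℓ).deriv_time_eq_fderiv hs0 (s * y - beta₃ f * y ^ 3)).deriv
      have e3 := htransport s hs0 (s * y - beta₃ f * y ^ 3)
      rw [profile_char hβ hs0, e1, e2] at e3
      -- The direction (1, y) of the characteristic is decomposed into the two coordinate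
      -- directions.
      rw [← e3, ← smul_eq_mul y, ← map_smul, ← map_add]
      simp
    have hconst' : ∀ s ∈ Iio (0 : ℝ), φ s = φ T := by
      intro s hs'
      exact isOpen_Iio.is_const_of_deriv_eq_zero (convex_Iio 0).isPreconnected
        (fun s hs => (hd s hs).differentiableAt.differentiableWithinAt)
        (fun s hs => (hd s hs).deriv) hs' hT
    have hlim := tendsto_outerResidual_char hf hC (k := k) hN y
    have hlim2 : Tendsto φ atBot (𝓝 (φ T)) := by
      refine tendsto_const_nhds.congr' ?_
      filter_upwards [eventually_lt_atBot (0 : ℝ)] with s hs' using (hconst' s hs').symm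
    exact tendsto_nhds_unique hlim2 hlim
  intro T hT X
  have := hconst (profile (beta₃ f) T X) T hT
  rwa [profile_spec hβ hT.le] at this

/-- The algebraic equation of the outer expansion, coefficient by coefficient. -/
theorem outerPow_equation (hf : IsShockDatum f) {C : ℕ → ℕ → ℝ}
    (hC : ∀ k ℓ, k + ℓ ≠ 0 → (ℓ + 3 < 4 * k → C k ℓ = 0) ∧ ∀ y : ℝ,
      Tendsto (fun T => (-T + 3 * beta₃ f * y ^ 2) * outerComponent f k ℓ T
        (T * y - beta₃ f * y ^ 3)) atBot (𝓝 (C k ℓ * y ^ (ℓ + 3 - 4 * k))))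
    (k ℓ : ℕ) {T : ℝ} (hT : T < 0) (X : ℝ) :
    (if k = 0 ∧ ℓ = 0 then X else 0) - T * outerComponent f k ℓ T X +
      beta₃ f * outerPow f 3 k ℓ T X =
      ∑ n ∈ Finset.range (ℓ + 4), ∑ p ∈ Finset.HasAntidiagonal.antidiagonal k,
        ∑ q ∈ Finset.HasAntidiagonal.antidiagonal ℓ,
          charCoeff C n p.1 q.1 * outerPow f n p.2 q.2 T X := by
  have h := outerResidual_eq_zero hf hC (k := k) (ℓ := ℓ) (N := ℓ + 4) (by omega) T hT X
  rw [cf_outerResidual, outerPow_one] at h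
  linarith

end OuterSeries

end ShockFormation

namespace ShockFormation

open Filter Topology Set MeasureTheory
open Polynomial (eval derivative)

/-! ### Exponential moments -/

/-- The weight `exp (-X y / 2 + T y² / 4 - β y⁴ / 8)`, a solution of the heat equation in `(T, X)`. -/
noncomputable def weight (β T X y : ℝ) : ℝ :=
  Real.exp (-(X * y) / 2 + T * y ^ 2 / 4 - β * y ^ 4 / 8)

/-- The integral of the polynomial `p` against the weight. -/
noncomputable def moment (β : ℝ) (p : Polynomial ℝ) (T X : ℝ) : ℝ :=
  ∫ y, p.eval y * weight β T X y

section Moment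

variable {β : ℝ}

theorem weight_pos (β T X y : ℝ) : 0 < weight β T X y := Real.exp_pos _

theorem continuous_weight (β T X : ℝ) : Continuous (weight β T X) := by
  unfold weight
  fun_prop

theorem exists_weight_le (hβ : 0 < β) (R : ℝ) : ∃ C : ℝ, 0 ≤ C ∧ ∀ T X y : ℝ, |T| ≤ R → |X| ≤ R →
    weight β T X y ≤ C * Real.exp (-2 * y ^ 2) := by
  refine ⟨Real.exp (R / 4 + 2 * (R / 2 + 2) ^ 2 / β), (Real.exp_pos _).le,
    fun T X y hT hX => ?_⟩
  rw [weight, ← Real.exp_add]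
  refine Real.exp_le_exp.2 ?_
  have h1 : -(X * y) ≤ R * ((1 + y ^ 2) / 2) := by
    have h2 : |X * y| ≤ R * |y| := by
      rw [abs_mul]
      exact mul_le_mul_of_nonneg_right hX (abs_nonneg y)
    have h3 : |y| ≤ (1 + y ^ 2) / 2 := by
      have := sq_nonneg (|y| - 1)
      rw [sub_sq, sq_abs] at this
      linarith
    have hR : 0 ≤ R := (abs_nonneg _).trans hX
    exact (neg_le_abs _).trans (h2.trans (mul_le_mul_of_nonneg_left h3 hR))
  have h4 : T * y ^ 2 ≤ R * y ^ 2 :=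
    mul_le_mul_of_nonneg_right ((le_abs_self T).trans hT) (sq_nonneg y)
  -- The right side is the maximum of the left one over y². The summand 2 in R/2 + 2 pays for the
  -- factor exp(-2y²).
  have h5 : (R / 2 + 2) * y ^ 2 - β * y ^ 4 / 8 ≤ 2 * (R / 2 + 2) ^ 2 / β := by
    rw [le_div_iff₀ hβ]
    nlinarith [sq_nonneg (β * y ^ 2 - 4 * (R / 2 + 2))]
  linarith

theorem exists_abs_eval_le (p : Polynomial ℝ) :
    ∃ C : ℝ, 0 ≤ C ∧ ∀ y, |p.eval y| ≤ C * Real.exp (y ^ 2) := by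
  induction p using Polynomial.induction_on' with
  | add p q hp hq =>
    obtain ⟨C, hC0, hC⟩ := hp
    obtain ⟨D, hD0, hD⟩ := hq
    refine ⟨C + D, by positivity, fun y => ?_⟩
    rw [Polynomial.eval_add, add_mul]
    exact (abs_add_le _ _).trans (add_le_add (hC y) (hD y))
  | monomial n a =>
    refine ⟨|a| * (1 + n.factorial), by positivity, fun y => ?_⟩
    rw [Polynomial.eval_monomial, abs_mul, mul_assoc, abs_pow]
    refine mul_le_mul_of_nonneg_left ?_ (abs_nonneg a)
    have h1 : |y| ^ n ≤ 1 + (y ^ 2) ^ n := by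
      rw [← sq_abs, ← pow_mul, mul_comm 2 n, pow_mul]
      nlinarith [sq_nonneg (|y| ^ n - 1), pow_nonneg (abs_nonneg y) n]
    have h2 : (y ^ 2) ^ n ≤ n.factorial * Real.exp (y ^ 2) := by
      have := Real.pow_div_factorial_le_exp (y ^ 2) (sq_nonneg y) n
      rwa [div_le_iff₀' (by positivity)] at this
    have h3 : 1 ≤ Real.exp (y ^ 2) := Real.one_le_exp (sq_nonneg y)
    linarith

/-- An integrable bound, uniform for bounded (T, X), that allows differentiation under the integral
sign. -/
theorem exists_abs_eval_mul_weight_le (hβ : 0 < β) (p : Polynomial ℝ) (R : ℝ) :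
    ∃ C : ℝ, ∀ T X y : ℝ, |T| ≤ R → |X| ≤ R →
      |p.eval y| * weight β T X y ≤ C * Real.exp (-1 * y ^ 2) := by
  obtain ⟨C, hC0, hC⟩ := exists_abs_eval_le p
  obtain ⟨D, hD0, hD⟩ := exists_weight_le hβ R
  refine ⟨C * D, fun T X y hT hX => ?_⟩
  refine (mul_le_mul (hC y) (hD T X y hT hX) (weight_pos _ _ _ _).le
    (by positivity)).trans (le_of_eq ?_)
  rw [mul_mul_mul_comm, ← Real.exp_add]
  ring_nf

theorem integrable_eval_mul_weight (hβ : 0 < β) (p : Polynomial ℝ) (T X : ℝ) :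
    Integrable fun y => p.eval y * weight β T X y := by
  obtain ⟨C, hC⟩ := exists_abs_eval_mul_weight_le hβ p (max |T| |X|)
  refine ((integrable_exp_neg_mul_sq one_pos).const_mul C).mono'
    (p.continuous.mul (continuous_weight β T X)).aestronglyMeasurable (.of_forall fun y => ?_)
  rw [Real.norm_eq_abs, abs_mul, abs_of_pos (weight_pos _ _ _ _)]
  exact hC T X y (le_max_left _ _) (le_max_right _ _)

theorem moment_add (hβ : 0 < β) (p q : Polynomial ℝ) (T X : ℝ) :
    moment β (p + q) T X = moment β p T X + moment β q T X := by
  simp only [moment, Polynomial.eval_add, add_mul]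
  exact integral_add (integrable_eval_mul_weight hβ p T X) (integrable_eval_mul_weight hβ q T X)

theorem moment_C_mul (β c : ℝ) (p : Polynomial ℝ) (T X : ℝ) :
    moment β (Polynomial.C c * p) T X = c * moment β p T X := by
  simp only [moment, Polynomial.eval_mul, Polynomial.eval_C, mul_assoc]
  exact integral_const_mul _ _

theorem moment_zero (β T X : ℝ) : moment β 0 T X = 0 := by simp [moment]

theorem moment_sub (hβ : 0 < β) (p q : Polynomial ℝ) (T X : ℝ) :
    moment β (p - q) T X = moment β p T X - moment β q T X := by
  have : p - q = p + Polynomial.C (-1) * q := by simp [sub_eq_add_neg]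
  rw [this, moment_add hβ, moment_C_mul]
  ring

theorem moment_sum (hβ : 0 < β) {ι : Type*} (s : Finset ι) (p : ι → Polynomial ℝ) (T X : ℝ) :
    moment β (∑ i ∈ s, p i) T X = ∑ i ∈ s, moment β (p i) T X := by
  classical
  induction s using Finset.induction_on with
  | empty => simp [moment_zero]
  | insert a s ha ih => rw [Finset.sum_insert ha, Finset.sum_insert ha, moment_add hβ, ih]

theorem moment_nonneg {p : Polynomial ℝ} (hp : ∀ y, 0 ≤ p.eval y) (T X : ℝ) :
    0 ≤ moment β p T X :=
  integral_nonneg fun y => mul_nonneg (hp y) (weight_pos _ _ _ _).le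

theorem moment_mono (hβ : 0 < β) {p q : Polynomial ℝ} (hp : ∀ y, p.eval y ≤ q.eval y) (T X : ℝ) :
    moment β p T X ≤ moment β q T X := by
  rw [← sub_nonneg, ← moment_sub hβ]
  exact moment_nonneg (fun y => by simpa using hp y) T X

theorem moment_one_pos (hβ : 0 < β) (T X : ℝ) : 0 < moment β 1 T X := by
  have hi := integrable_eval_mul_weight hβ 1 T X
  rw [moment, integral_pos_iff_support_of_nonneg
    (fun y => by simpa using (weight_pos β T X y).le) hi]
  have : Function.support (fun y => Polynomial.eval y 1 * weight β T X y) = univ := by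
    ext y
    simpa using (weight_pos β T X y).ne'
  rw [this]
  simp

/-- The total derivative of the integrand. -/
noncomputable def weightFDeriv (β : ℝ) (p : Polynomial ℝ) (z : ℝ × ℝ) (y : ℝ) : ℝ × ℝ →L[ℝ] ℝ :=
  (1 / 4 * ((Polynomial.X ^ 2 * p).eval y * weight β z.1 z.2 y)) • ContinuousLinearMap.fst ℝ ℝ ℝ +
    (-(1 / 2) * ((Polynomial.X * p).eval y * weight β z.1 z.2 y)) • ContinuousLinearMap.snd ℝ ℝ ℝ

theorem hasFDerivAt_eval_mul_weight (β : ℝ) (p : Polynomial ℝ) (y : ℝ) (z : ℝ × ℝ) :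
    HasFDerivAt (fun z : ℝ × ℝ => p.eval y * weight β z.1 z.2 y) (weightFDeriv β p z y) z := by
  have h1 : HasFDerivAt (fun z : ℝ × ℝ => z.1) (ContinuousLinearMap.fst ℝ ℝ ℝ) z := hasFDerivAt_fst
  have h2 : HasFDerivAt (fun z : ℝ × ℝ => z.2) (ContinuousLinearMap.snd ℝ ℝ ℝ) z := hasFDerivAt_snd
  have h3 := (((h2.const_mul (-(y / 2))).add (h1.const_mul (y ^ 2 / 4))).add_const
    (-(β * y ^ 4 / 8))).exp.const_mul (p.eval y)
  have e : (fun z : ℝ × ℝ => p.eval y * weight β z.1 z.2 y) = fun z : ℝ × ℝ => p.eval y *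
      Real.exp (-(y / 2) * z.2 + y ^ 2 / 4 * z.1 + -(β * y ^ 4 / 8)) := by
    funext z
    rw [weight]
    ring_nf
  have e1 : Real.exp (-(y / 2) * z.2 + y ^ 2 / 4 * z.1 + -(β * y ^ 4 / 8)) =
      weight β z.1 z.2 y := by
    rw [weight]
    ring_nf
  rw [e]
  refine h3.congr_fderiv ?_
  simp only [Pi.add_apply]
  rw [e1]
  ext
  · simp [weightFDeriv]
    ring
  · simp [weightFDeriv]
    ring

theorem integrable_weightFDeriv (hβ : 0 < β) (p : Polynomial ℝ) (z : ℝ × ℝ) :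
    Integrable (weightFDeriv β p z) :=
  (((integrable_eval_mul_weight hβ (Polynomial.X ^ 2 * p) z.1 z.2).const_mul (1 / 4)).smul_const
    (ContinuousLinearMap.fst ℝ ℝ ℝ)).add
    (((integrable_eval_mul_weight hβ (Polynomial.X * p) z.1 z.2).const_mul (-(1 / 2))).smul_const
    (ContinuousLinearMap.snd ℝ ℝ ℝ))

/-- Differentiation in T and X multiplies the polynomial by y²/4 and -y/2. The class of moments is
thus closed under differentiation, which yields both smoothness and the heat equation. -/
theorem hasFDerivAt_moment (hβ : 0 < β) (p : Polynomial ℝ) (z : ℝ × ℝ) :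
    HasFDerivAt (fun z : ℝ × ℝ => moment β p z.1 z.2)
      ((1 / 4 * moment β (Polynomial.X ^ 2 * p) z.1 z.2) • ContinuousLinearMap.fst ℝ ℝ ℝ +
        (-(1 / 2) * moment β (Polynomial.X * p) z.1 z.2) • ContinuousLinearMap.snd ℝ ℝ ℝ) z := by
  obtain ⟨C, hC⟩ := exists_abs_eval_mul_weight_le hβ (Polynomial.X ^ 2 * p) (max |z.1| |z.2| + 1)
  obtain ⟨D, hD⟩ := exists_abs_eval_mul_weight_le hβ (Polynomial.X * p) (max |z.1| |z.2| + 1)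
  have hmain := hasFDerivAt_integral_of_dominated_of_fderiv_le (μ := (volume : Measure ℝ))
    (F := fun (z : ℝ × ℝ) y => p.eval y * weight β z.1 z.2 y)
    (F' := weightFDeriv β p) (x₀ := z)
    (bound := fun y => (C + D) * Real.exp (-1 * y ^ 2)) (Metric.ball_mem_nhds z one_pos)
    (.of_forall fun z => (p.continuous.mul (continuous_weight β z.1 z.2)).aestronglyMeasurable)
    (integrable_eval_mul_weight hβ p z.1 z.2)
    (integrable_weightFDeriv hβ p z).aestronglyMeasurable
    (.of_forall fun y w hw => ?_)
    ((integrable_exp_neg_mul_sq one_pos).const_mul _)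
    (.of_forall fun y w _ => hasFDerivAt_eval_mul_weight β p y w)
  · refine hmain.congr_fderiv ?_
    have h1 := ((integrable_eval_mul_weight hβ (Polynomial.X ^ 2 * p) z.1 z.2).const_mul
      (1 / 4)).smul_const (ContinuousLinearMap.fst ℝ ℝ ℝ)
    have h2 := ((integrable_eval_mul_weight hβ (Polynomial.X * p) z.1 z.2).const_mul
      (-(1 / 2))).smul_const (ContinuousLinearMap.snd ℝ ℝ ℝ)
    simp only [weightFDeriv]
    rw [integral_add h1 h2, integral_smul_const, integral_smul_const, integral_const_mul,
      integral_const_mul]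
    rfl
  · have hw' : max |w.1 - z.1| |w.2 - z.2| < 1 := by
      have := Metric.mem_ball.1 hw
      rwa [Prod.dist_eq, Real.dist_eq, Real.dist_eq] at this
    have hw1 : |w.1| ≤ max |z.1| |z.2| + 1 := by
      have := abs_sub_abs_le_abs_sub w.1 z.1
      have := (le_max_left |w.1 - z.1| |w.2 - z.2|)
      have := le_max_left |z.1| |z.2|
      linarith
    have hw2 : |w.2| ≤ max |z.1| |z.2| + 1 := by
      have := abs_sub_abs_le_abs_sub w.2 z.2
      have := (le_max_right |w.1 - z.1| |w.2 - z.2|)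
      have := le_max_right |z.1| |z.2|
      linarith
    have hc := hC w.1 w.2 y hw1 hw2
    have hd := hD w.1 w.2 y hw1 hw2
    have n1 : ‖ContinuousLinearMap.fst ℝ ℝ ℝ‖ ≤ 1 := ContinuousLinearMap.norm_fst_le ..
    have n2 : ‖ContinuousLinearMap.snd ℝ ℝ ℝ‖ ≤ 1 := ContinuousLinearMap.norm_snd_le ..
    refine (norm_add_le _ _).trans ?_
    rw [norm_smul, norm_smul, add_mul]
    have hw0 := weight_pos β w.1 w.2 y
    refine add_le_add ?_ ?_
    · rw [Real.norm_eq_abs, abs_mul, abs_mul, abs_of_pos hw0]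
      have : |(1 / 4 : ℝ)| ≤ 1 := by norm_num [abs_le]
      refine le_trans ?_ hc
      refine (mul_le_mul (mul_le_mul_of_nonneg_right this (by positivity)) n1 (norm_nonneg _)
        (by positivity)).trans (by simp)
    · rw [Real.norm_eq_abs, abs_mul, abs_mul, abs_of_pos hw0]
      have : |(-(1 / 2) : ℝ)| ≤ 1 := by norm_num [abs_le]
      refine le_trans ?_ hd
      refine (mul_le_mul (mul_le_mul_of_nonneg_right this (by positivity)) n2 (norm_nonneg _)
        (by positivity)).trans (by simp)

theorem contDiff_moment (hβ : 0 < β) (p : Polynomial ℝ) :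
    ContDiff ℝ ∞ (fun z : ℝ × ℝ => moment β p z.1 z.2) := by
  rw [contDiff_infty]
  intro n
  induction n generalizing p with
  | zero =>
    exact contDiff_zero.2 (continuous_iff_continuousAt.2 fun z =>
      (hasFDerivAt_moment hβ p z).continuousAt)
  | succ n ih =>
    have : ((n + 1 : ℕ) : WithTop ℕ∞) = (n : WithTop ℕ∞) + 1 := by push_cast; rfl
    rw [this, contDiff_succ_iff_hasFDerivAt]
    refine ⟨_, ?_, hasFDerivAt_moment hβ p⟩
    exact ((contDiff_const.mul (ih (Polynomial.X ^ 2 * p))).smul contDiff_const).add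
      ((contDiff_const.mul (ih (Polynomial.X * p))).smul contDiff_const)

theorem smoothFor_moment (hβ : 0 < β) (p : Polynomial ℝ) : SmoothFor univ (moment β p) :=
  smoothFor_univ_iff.2 (contDiff_moment hβ p)

theorem hasDerivAt_moment (hβ : 0 < β) (p : Polynomial ℝ) (T X : ℝ) :
    HasDerivAt (moment β p T) (-(1 / 2) * moment β (Polynomial.X * p) T X) X := by
  have h1 : HasDerivAt (fun x : ℝ => ((T, x) : ℝ × ℝ)) ((0 : ℝ), (1 : ℝ)) X :=
    (hasDerivAt_const X T).prodMk (hasDerivAt_id X)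
  refine ((hasFDerivAt_moment hβ p (T, X)).comp_hasDerivAt X h1).congr_deriv ?_
  simp

theorem hasDerivAt_moment_time (hβ : 0 < β) (p : Polynomial ℝ) (T X : ℝ) :
    HasDerivAt (fun s => moment β p s X) (1 / 4 * moment β (Polynomial.X ^ 2 * p) T X) T := by
  have h1 : HasDerivAt (fun s : ℝ => ((s, X) : ℝ × ℝ)) ((1 : ℝ), (0 : ℝ)) T :=
    (hasDerivAt_id T).prodMk (hasDerivAt_const T X)
  refine ((hasFDerivAt_moment hβ p (T, X)).comp_hasDerivAt T h1).congr_deriv ?_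
  simp

/-- The derivative of the exponent of the weight, up to sign. -/
noncomputable def phase (β T X : ℝ) : Polynomial ℝ :=
  Polynomial.C (X / 2) - Polynomial.C (T / 2) * Polynomial.X +
    Polynomial.C (β / 2) * Polynomial.X ^ 3

theorem eval_phase (β T X y : ℝ) : (phase β T X).eval y = X / 2 - T / 2 * y + β / 2 * y ^ 3 := by
  simp [phase]

/-- Integration by parts. -/
theorem moment_derivative (hβ : 0 < β) (p : Polynomial ℝ) (T X : ℝ) :
    moment β (derivative p) T X = moment β (p * phase β T X) T X := by
  have hd : ∀ y, HasDerivAt (fun y => p.eval y * weight β T X y)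
      ((derivative p - p * phase β T X).eval y * weight β T X y) y := by
    intro y
    have h1 : HasDerivAt (weight β T X) (-(phase β T X).eval y * weight β T X y) y := by
      have h2 : HasDerivAt (fun y : ℝ => -(X * y) / 2 + T * y ^ 2 / 4 - β * y ^ 4 / 8)
          (-(phase β T X).eval y) y := by
        have := (((((hasDerivAt_id y).const_mul X).neg.div_const 2).add
          ((((hasDerivAt_id y).pow 2).const_mul T).div_const 4)).sub
          ((((hasDerivAt_id y).pow 4).const_mul β).div_const 8))
        refine this.congr_deriv ?_
        rw [eval_phase]
        simp
        ring
      refine h2.exp.congr_deriv ?_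
      rw [weight]
      ring
    refine ((p.hasDerivAt y).mul h1).congr_deriv ?_
    simp
    ring
  have h := integral_eq_zero_of_hasDerivAt_of_integrable hd
    (integrable_eval_mul_weight hβ _ T X) (integrable_eval_mul_weight hβ p T X)
  rw [← sub_eq_zero, ← moment_sub hβ]
  exact h

end Moment

/-! ### The inner solutions -/

section Tilt

theorem exists_antiderivative (p : Polynomial ℝ) : ∃ q : Polynomial ℝ, derivative q = p := by
  induction p using Polynomial.induction_on' with
  | add p q hp hq =>
    obtain ⟨P, rfl⟩ := hp
    obtain ⟨Q, rfl⟩ := hq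
    exact ⟨P + Q, by simp⟩
  | monomial n a =>
    refine ⟨Polynomial.monomial (n + 1) (a / (n + 1)), ?_⟩
    rw [Polynomial.derivative_monomial]
    have : (n : ℝ) + 1 ≠ 0 := by positivity
    simp [div_mul_cancel₀ _ this]

/-- The coefficients of the formal series `exp (∑ ε ^ j ∫ c_j / 2)`. -/
noncomputable def tiltPoly (c : ℕ → Polynomial ℝ) : ℕ → Polynomial ℝ
  | 0 => 1
  | ℓ + 1 => (exists_antiderivative
      (Polynomial.C (1 / 2) * ∑ j : Fin (ℓ + 1), c (ℓ + 1 - j) * tiltPoly c j)).choose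
termination_by ℓ => ℓ

theorem tiltPoly_zero (c : ℕ → Polynomial ℝ) : tiltPoly c 0 = 1 := by rw [tiltPoly]

/-- In terms of generating series this is P' = ½ c P. Because c_0 = 0, the right side at order ℓ
involves only polynomials that are already constructed. -/
theorem derivative_tiltPoly {c : ℕ → Polynomial ℝ} (hc : c 0 = 0) (ℓ : ℕ) :
    derivative (tiltPoly c ℓ) = Polynomial.C (1 / 2) *
      ∑ p ∈ Finset.HasAntidiagonal.antidiagonal ℓ, c p.1 * tiltPoly c p.2 := by
  cases ℓ with
  | zero => simp [tiltPoly_zero, hc]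
  | succ ℓ =>
    rw [tiltPoly, (exists_antiderivative _).choose_spec,
      Finset.Nat.sum_antidiagonal_eq_sum_range_succ_mk, ← Finset.sum_range_reflect,
      Finset.sum_range_succ, Fin.sum_univ_eq_sum_range (fun j => c (ℓ + 1 - j) * tiltPoly c j)]
    congr 1
    rw [show ℓ + 1 + 1 - 1 - (ℓ + 1) = 0 by omega, hc, zero_mul, add_zero]
    refine Finset.sum_congr rfl fun j hj => ?_
    have := Finset.mem_range.1 hj
    rw [show ℓ + 1 + 1 - 1 - j = ℓ + 1 - j by omega, show ℓ + 1 - (ℓ + 1 - j) = j by omega]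

end Tilt

/-- Coefficientwise differentiation of a power series. -/
def HasSeriesDeriv (F : ℝ → PowerSeries ℝ) (F' : PowerSeries ℝ) (x : ℝ) : Prop :=
  ∀ ℓ, HasDerivAt (fun y => PowerSeries.coeff ℓ (F y)) (PowerSeries.coeff ℓ F') x

theorem HasSeriesDeriv.mul {F G : ℝ → PowerSeries ℝ} {F' G' : PowerSeries ℝ} {x : ℝ}
    (hF : HasSeriesDeriv F F' x) (hG : HasSeriesDeriv G G' x) :
    HasSeriesDeriv (fun y => F y * G y) (F' * G x + F x * G') x := by
  intro ℓ
  simp only [PowerSeries.coeff_mul, map_add, ← Finset.sum_add_distrib]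
  exact HasDerivAt.fun_sum fun p _ => (hF p.1).mul (hG p.2)

theorem HasSeriesDeriv.add {F G : ℝ → PowerSeries ℝ} {F' G' : PowerSeries ℝ} {x : ℝ}
    (hF : HasSeriesDeriv F F' x) (hG : HasSeriesDeriv G G' x) :
    HasSeriesDeriv (fun y => F y + G y) (F' + G') x := fun ℓ => by
  simp only [map_add]
  exact (hF ℓ).add (hG ℓ)

theorem HasSeriesDeriv.unique {F : ℝ → PowerSeries ℝ} {F' F'' : PowerSeries ℝ} {x : ℝ}
    (h1 : HasSeriesDeriv F F' x) (h2 : HasSeriesDeriv F F'' x) : F' = F'' :=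
  PowerSeries.ext fun ℓ => (h1 ℓ).unique (h2 ℓ)

/-- The series of the space derivatives of a family. -/
noncomputable def famDX (V : ℕ → ℝ → ℝ → ℝ) (ℓ : ℕ) (T X : ℝ) : ℝ := deriv (V ℓ T) X

/-- The series of the values of a family. -/
noncomputable def famSeries (V : ℕ → ℝ → ℝ → ℝ) (T X : ℝ) : PowerSeries ℝ :=
  PowerSeries.mk fun ℓ => V ℓ T X

theorem hasSeriesDeriv_famSeries {J : Set ℝ} {V : ℕ → ℝ → ℝ → ℝ} (hV : ∀ ℓ, SmoothFor J (V ℓ))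
    {T : ℝ} (hT : T ∈ J) (X : ℝ) :
    HasSeriesDeriv (famSeries V T) (famSeries (famDX V) T X) X := fun ℓ => by
  simpa [famSeries, famDX] using (hV ℓ).hasDerivAt hT X

/-- `(V - 2 ∂_X) ^ n` applied to `1`, as a family. -/
noncomputable def famPow (V : ℕ → ℝ → ℝ → ℝ) : ℕ → ℕ → ℝ → ℝ → ℝ
  | 0 => fun ℓ _ _ => if ℓ = 0 then 1 else 0
  | n + 1 => fun ℓ T X => ∑ p ∈ Finset.HasAntidiagonal.antidiagonal ℓ,
      V p.1 T X * famPow V n p.2 T X - 2 * deriv (famPow V n ℓ T) X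

theorem famPow_zero (V : ℕ → ℝ → ℝ → ℝ) (ℓ : ℕ) (T X : ℝ) :
    famPow V 0 ℓ T X = if ℓ = 0 then 1 else 0 := rfl

theorem famPow_succ (V : ℕ → ℝ → ℝ → ℝ) (n ℓ : ℕ) (T X : ℝ) :
    famPow V (n + 1) ℓ T X = ∑ p ∈ Finset.HasAntidiagonal.antidiagonal ℓ,
      V p.1 T X * famPow V n p.2 T X - 2 * deriv (famPow V n ℓ T) X := rfl

theorem smoothFor_famPow {J : Set ℝ} (hJ : IsOpen J) {V : ℕ → ℝ → ℝ → ℝ}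
    (hV : ∀ ℓ, SmoothFor J (V ℓ)) (n ℓ : ℕ) : SmoothFor J (famPow V n ℓ) := by
  induction n generalizing ℓ with
  | zero => exact SmoothFor.const _
  | succ n ih =>
    exact (SmoothFor.sum fun p _ => (hV p.1).mul (ih p.2)).sub
      ((SmoothFor.const 2).mul ((ih ℓ).dX hJ))

theorem famSeries_famPow_succ (V : ℕ → ℝ → ℝ → ℝ) (n : ℕ) (T X : ℝ) :
    famSeries (famPow V (n + 1)) T X = famSeries V T X * famSeries (famPow V n) T X -
      2 * famSeries (famDX (famPow V n)) T X := by
  ext ℓ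
  rw [map_sub, PowerSeries.coeff_mul, show (2 : PowerSeries ℝ) = PowerSeries.C 2 by simp only [map_ofNat],
    PowerSeries.coeff_C_mul]
  simp [famSeries, famPow_succ, famDX]

/-! ### The Cole–Hopf transformation for formal series. -/

section ColeHopf

variable {β : ℝ}

/-- The moments with an additional factor `y ^ n`, as a family. -/
noncomputable def momentFam (β : ℝ) (P : ℕ → Polynomial ℝ) (n ℓ : ℕ) (T X : ℝ) : ℝ :=
  moment β (Polynomial.X ^ n * P ℓ) T X

theorem hasSeriesDeriv_momentFam (hβ : 0 < β) (P : ℕ → Polynomial ℝ) (n : ℕ) (T X : ℝ) :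
    HasSeriesDeriv (famSeries (momentFam β P n) T)
      (PowerSeries.C (-(1 / 2)) * famSeries (momentFam β P (n + 1)) T X) X := fun ℓ => by
  have := hasDerivAt_moment hβ (Polynomial.X ^ n * P ℓ) T X
  rw [← mul_assoc, ← pow_succ'] at this
  rw [PowerSeries.coeff_C_mul]
  simpa [famSeries, momentFam] using this

theorem hasSeriesDeriv_momentFam_time (hβ : 0 < β) (P : ℕ → Polynomial ℝ) (n : ℕ) (T X : ℝ) :
    HasSeriesDeriv (fun s => famSeries (momentFam β P n) s X)
      (PowerSeries.C (1 / 4) * famSeries (momentFam β P (n + 2)) T X) T := fun ℓ => by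
  have := hasDerivAt_moment_time hβ (Polynomial.X ^ n * P ℓ) T X
  rw [← mul_assoc, ← pow_add, add_comm 2 n] at this
  rw [PowerSeries.coeff_C_mul]
  simpa [famSeries, momentFam] using this

/-- The solution of the inner hierarchy given by the Cole-Hopf transformation. -/
noncomputable def innerSol (β : ℝ) (P : ℕ → Polynomial ℝ) (ℓ : ℕ) (T X : ℝ) : ℝ :=
  PowerSeries.coeff ℓ (famSeries (momentFam β P 1) T X * (famSeries (momentFam β P 0) T X)⁻¹)

variable {P : ℕ → Polynomial ℝ}

theorem constantCoeff_momentFam_pos (hβ : 0 < β) (hP : P 0 = 1) (T X : ℝ) :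
    0 < PowerSeries.constantCoeff (famSeries (momentFam β P 0) T X) := by
  simpa [famSeries, momentFam, hP] using moment_one_pos hβ T X

theorem famSeries_innerSol (β : ℝ) (P : ℕ → Polynomial ℝ) (T X : ℝ) :
    famSeries (innerSol β P) T X =
      famSeries (momentFam β P 1) T X * (famSeries (momentFam β P 0) T X)⁻¹ := by
  ext ℓ
  simp [famSeries, innerSol]

theorem famSeries_innerSol_mul (hβ : 0 < β) (hP : P 0 = 1) (T X : ℝ) :
    famSeries (innerSol β P) T X * famSeries (momentFam β P 0) T X =
      famSeries (momentFam β P 1) T X := by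
  rw [famSeries_innerSol, mul_assoc, PowerSeries.inv_mul_cancel, mul_one]
  exact (constantCoeff_momentFam_pos hβ hP T X).ne'

/-- The coefficients of UΦ = ∫ y P weight, solved for the top one. Smoothness, symbol bounds and
growth are all obtained from this recursion. -/
theorem innerSol_eq (hβ : 0 < β) (hP : P 0 = 1) (ℓ : ℕ) (T X : ℝ) :
    innerSol β P ℓ T X = (moment β (Polynomial.X * P ℓ) T X -
      ∑ j ∈ Finset.range ℓ, innerSol β P j T X * moment β (P (ℓ - j)) T X) / moment β 1 T X := by
  have h := congrArg (PowerSeries.coeff ℓ) (famSeries_innerSol_mul hβ hP T X)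
  rw [PowerSeries.coeff_mul, Finset.Nat.sum_antidiagonal_eq_sum_range_succ_mk,
    Finset.sum_range_succ] at h
  simp only [famSeries, PowerSeries.coeff_mk, momentFam, pow_zero, one_mul, pow_one, Nat.sub_self,
    hP] at h
  rw [eq_div_iff (moment_one_pos hβ T X).ne']
  linarith

theorem smoothFor_innerSol (hβ : 0 < β) (hP : P 0 = 1) (ℓ : ℕ) :
    SmoothFor univ (innerSol β P ℓ) := by
  induction ℓ using Nat.strong_induction_on with
  | _ ℓ ih =>
    have : innerSol β P ℓ = fun T X => (moment β (Polynomial.X * P ℓ) T X -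
        ∑ j ∈ Finset.range ℓ, innerSol β P j T X * moment β (P (ℓ - j)) T X) / moment β 1 T X :=
      funext fun T => funext fun X => innerSol_eq hβ hP ℓ T X
    rw [this]
    have h1 := (smoothFor_moment hβ (Polynomial.X * P ℓ)).sub
      (SmoothFor.sum fun j hj => (ih j (Finset.mem_range.1 hj)).mul (smoothFor_moment hβ (P (ℓ - j))))
    exact fun T hT X => (h1 T hT X).div (smoothFor_moment hβ 1 T hT X) (moment_one_pos hβ T X).ne'

/-- The Cole-Hopf transformation turns the heat equation into the inner hierarchy. -/
theorem solvesInnerEquation_innerSol (hβ : 0 < β) (hP : P 0 = 1) (ℓ : ℕ) :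
    SolvesInnerEquation univ (innerSol β P) ℓ := by
  have hs := smoothFor_innerSol (P := P) hβ hP
  intro T _ X
  set u := famSeries (innerSol β P) T X with hu
  set uX := famSeries (famDX (innerSol β P)) T X with huX
  set uXX := famSeries (famDX (famDX (innerSol β P))) T X with huXX
  set uT : PowerSeries ℝ := PowerSeries.mk fun ℓ => deriv (fun s => innerSol β P ℓ s X) T with huT
  set m := fun n => famSeries (momentFam β P n) T X with hm
  have hrel : ∀ T X, famSeries (innerSol β P) T X * famSeries (momentFam β P 0) T X =
      famSeries (momentFam β P 1) T X := famSeries_innerSol_mul hβ hP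
  have hsX : ∀ ℓ, SmoothFor univ (famDX (innerSol β P) ℓ) := fun ℓ => (hs ℓ).dX isOpen_univ
  -- The X-derivative of UΦ = M_1, where M_n denotes the moment series with factor yⁿ, so that M_0 =
  -- Φ and ∂_X M_n = -½ M_{n+1}.
  have d1 : ∀ X, famSeries (famDX (innerSol β P)) T X * famSeries (momentFam β P 0) T X +
      famSeries (innerSol β P) T X * (PowerSeries.C (-(1 / 2)) * famSeries (momentFam β P 1) T X) =
      PowerSeries.C (-(1 / 2)) * famSeries (momentFam β P 2) T X := fun X => by
    refine ((hasSeriesDeriv_famSeries hs (mem_univ T) X).mul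
      (hasSeriesDeriv_momentFam hβ P 0 T X)).unique ?_
    simp only [hrel]
    exact hasSeriesDeriv_momentFam hβ P 1 T X
  have hC : ∀ (c : ℝ) {F : ℝ → PowerSeries ℝ} {F' : PowerSeries ℝ} {x : ℝ}, HasSeriesDeriv F F' x →
      HasSeriesDeriv (fun y => PowerSeries.C c * F y) (PowerSeries.C c * F') x := by
    intro c F F' x hF ℓ
    simp only [PowerSeries.coeff_C_mul]
    exact (hF ℓ).const_mul c
  have d2 : (uXX * m 0 + uX * (PowerSeries.C (-(1 / 2)) * m 1)) +
      (uX * (PowerSeries.C (-(1 / 2)) * m 1) +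
        u * (PowerSeries.C (-(1 / 2)) * (PowerSeries.C (-(1 / 2)) * m 2))) =
      PowerSeries.C (-(1 / 2)) * (PowerSeries.C (-(1 / 2)) * m 3) := by
    refine (((hasSeriesDeriv_famSeries hsX (mem_univ T) X).mul
      (hasSeriesDeriv_momentFam hβ P 0 T X)).add
      ((hasSeriesDeriv_famSeries hs (mem_univ T) X).mul
        (hC _ (hasSeriesDeriv_momentFam hβ P 1 T X)))).unique ?_
    simp only [d1]
    exact hC _ (hasSeriesDeriv_momentFam hβ P 2 T X)
  have dt : uT * m 0 + u * (PowerSeries.C (1 / 4) * m 2) = PowerSeries.C (1 / 4) * m 3 := by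
    have h1 : HasSeriesDeriv (fun s => famSeries (innerSol β P) s X) uT T := fun ℓ => by
      simpa [famSeries, huT] using (hs ℓ).hasDerivAt_time (mem_univ T) X
    refine (h1.mul (hasSeriesDeriv_momentFam_time hβ P 0 T X)).unique ?_
    simp only [hrel]
    exact hasSeriesDeriv_momentFam_time hβ P 1 T X
  have hne : m 0 ≠ 0 := fun h => by
    have := constantCoeff_momentFam_pos hβ hP T X
    simp only [hm] at h
    rw [h] at this
    simp at this
  have hq : PowerSeries.C (1 / 4 : ℝ) = PowerSeries.C (-(1 / 2)) * PowerSeries.C (-(1 / 2)) := by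
    rw [← map_mul]
    norm_num
  have h2 : 2 * PowerSeries.C (-(1 / 2) : ℝ) = -1 := by
    have : (2 : PowerSeries ℝ) = PowerSeries.C 2 := by simp only [map_ofNat]
    rw [this, ← map_mul]
    norm_num
  have hmain : uT = uXX - u * uX := by
    -- The equation is checked after multiplication by Φ, which can be cancelled because formal
    -- power series over ℝ have no zero divisors.
    refine mul_right_cancel₀ hne ?_
    have h0 := hrel T X
    change u * m 0 = m 1 at h0
    rw [hq] at dt
    linear_combination dt - d2 + (-2 * PowerSeries.C (-(1 / 2) : ℝ)) * uX * h0 + u * uX * m 0 * h2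
  have hsq : HasDerivAt (fun x => PowerSeries.coeff ℓ (famSeries (innerSol β P) T x *
      famSeries (innerSol β P) T x)) (PowerSeries.coeff ℓ (uX * u + u * uX)) X :=
    (hasSeriesDeriv_famSeries hs (mem_univ T) X).mul
      (hasSeriesDeriv_famSeries hs (mem_univ T) X) ℓ
  have hsum : HasDerivAt (fun x => PowerSeries.coeff ℓ (famSeries (innerSol β P) T x *
      famSeries (innerSol β P) T x)) (∑ p ∈ Finset.HasAntidiagonal.antidiagonal ℓ,
        deriv (fun x => innerSol β P p.1 T x * innerSol β P p.2 T x) X) X := by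
    simp only [PowerSeries.coeff_mul, famSeries, PowerSeries.coeff_mk]
    exact HasDerivAt.fun_sum fun p _ =>
      (((hs p.1).mul (hs p.2)).differentiableAt (mem_univ T) X).hasDerivAt
  rw [← hsq.unique hsum]
  have hfin := congrArg (PowerSeries.coeff ℓ) hmain
  rw [show uX * u + u * uX = PowerSeries.C 2 * (u * uX) by
    rw [show PowerSeries.C (2 : ℝ) = 2 by simp only [map_ofNat]]; ring, PowerSeries.coeff_C_mul]
  simp only [huT, huXX, famSeries, PowerSeries.coeff_mk, map_sub] at hfin
  rw [hfin]
  simp only [iteratedDeriv_succ, iteratedDeriv_zero]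
  change deriv (deriv (innerSol β P ℓ T)) X - _ = _
  ring

/-- Since U = -2Φ_X/Φ, the operator U - 2∂_X maps g/Φ to -2g_X/Φ. Applied to the moment series with
factor yⁿ, it raises the power of y by one. -/
theorem famSeries_famPow_mul (hβ : 0 < β) (hP : P 0 = 1) (n : ℕ) (T X : ℝ) :
    famSeries (famPow (innerSol β P) n) T X * famSeries (momentFam β P 0) T X =
      famSeries (momentFam β P n) T X := by
  have hs := smoothFor_innerSol (P := P) hβ hP
  induction n generalizing X with
  | zero =>
    have : famSeries (famPow (innerSol β P) 0) T X = 1 := by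
      ext ℓ
      simp [famSeries, famPow_zero, PowerSeries.coeff_one]
    rw [this, one_mul]
  | succ n ih =>
    have d1 : famSeries (famDX (famPow (innerSol β P) n)) T X * famSeries (momentFam β P 0) T X +
        famSeries (famPow (innerSol β P) n) T X *
          (PowerSeries.C (-(1 / 2)) * famSeries (momentFam β P 1) T X) =
        PowerSeries.C (-(1 / 2)) * famSeries (momentFam β P (n + 1)) T X := by
      refine ((hasSeriesDeriv_famSeries (smoothFor_famPow isOpen_univ hs n) (mem_univ T) X).mul
        (hasSeriesDeriv_momentFam hβ P 0 T X)).unique ?_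
      simp only [ih]
      exact hasSeriesDeriv_momentFam hβ P n T X
    have h2 : 2 * PowerSeries.C (-(1 / 2) : ℝ) = -1 := by
      have : (2 : PowerSeries ℝ) = PowerSeries.C 2 := by simp only [map_ofNat]
      rw [this, ← map_mul]
      norm_num
    have h0 := famSeries_innerSol_mul hβ hP T X
    rw [famSeries_famPow_succ]
    linear_combination (-2 : PowerSeries ℝ) * d1 + famSeries (famPow (innerSol β P) n) T X * h0 +
      (famSeries (famPow (innerSol β P) n) T X * famSeries (momentFam β P 1) T X -
        famSeries (momentFam β P (n + 1)) T X) * h2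

/-- The algebraic equation of the inner solutions. -/
theorem famPow_equation (hβ : 0 < β) {δ : ℕ → ℕ → ℝ} (hδ : ∀ n j, j + 3 < n → δ n j = 0)
    (hδ0 : ∀ n, δ n 0 = 0) {P : ℕ → Polynomial ℝ} (hP : P = tiltPoly fun j =>
      ∑ n ∈ Finset.range (j + 4), Polynomial.C (δ n j) * Polynomial.X ^ n) (ℓ : ℕ) (T X : ℝ) :
    (if ℓ = 0 then X else 0) - T * famPow (innerSol β P) 1 ℓ T X +
      β * famPow (innerSol β P) 3 ℓ T X =
      ∑ n ∈ Finset.range (ℓ + 4), ∑ p ∈ Finset.HasAntidiagonal.antidiagonal ℓ,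
        δ n p.1 * famPow (innerSol β P) n p.2 T X := by
  set c : ℕ → Polynomial ℝ := fun j =>
    ∑ n ∈ Finset.range (j + 4), Polynomial.C (δ n j) * Polynomial.X ^ n with hc
  have hP0 : P 0 = 1 := by rw [hP, tiltPoly_zero]
  have hc0 : c 0 = 0 := by
    simp only [hc]
    exact Finset.sum_eq_zero fun n _ => by simp [hδ0]
  have hcN : ∀ N j, j + 4 ≤ N → c j = ∑ n ∈ Finset.range N, Polynomial.C (δ n j) * Polynomial.X ^ n := by
    intro N j hj
    refine Finset.sum_subset (Finset.range_subset_range.2 hj) fun n _ hn => ?_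
    rw [hδ n j (by have := Finset.mem_range.not.1 hn; omega)]
    simp
  set Φ := famSeries (momentFam β P 0) T X with hΦ
  set a := fun n => famSeries (famPow (innerSol β P) n) T X with ha
  have hrel : ∀ n, a n * Φ = famSeries (momentFam β P n) T X := fun n =>
    famSeries_famPow_mul hβ hP0 n T X
  set N := ℓ + 4 with hN
  have hne : Φ ≠ 0 := fun h => by
    have := constantCoeff_momentFam_pos hβ hP0 T X
    rw [← hΦ, h] at this
    simp at this
  -- Only the coefficients up to ℓ agree: the sum is truncated at N = ℓ + 4, which covers the
  -- degrees of c_j for j ≤ ℓ.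
  have hlow : ∀ j ≤ ℓ, PowerSeries.coeff j ((PowerSeries.C X * a 0 - PowerSeries.C T * a 1 +
      PowerSeries.C β * a 3) * Φ) = PowerSeries.coeff j
      ((∑ n ∈ Finset.range N, PowerSeries.mk (δ n) * a n) * Φ) := by
    intro j hj
    have e1 : (PowerSeries.C X * a 0 - PowerSeries.C T * a 1 + PowerSeries.C β * a 3) * Φ =
        PowerSeries.C X * (a 0 * Φ) - PowerSeries.C T * (a 1 * Φ) + PowerSeries.C β * (a 3 * Φ) := by
      ring
    have e2 : (∑ n ∈ Finset.range N, PowerSeries.mk (δ n) * a n) * Φ =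
        ∑ n ∈ Finset.range N, PowerSeries.mk (δ n) * (a n * Φ) := by
      rw [Finset.sum_mul]
      exact Finset.sum_congr rfl fun n _ => mul_assoc _ _ _
    rw [e1, e2]
    simp only [hrel, map_add, map_sub, map_sum, PowerSeries.coeff_C_mul]
    simp only [PowerSeries.coeff_mul, famSeries, PowerSeries.coeff_mk, momentFam]
    -- Integration by parts against P_j. The two sides are ½ ∑ c_i P_{j-i} and ½ (X - Ty + βy³) P_j.
    have hibp := moment_derivative hβ (P j) T X
    have hder : derivative (P j) = Polynomial.C (1 / 2) *
        ∑ p ∈ Finset.HasAntidiagonal.antidiagonal j, c p.1 * P p.2 := by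
      rw [hP]
      exact derivative_tiltPoly hc0 j
    have hph : P j * phase β T X = Polynomial.C (1 / 2) * (Polynomial.C X * (Polynomial.X ^ 0 * P j) -
        Polynomial.C T * (Polynomial.X ^ 1 * P j) + Polynomial.C β * (Polynomial.X ^ 3 * P j)) := by
      have hx : ∀ r : ℝ, Polynomial.C (r / 2) = Polynomial.C (1 / 2) * Polynomial.C r := fun r => by
        rw [← Polynomial.C_mul]
        ring_nf
      rw [phase, hx X, hx T, hx β]
      ring
    rw [hder, hph, moment_C_mul, moment_C_mul] at hibp
    have hibp' := mul_left_cancel₀ (by norm_num : (1 / 2 : ℝ) ≠ 0) hibp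
    rw [moment_add hβ, moment_sub hβ, moment_C_mul, moment_C_mul, moment_C_mul] at hibp'
    rw [← hibp', moment_sum hβ, Finset.sum_comm]
    refine Finset.sum_congr rfl fun p hp => ?_
    have hp' := Finset.HasAntidiagonal.mem_antidiagonal.1 hp
    rw [hcN N p.1 (by omega), Finset.sum_mul, moment_sum hβ]
    refine Finset.sum_congr rfl fun n _ => ?_
    rw [mul_assoc, moment_C_mul]
  -- The factor Φ is cancelled only up to order ℓ. This is a triangular system with diagonal entry
  -- the nonzero constant coefficient of Φ.
  have hcancel : ∀ A B : PowerSeries ℝ, (∀ j ≤ ℓ, PowerSeries.coeff j (A * Φ) =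
      PowerSeries.coeff j (B * Φ)) → ∀ j ≤ ℓ, PowerSeries.coeff j A = PowerSeries.coeff j B := by
    intro A B h j
    induction j using Nat.strong_induction_on with
    | _ j ih =>
      intro hj
      have h1 := h j hj
      rw [PowerSeries.coeff_mul, PowerSeries.coeff_mul,
        Finset.Nat.sum_antidiagonal_eq_sum_range_succ_mk,
        Finset.Nat.sum_antidiagonal_eq_sum_range_succ_mk, Finset.sum_range_succ,
        Finset.sum_range_succ] at h1
      rw [Finset.sum_congr rfl fun i hi => by
        rw [ih i (Finset.mem_range.1 hi) ((Finset.mem_range.1 hi).le.trans hj)]] at h1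
      have h2 := add_left_cancel h1
      refine mul_right_cancel₀ ?_ h2
      have := constantCoeff_momentFam_pos hβ hP0 T X
      simpa using this.ne'
  have h := hcancel _ _ hlow ℓ le_rfl
  simp only [map_add, map_sub, map_sum, PowerSeries.coeff_C_mul] at h
  simp only [PowerSeries.coeff_mul, PowerSeries.coeff_mk, ha, famSeries] at h
  rw [← h, famPow_zero]
  simp

theorem famPow_one (V : ℕ → ℝ → ℝ → ℝ) (ℓ : ℕ) (T X : ℝ) : famPow V 1 ℓ T X = V ℓ T X := by
  rw [famPow_succ]
  have : famPow V 0 ℓ T = fun _ => if ℓ = 0 then 1 else 0 := rfl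
  rw [this, deriv_const, mul_zero, sub_zero, Finset.sum_eq_single (ℓ, 0)]
  · simp [famPow_zero]
  · intro p hp hne
    have hp' := Finset.HasAntidiagonal.mem_antidiagonal.1 hp
    rw [famPow_zero, if_neg, mul_zero]
    intro h
    exact hne (Prod.ext (by simp only; omega) h)
  · intro h
    exact absurd (Finset.HasAntidiagonal.mem_antidiagonal.2 (by simp)) h

end ColeHopf

/-! ### The moments are symbols -/

/-- The mean of the polynomial `p` with respect to the normalized weight. -/
noncomputable def mean (β : ℝ) (p : Polynomial ℝ) (T X : ℝ) : ℝ :=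
  moment β p T X / moment β 1 T X

/-- The shifted variable `y - u`. -/
noncomputable def shift (u : ℝ) : Polynomial ℝ := Polynomial.X - Polynomial.C u

theorem eval_shift (u y : ℝ) : (shift u).eval y = y - u := by simp [shift]

section Mean

variable {β : ℝ}

theorem mean_add (hβ : 0 < β) (p q : Polynomial ℝ) (T X : ℝ) :
    mean β (p + q) T X = mean β p T X + mean β q T X := by
  rw [mean, moment_add hβ, add_div]
  rfl

theorem mean_C_mul (β c : ℝ) (p : Polynomial ℝ) (T X : ℝ) :
    mean β (Polynomial.C c * p) T X = c * mean β p T X := by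
  rw [mean, moment_C_mul, mul_div_assoc]
  rfl

theorem mean_sub (hβ : 0 < β) (p q : Polynomial ℝ) (T X : ℝ) :
    mean β (p - q) T X = mean β p T X - mean β q T X := by
  rw [mean, moment_sub hβ, sub_div]
  rfl

theorem mean_one (hβ : 0 < β) (T X : ℝ) : mean β 1 T X = 1 :=
  div_self (moment_one_pos hβ T X).ne'

theorem mean_nonneg (hβ : 0 < β) {p : Polynomial ℝ} (hp : ∀ y, 0 ≤ p.eval y) (T X : ℝ) :
    0 ≤ mean β p T X := div_nonneg (moment_nonneg hp T X) (moment_one_pos hβ T X).le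

theorem mean_mono (hβ : 0 < β) {p q : Polynomial ℝ} (hp : ∀ y, p.eval y ≤ q.eval y) (T X : ℝ) :
    mean β p T X ≤ mean β q T X :=
  div_le_div_of_nonneg_right (moment_mono hβ hp T X) (moment_one_pos hβ T X).le

theorem mean_derivative (hβ : 0 < β) (p : Polynomial ℝ) (T X : ℝ) :
    mean β (derivative p) T X = mean β (p * phase β T X) T X := by
  rw [mean, moment_derivative hβ]
  rfl

theorem hasDerivAt_mean (hβ : 0 < β) (p : Polynomial ℝ) (T X : ℝ) :
    HasDerivAt (mean β p T) (-(1 / 2) * (mean β (Polynomial.X * p) T X -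
      mean β Polynomial.X T X * mean β p T X)) X := by
  have h := moment_one_pos hβ T X
  refine ((hasDerivAt_moment hβ p T X).div (hasDerivAt_moment hβ 1 T X) h.ne').congr_deriv ?_
  simp only [mean, mul_one]
  field_simp
  ring

theorem innerSol_eq_mean (hβ : 0 < β) {P : ℕ → Polynomial ℝ} (hP : P 0 = 1) (ℓ : ℕ) (T X : ℝ) :
    innerSol β P ℓ T X = mean β (Polynomial.X * P ℓ) T X -
      ∑ j ∈ Finset.range ℓ, innerSol β P j T X * mean β (P (ℓ - j)) T X := by
  rw [innerSol_eq hβ hP, sub_div, Finset.sum_div]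
  simp only [mean, mul_div_assoc]

/-- The profile is the critical point of the exponent of the weight. In the expansion about it, the
linear coefficient is 1/(2𝔪). -/
theorem phase_eq (hβ : 0 < β) {T : ℝ} (hT : T < 0) (X : ℝ) :
    phase β T X = shift (profile β T X) * (Polynomial.C (-T / 2 + 3 * β / 2 * profile β T X ^ 2) +
      Polynomial.C (3 * β / 2 * profile β T X) * shift (profile β T X) +
      Polynomial.C (β / 2) * shift (profile β T X) ^ 2) := by
  have h := profile_spec hβ hT.le X
  refine Polynomial.funext fun y => ?_
  rw [eval_phase]
  simp only [Polynomial.eval_mul, Polynomial.eval_add, Polynomial.eval_C, Polynomial.eval_pow,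
    eval_shift]
  linear_combination (-(1 / 2)) * h

theorem derivative_shift_pow (u : ℝ) (j : ℕ) :
    derivative (shift u ^ (j + 1)) = Polynomial.C ((j : ℝ) + 1) * shift u ^ j := by
  rw [Polynomial.derivative_pow]
  simp [shift]

/-- The moments about the profile. -/
noncomputable def centered (β : ℝ) (j : ℕ) (T X : ℝ) : ℝ :=
  mean β (shift (profile β T X) ^ j) T X

theorem centered_zero (hβ : 0 < β) (T X : ℝ) : centered β 0 T X = 1 := by
  rw [centered, pow_zero, mean_one hβ]

theorem mean_shift_pow_mul_phase (hβ : 0 < β) {T : ℝ} (hT : T < 0) (X : ℝ) (j : ℕ) :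
    mean β (shift (profile β T X) ^ j * phase β T X) T X =
      (-T / 2 + 3 * β / 2 * profile β T X ^ 2) * centered β (j + 1) T X +
      3 * β / 2 * profile β T X * centered β (j + 2) T X + β / 2 * centered β (j + 3) T X := by
  set W := shift (profile β T X) with hW
  have : W ^ j * phase β T X =
      Polynomial.C (-T / 2 + 3 * β / 2 * profile β T X ^ 2) * W ^ (j + 1) +
      Polynomial.C (3 * β / 2 * profile β T X) * W ^ (j + 2) + Polynomial.C (β / 2) * W ^ (j + 3) := by
    rw [phase_eq hβ hT X]
    ring
  rw [this, mean_add hβ, mean_add hβ, mean_C_mul, mean_C_mul, mean_C_mul]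
  rfl

theorem slope_mul_mean_phase (hβ : 0 < β) {T : ℝ} (hT : T < 0) (X : ℝ) (j : ℕ) :
    slope β T X * mean β (shift (profile β T X) ^ j * phase β T X) T X =
      1 / 2 * centered β (j + 1) T X + slope β T X *
      (3 * β / 2 * profile β T X * centered β (j + 2) T X + β / 2 * centered β (j + 3) T X) := by
  rw [mean_shift_pow_mul_phase hβ hT]
  linear_combination (1 / 2 * centered β (j + 1) T X) * slope_mul_width hβ hT X

/-- Integration by parts against the constant 1. The identity improves the order of the first moment
about 𝔲 from -1 to -3. -/
theorem centered_one (hβ : 0 < β) {T : ℝ} (hT : T < 0) (X : ℝ) :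
    centered β 1 T X = -(slope β T X *
      (3 * β * profile β T X * centered β 2 T X + β * centered β 3 T X)) := by
  have h1 := slope_mul_mean_phase hβ hT X 0
  have h2 := mean_derivative hβ (shift (profile β T X) ^ 0) T X
  rw [← h2] at h1
  have h3 : mean β (derivative (shift (profile β T X) ^ 0)) T X = 0 := by
    simp [mean, moment_zero]
  rw [h3] at h1
  linear_combination (-2) * h1

/-- The polynomial depends on X through 𝔲. The induction splits off one factor y - 𝔲 at a time,
which reduces the claim to fixed polynomials. -/
theorem hasDerivAt_moment_shift (hβ : 0 < β) {T : ℝ} (hT : T < 0) (X : ℝ) (j : ℕ)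
    (p : Polynomial ℝ) :
    HasDerivAt (fun X => moment β (shift (profile β T X) ^ j * p) T X)
      (-(1 / 2) * moment β (shift (profile β T X) ^ j * (Polynomial.X * p)) T X +
        j * (slope β T X * moment β (shift (profile β T X) ^ (j - 1) * p) T X)) X := by
  have key : ∀ (X : ℝ) (j : ℕ) (p : Polynomial ℝ),
      moment β (shift (profile β T X) ^ (j + 1) * p) T X =
      moment β (shift (profile β T X) ^ j * (Polynomial.X * p)) T X -
        profile β T X * moment β (shift (profile β T X) ^ j * p) T X := by
    intro X j p
    rw [← moment_C_mul, ← moment_sub hβ]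
    congr 1
    rw [pow_succ, shift]
    ring
  induction j generalizing p with
  | zero => simpa using hasDerivAt_moment hβ p T X
  | succ j ih =>
    simp only [key]
    refine ((ih (Polynomial.X * p)).sub ((hasDerivAt_profile hβ hT X).mul (ih p))).congr_deriv ?_
    rw [Nat.add_sub_cancel]
    cases j with
    | zero => simp; ring
    | succ j =>
      rw [Nat.add_sub_cancel, key X j p]
      push_cast
      ring

/-- The terms of order -j - 1, coming from the weight and from the motion of the centre, cancel by
integration by parts. What is left carries a factor 𝔪 and has order -j - 3, as a symbol requires. -/
theorem hasDerivAt_centered (hβ : 0 < β) {T : ℝ} (hT : T < 0) (X : ℝ) (j : ℕ) :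
    HasDerivAt (centered β j T) (slope β T X *
      (3 * β / 2 * profile β T X * (centered β (j + 2) T X - centered β 2 T X * centered β j T X) +
        β / 2 * (centered β (j + 3) T X - centered β 3 T X * centered β j T X))) X := by
  have hm := moment_one_pos hβ T X
  have h1 := (hasDerivAt_moment_shift hβ hT X j 1).div (hasDerivAt_moment hβ 1 T X) hm.ne'
  simp only [mul_one] at h1
  refine HasDerivAt.congr_deriv (f := centered β j T) h1 ?_
  have hX : ∀ j, shift (profile β T X) ^ j * Polynomial.X = shift (profile β T X) ^ (j + 1) +
      Polynomial.C (profile β T X) * shift (profile β T X) ^ j := fun j => by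
    rw [pow_succ]
    simp only [shift]
    ring
  have e1 : moment β (shift (profile β T X) ^ j * Polynomial.X) T X / moment β 1 T X =
      centered β (j + 1) T X + profile β T X * centered β j T X := by
    rw [hX]
    exact (mean_add hβ _ _ T X).trans (by rw [mean_C_mul]; rfl)
  have e2 : moment β Polynomial.X T X / moment β 1 T X = centered β 1 T X + profile β T X := by
    have := hX 0
    rw [pow_zero, one_mul] at this
    rw [this]
    exact (mean_add hβ _ _ T X).trans (by rw [mean_C_mul, mean_one hβ, mul_one]; rfl)
  have e3 : j * (slope β T X * (moment β (shift (profile β T X) ^ (j - 1)) T X / moment β 1 T X)) =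
      1 / 2 * centered β (j + 1) T X + slope β T X *
      (3 * β / 2 * profile β T X * centered β (j + 2) T X + β / 2 * centered β (j + 3) T X) := by
    rw [← slope_mul_mean_phase hβ hT, ← mean_derivative hβ]
    cases j with
    | zero => simp [mean, moment_zero]
    | succ j =>
      rw [derivative_shift_pow, mean_C_mul]
      simp only [Nat.add_sub_cancel, mean]
      push_cast
      ring
  have e4 : moment β (shift (profile β T X) ^ j) T X / moment β 1 T X = centered β j T X := rfl
  have hc := centered_one hβ hT X
  calc _ = -(1 / 2) * (moment β (shift (profile β T X) ^ j * Polynomial.X) T X / moment β 1 T X) +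
        j * (slope β T X * (moment β (shift (profile β T X) ^ (j - 1)) T X / moment β 1 T X)) +
        1 / 2 * (moment β (shift (profile β T X) ^ j) T X / moment β 1 T X) *
          (moment β Polynomial.X T X / moment β 1 T X) := by
        field_simp
        ring
    _ = _ := by
        rw [e1, e2, e3, e4]
        linear_combination (1 / 2 * centered β j T X) * hc

theorem centered_even_nonneg (hβ : 0 < β) (i : ℕ) (T X : ℝ) : 0 ≤ centered β (2 * i) T X :=
  mean_nonneg hβ (fun y => by
    rw [Polynomial.eval_pow, pow_mul]
    positivity) T X

/-- With w = y - 𝔲, integration by parts gives (2i + 1)⟨w^(2i)⟩ = ⟨w^(2i+1) phase⟩, and phase/w ≥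
1/(8𝔪) by convexity of the quartic exponent. -/
theorem centered_even_succ_le (hβ : 0 < β) {T : ℝ} (hT : T < 0) (X : ℝ) (i : ℕ) :
    centered β (2 * (i + 1)) T X ≤ 8 * (2 * i + 1) * slope β T X * centered β (2 * i) T X := by
  set u := profile β T X with hu
  have hw := slope_mul_width hβ hT X
  have hm := slope_pos hβ hT X
  rw [← hu] at hw
  have h1 : mean β (Polynomial.C ((-T + 3 * β * u ^ 2) / 8) * shift u ^ (2 * (i + 1))) T X ≤
      mean β (shift u ^ (2 * i + 1) * phase β T X) T X := by
    refine mean_mono hβ (fun y => ?_) T X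
    have hph : (phase β T X).eval y = (y - u) * (1 / 2 * (-T + β * (3 * u ^ 2 + 3 * u * (y - u) +
        (y - u) ^ 2))) := by
      rw [phase_eq hβ hT X, ← hu]
      simp only [Polynomial.eval_mul, Polynomial.eval_add, Polynomial.eval_C, Polynomial.eval_pow,
        eval_shift]
      ring
    rw [Polynomial.eval_mul, Polynomial.eval_mul, hph]
    simp only [Polynomial.eval_C, Polynomial.eval_pow, eval_shift]
    have h2 : (y - u) ^ (2 * i + 1) * ((y - u) * (1 / 2 * (-T + β * (3 * u ^ 2 + 3 * u * (y - u) +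
        (y - u) ^ 2)))) = (1 / 2 * (-T + β * (3 * u ^ 2 + 3 * u * (y - u) + (y - u) ^ 2))) *
        (y - u) ^ (2 * (i + 1)) := by
      rw [show 2 * (i + 1) = 2 * i + 1 + 1 by ring, pow_succ (y - u) (2 * i + 1)]
      ring
    rw [h2]
    refine mul_le_mul_of_nonneg_right ?_ (by rw [pow_mul]; positivity)
    -- Uses 3u² + 3uw + w² = (w + 3u/2)² + 3u²/4 with w = y - u.
    nlinarith [mul_nonneg hβ.le (sq_nonneg ((y - u) + 3 * u / 2))]
  rw [← mean_derivative hβ, derivative_shift_pow, mean_C_mul, mean_C_mul] at h1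
  have h2 := mul_le_mul_of_nonneg_left h1 (mul_nonneg (by norm_num : (0 : ℝ) ≤ 8) hm.le)
  change _ * (_ * centered β (2 * (i + 1)) T X) ≤ _ * (_ * centered β (2 * i) T X) at h2
  calc _ = 8 * slope β T X * ((-T + 3 * β * u ^ 2) / 8 * centered β (2 * (i + 1)) T X) := by
        linear_combination (-centered β (2 * (i + 1)) T X) * hw
    _ ≤ _ := h2
    _ = _ := by
        push_cast
        ring

theorem exists_centered_even_le (hβ : 0 < β) (i : ℕ) : ∃ C : ℝ, 0 ≤ C ∧ ∀ T < 0, ∀ X,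
    centered β (2 * i) T X ≤ C * dist β T X ^ (-((2 * i : ℕ) : ℤ)) := by
  induction i with
  | zero => exact ⟨1, zero_le_one, fun T _ X => by simp [centered_zero hβ]⟩
  | succ i ih =>
    obtain ⟨C, hC0, hC⟩ := ih
    refine ⟨8 * (2 * i + 1) * C, by positivity, fun T hT X =>
      (centered_even_succ_le hβ hT X i).trans ?_⟩
    have hd := dist_pos (X := X) hβ hT
    rw [slope_eq_dist hβ, show -((2 * (i + 1) : ℕ) : ℤ) = -2 + -((2 * i : ℕ) : ℤ) by push_cast; ring,
      zpow_add₀ hd.ne']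
    calc _ ≤ 8 * (2 * i + 1) * dist β T X ^ (-2 : ℤ) * (C * dist β T X ^ (-((2 * i : ℕ) : ℤ))) :=
          mul_le_mul_of_nonneg_left (hC T hT X) (by positivity)
      _ = _ := by ring

theorem exists_abs_centered_le (hβ : 0 < β) (j : ℕ) : ∃ C : ℝ, ∀ T < 0, ∀ X,
    |centered β j T X| ≤ C * dist β T X ^ (-(j : ℤ)) := by
  obtain ⟨i, rfl | rfl⟩ := j.even_or_odd'
  · obtain ⟨C, -, hC⟩ := exists_centered_even_le hβ i
    exact ⟨C, fun T hT X => by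
      rw [abs_of_nonneg (centered_even_nonneg hβ i T X)]
      exact hC T hT X⟩
  · obtain ⟨C, -, hC⟩ := exists_centered_even_le hβ i
    obtain ⟨D, -, hD⟩ := exists_centered_even_le hβ (i + 1)
    refine ⟨(C + D) / 2, fun T hT X => ?_⟩
    set d := dist β T X with hd'
    have hd : 0 < d := dist_pos (X := X) hβ hT
    -- An odd moment is estimated by its even neighbours, weighted with 𝔇^(∓1) so that both have the
    -- same order. The sign s = ±1 gives both directions.
    have hle : ∀ s : ℝ, s ^ 2 = 1 → s * centered β (2 * i + 1) T X ≤
        d⁻¹ / 2 * centered β (2 * i) T X + d / 2 * centered β (2 * (i + 1)) T X := by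
      intro s hs
      rw [centered, centered, centered, ← mean_C_mul, ← mean_C_mul, ← mean_C_mul, ← mean_add hβ]
      refine mean_mono hβ (fun y => ?_) T X
      simp only [Polynomial.eval_add, Polynomial.eval_mul, Polynomial.eval_C, Polynomial.eval_pow,
        eval_shift]
      set w := y - profile β T X
      have hw : 0 ≤ w ^ (2 * i) := by rw [pow_mul]; positivity
      have : 0 ≤ d⁻¹ / 2 * (1 - s * d * w) ^ 2 * w ^ (2 * i) := by positivity
      have e : d⁻¹ / 2 * (1 - s * d * w) ^ 2 * w ^ (2 * i) = d⁻¹ / 2 * w ^ (2 * i) +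
          d / 2 * w ^ (2 * (i + 1)) - s * w ^ (2 * i + 1) := by
        rw [show 2 * (i + 1) = 2 * i + 2 by ring, pow_add, pow_succ w (2 * i)]
        field_simp
        linear_combination (d ^ 2 * w ^ 2 * w ^ (2 * i)) * hs
      linarith
    have hb : d⁻¹ / 2 * centered β (2 * i) T X + d / 2 * centered β (2 * (i + 1)) T X ≤
        (C + D) / 2 * d ^ (-((2 * i + 1 : ℕ) : ℤ)) := by
      have e1 : d ^ (-((2 * i + 1 : ℕ) : ℤ)) = d⁻¹ * d ^ (-((2 * i : ℕ) : ℤ)) := by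
        rw [← zpow_neg_one, ← zpow_add₀ hd.ne']
        congr 1
        push_cast
        ring
      have e2 : d ^ (-((2 * i + 1 : ℕ) : ℤ)) = d * d ^ (-((2 * (i + 1) : ℕ) : ℤ)) := by
        rw [← zpow_one_add₀ hd.ne']
        congr 1
      calc _ ≤ d⁻¹ / 2 * (C * d ^ (-((2 * i : ℕ) : ℤ))) +
            d / 2 * (D * d ^ (-((2 * (i + 1) : ℕ) : ℤ))) :=
            add_le_add (mul_le_mul_of_nonneg_left (hC T hT X) (by positivity))
              (mul_le_mul_of_nonneg_left (hD T hT X) (by positivity))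
        _ = _ := by linear_combination (-C / 2) * e1 - D / 2 * e2
    rw [abs_le]
    constructor
    · have := hle (-1) (by norm_num)
      linarith
    · have := hle 1 (by norm_num)
      linarith

theorem contDiff_moment_shift (hβ : 0 < β) {T : ℝ} (hT : T < 0) (j : ℕ) (p : Polynomial ℝ) :
    ContDiff ℝ ∞ (fun X => moment β (shift (profile β T X) ^ j * p) T X) := by
  induction j generalizing p with
  | zero =>
    simp only [pow_zero, one_mul]
    exact (smoothFor_moment hβ p).contDiff (mem_univ T)
  | succ j ih =>
    have : (fun X => moment β (shift (profile β T X) ^ (j + 1) * p) T X) =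
        fun X => moment β (shift (profile β T X) ^ j * (Polynomial.X * p)) T X -
          profile β T X * moment β (shift (profile β T X) ^ j * p) T X := by
      funext X
      rw [← moment_C_mul, ← moment_sub hβ]
      congr 1
      rw [pow_succ, shift]
      ring
    rw [this]
    exact (ih _).sub (((smoothFor_profile hβ).contDiff hT).mul (ih p))

theorem contDiff_centered (hβ : 0 < β) (j : ℕ) {T : ℝ} (hT : T < 0) :
    ContDiff ℝ ∞ (centered β j T) := by
  have h := (contDiff_moment_shift hβ hT j 1).div
    ((smoothFor_moment hβ 1).contDiff (mem_univ T)) fun X => (moment_one_pos hβ T X).ne'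
  simp only [mul_one] at h
  exact h

/-- The induction runs over the number of derivatives, for all j at once, because the derivative of
the j-th moment involves the moments j + 2 and j + 3. -/
theorem sym_centered (hβ : 0 < β) (j : ℕ) : Sym β (-(j : ℤ)) (centered β j) := by
  intro n
  induction n generalizing j with
  | zero =>
    obtain ⟨C, hC⟩ := exists_abs_centered_le hβ j
    exact SymUpTo.of_bound (fun T hT => contDiff_centered hβ j hT) hC
  | succ n ih =>
    refine ((ih j).of_le (Nat.zero_le n)).succ ?_
    have hu := sym_profile hβ n
    have hm := sym_slope hβ n
    have h2 : SymUpTo β n (-((j + 2 : ℕ) : ℤ)) (fun T X => centered β (j + 2) T X -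
        centered β 2 T X * centered β j T X) :=
      (ih (j + 2)).sub hβ (((ih 2).mul hβ (ih j)).mono hβ (by push_cast; omega))
    have h3 : SymUpTo β n (-((j + 3 : ℕ) : ℤ)) (fun T X => centered β (j + 3) T X -
        centered β 3 T X * centered β j T X) :=
      (ih (j + 3)).sub hβ (((ih 3).mul hβ (ih j)).mono hβ (by push_cast; omega))
    have h4 : SymUpTo β n (-(j : ℤ) - 1) (fun T X => 3 * β / 2 * profile β T X *
        (centered β (j + 2) T X - centered β 2 T X * centered β j T X) +
        β / 2 * (centered β (j + 3) T X - centered β 3 T X * centered β j T X)) :=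
      (((hu.const_mul hβ (3 * β / 2)).mul hβ h2).mono hβ (by push_cast; omega)).add
        ((h3.const_mul hβ (β / 2)).mono hβ (by push_cast; omega))
    exact ((hm.mul hβ h4).mono hβ (by omega)).congr fun T hT X =>
      (hasDerivAt_centered hβ hT X j).deriv

theorem sym_centered_one (hβ : 0 < β) : Sym β (-3) (centered β 1) := by
  have h1 := ((sym_profile hβ).const_mul hβ (3 * β)).mul hβ (sym_centered hβ 2)
  have h2 := (sym_centered hβ 3).const_mul hβ β
  have h3 := ((sym_slope hβ).mul hβ (h1.add (h2.mono hβ (by norm_num)))).const_mul hβ (-1)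
  refine (h3.mono hβ (by norm_num)).congr fun T hT X => ?_
  rw [centered_one hβ hT]
  ring

/-- Powers of y are expanded in powers of y - 𝔲 and 𝔲. The order need not be optimal, as it only
starts the bootstrap. -/
theorem exists_sym_mean (hβ : 0 < β) (p : Polynomial ℝ) : ∃ r : ℤ, Sym β r (mean β p) := by
  have hmon : ∀ n j : ℕ, Sym β ((n : ℤ) - j)
      (fun T X => mean β (shift (profile β T X) ^ j * Polynomial.X ^ n) T X) := by
    intro n
    induction n with
    | zero => 
      intro j
      refine ((sym_centered hβ j).mono hβ (by simp)).congr fun T _ X => ?_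
      rw [pow_zero, mul_one]
      rfl
    | succ n ih =>
      intro j
      have h1 := ((ih (j + 1)).mono hβ (s := (((n + 1 : ℕ) : ℤ) - j)) (by push_cast; omega)).add
        (((sym_profile hβ).mul hβ (ih j)).mono hβ (by push_cast; omega))
      refine h1.congr fun T _ X => ?_
      rw [← mean_C_mul, ← mean_add hβ]
      congr 1
      rw [pow_succ (shift _), shift]
      ring
  induction p using Polynomial.induction_on' with
  | add p q hp hq =>
    obtain ⟨r, hr⟩ := hp
    obtain ⟨s, hs⟩ := hq
    exact ⟨max r s, ((hr.mono hβ (le_max_left r s)).add (hs.mono hβ (le_max_right r s))).congr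
      fun T _ X => mean_add hβ p q T X⟩
  | monomial n a =>
    refine ⟨n, (((hmon n 0).mono hβ (by simp)).const_mul hβ a).congr fun T _ X => ?_⟩
    rw [← Polynomial.C_mul_X_pow_eq_monomial, mean_C_mul, pow_zero, one_mul]

theorem exists_sym_innerSol (hβ : 0 < β) {P : ℕ → Polynomial ℝ} (hP : P 0 = 1) (ℓ : ℕ) :
    ∃ r : ℤ, Sym β r (innerSol β P ℓ) := by
  induction ℓ using Nat.strong_induction_on with
  | _ ℓ ih =>
    have hterm : ∀ j, ∃ r : ℤ, j < ℓ →
        Sym β r (fun T X => innerSol β P j T X * mean β (P (ℓ - j)) T X) := fun j => by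
      by_cases hj : j < ℓ
      · obtain ⟨r, hr⟩ := ih j hj
        obtain ⟨s, hs⟩ := exists_sym_mean hβ (P (ℓ - j))
        exact ⟨r + s, fun _ => hr.mul hβ hs⟩
      · exact ⟨0, fun h => absurd h hj⟩
    choose r hr using hterm
    obtain ⟨s, hs⟩ := exists_sym_mean hβ (Polynomial.X * P ℓ)
    obtain ⟨M, hM⟩ := ((Finset.range ℓ).image r).bddAbove
    refine ⟨max s M, ((hs.mono hβ (le_max_left s M)).sub hβ (Sym.sum (s := Finset.range ℓ)
      fun j hj => (hr j (Finset.mem_range.1 hj)).mono hβ ?_)).congr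
      fun T _ X => innerSol_eq_mean hβ hP ℓ T X⟩
    exact (hM (by simpa using ⟨j, Finset.mem_range.1 hj, rfl⟩)).trans (le_max_right s M)

theorem sym_innerSol_zero_sub_profile (hβ : 0 < β) {P : ℕ → Polynomial ℝ} (hP : P 0 = 1) :
    Sym β (-3) (fun T X => innerSol β P 0 T X - profile β T X) := by
  refine (sym_centered_one hβ).congr fun T _ X => ?_
  rw [innerSol_eq_mean hβ hP, Finset.range_zero, Finset.sum_empty, sub_zero, hP, mul_one, centered,
    pow_one, shift, mean_sub hβ]
  have := mean_C_mul β (profile β T X) 1 T X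
  rw [mul_one, mean_one hβ, mul_one] at this
  rw [this]

end Mean

end ShockFormation

namespace ShockFormation

open Filter Topology Set MeasureTheory

/-! ### Asymptotic expansions in the far field -/

/-- `g` agrees with `∑_{k < K} G k` up to a symbol of order `w - 4 K`, and each `G k` is a symbol of
order `w - 4 k`. -/
def HasExp (β : ℝ) (w : ℤ) (K : ℕ) (g : ℝ → ℝ → ℝ) (G : ℕ → ℝ → ℝ → ℝ) : Prop :=
  Sym β (w - 4 * K) (fun T X => g T X - ∑ k ∈ Finset.range K, G k T X) ∧
    ∀ k : ℕ, Sym β (w - 4 * k) (G k)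

namespace HasExp

variable {β : ℝ} {w v : ℤ} {K : ℕ} {g h : ℝ → ℝ → ℝ} {G H : ℕ → ℝ → ℝ → ℝ}

theorem sym (hβ : 0 < β) (hg : HasExp β w K g G) : Sym β w g :=
  ((hg.1.mono hβ (s := w) (by omega)).add (Sym.sum (s := Finset.range K) fun k _ =>
    (hg.2 k).mono hβ (s := w) (by omega))).congr fun T _ X => by ring

theorem truncate (hβ : 0 < β) (hg : HasExp β w K g G) {J : ℕ} (hJ : J ≤ K) : HasExp β w J g G := by
  refine ⟨((hg.1.mono hβ (by omega)).add (Sym.sum (s := Finset.Ico J K) fun k hk =>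
    (hg.2 k).mono hβ ?_)).congr fun T _ X => ?_, hg.2⟩
  · have := (Finset.mem_Ico.1 hk).1
    omega
  · rw [← Finset.sum_range_add_sum_Ico _ hJ]
    ring

theorem congr (hg : HasExp β w K g G) (he : ∀ T < 0, ∀ X, h T X = g T X)
    (hE : ∀ k, ∀ T < 0, ∀ X, H k T X = G k T X) : HasExp β w K h H :=
  ⟨hg.1.congr fun T hT X => by
    rw [he T hT X, Finset.sum_congr rfl fun k _ => hE k T hT X], fun k => (hg.2 k).congr (hE k)⟩

theorem add (hg : HasExp β w K g G) (hh : HasExp β w K h H) :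
    HasExp β w K (fun T X => g T X + h T X) (fun k T X => G k T X + H k T X) :=
  ⟨(hg.1.add hh.1).congr fun T _ X => by
    rw [Finset.sum_add_distrib]
    ring, fun k => (hg.2 k).add (hh.2 k)⟩

theorem zero : HasExp β w K (fun _ _ => 0) (fun _ _ _ => 0) :=
  ⟨Sym.zero.congr fun T _ X => by simp, fun _ => Sym.zero⟩

theorem sum {ι : Type*} {s : Finset ι} {g : ι → ℝ → ℝ → ℝ} {G : ι → ℕ → ℝ → ℝ → ℝ}
    (hG : ∀ i ∈ s, HasExp β w K (g i) (G i)) :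
    HasExp β w K (fun T X => ∑ i ∈ s, g i T X) (fun k T X => ∑ i ∈ s, G i k T X) := by
  classical
  induction s using Finset.induction_on with
  | empty => simpa using HasExp.zero
  | insert a s ha ih =>
    simp only [Finset.sum_insert ha]
    exact (hG a (Finset.mem_insert_self a s)).add
      (ih fun i hi => hG i (Finset.mem_insert_of_mem hi))

theorem const_mul (hβ : 0 < β) (c : ℝ) (hg : HasExp β w K g G) :
    HasExp β w K (fun T X => c * g T X) (fun k T X => c * G k T X) :=
  ⟨(hg.1.const_mul hβ c).congr fun T _ X => by
    rw [← Finset.mul_sum]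
    ring, fun k => (hg.2 k).const_mul hβ c⟩

theorem mul (hβ : 0 < β) (hg : HasExp β w K g G) (hh : HasExp β v K h H) :
    HasExp β (w + v) K (fun T X => g T X * h T X)
      (fun k T X => ∑ p ∈ Finset.HasAntidiagonal.antidiagonal k, G p.1 T X * H p.2 T X) := by
  constructor
  -- The remainder is split as (g - ∑_{i<K} G_i) h + ∑_{i<K} G_i (h - ∑_{j<K-i} H_j). Truncating h
  -- at K - i gives every summand the order w + v - 4K.
  · have h1 := (hg.1.mul hβ (hh.sym hβ)).mono hβ (s := w + v - 4 * K) (by omega)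
    have h2 : Sym β (w + v - 4 * K) (fun T X => ∑ i ∈ Finset.range K,
        G i T X * (h T X - ∑ j ∈ Finset.range (K - i), H j T X)) :=
      Sym.sum fun i hi => ((hg.2 i).mul hβ (hh.truncate hβ (Nat.sub_le K i)).1).mono hβ (by
        have := Finset.mem_range.1 hi
        omega)
    refine (h1.add h2).congr fun T _ X => ?_
    simp only [Finset.Nat.sum_antidiagonal_eq_sum_range_succ_mk]
    rw [Finset.sum_range_diag_flip K fun i j => G i T X * H j T X]
    simp only [mul_sub, Finset.sum_sub_distrib, Finset.mul_sum, sub_mul, Finset.sum_mul]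
    ring
  · intro k
    refine Sym.sum fun p hp => ((hg.2 p.1).mul hβ (hh.2 p.2)).mono hβ ?_
    have := Finset.HasAntidiagonal.mem_antidiagonal.1 hp
    omega

/-- A derivative lowers the order by 3 = 4 - 1. It is booked as one further power of the viscosity
with the weight raised by 1, matching the operator κ∂_X on the outer side. -/
theorem dX (hβ : 0 < β) (hg : HasExp β w K g G) :
    HasExp β (w + 1) K (fun T X => deriv (g T) X)
      (fun k T X => if 0 < k then deriv (G (k - 1) T) X else 0) := by
  constructor
  · cases K with
    | zero => simpa using ((hg.sym hβ).dX).mono hβ (by omega)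
    | succ K =>
      refine ((hg.truncate hβ (Nat.le_succ K)).1.dX.mono hβ (by push_cast; omega)).congr
        fun T hT X => ?_
      rw [Finset.sum_range_succ']
      simp only [Nat.zero_lt_succ, if_true, Nat.add_sub_cancel, lt_irrefl, if_false, add_zero]
      have h1 := ((hg.sym hβ).differentiableAt hT X).hasDerivAt.sub
        (HasDerivAt.fun_sum (u := Finset.range K) fun k _ =>
          ((hg.2 k).differentiableAt hT X).hasDerivAt)
      exact h1.deriv.symm
  · intro k
    by_cases hk : 0 < k
    · simp only [hk, if_true]
      exact ((hg.2 (k - 1)).dX).mono hβ (by omega)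
    · simp only [hk, if_false]
      exact Sym.zero

end HasExp

/-! ### Expansions of the powers (U - 2∂_X)ⁿ 1 and of the inner solutions. -/

section Expansion

variable {f : ℝ → ℝ} {K : ℕ}

theorem hasExp_one (β : ℝ) (hK : 0 < K) :
    HasExp β 0 K (fun _ _ => 1) (fun k _ _ => if k = 0 then 1 else 0) := by
  refine ⟨Sym.zero.congr fun T _ X => ?_, fun k => ?_⟩
  · rw [Finset.sum_ite_eq' (Finset.range K) 0, if_pos (Finset.mem_range.2 hK), sub_self]
  · by_cases hk : k = 0
    · subst hk
      simpa using Sym.const 1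
    · simp only [hk, if_false]
      exact Sym.zero

/-- The recursions for (U - 2∂_X)ⁿ 1 and (U - 2κ∂_X)ⁿ 1 agree term by term. The j-th member involves
only V_i with i ≤ j, so hypotheses up to ℓ suffice. -/
theorem hasExp_famPow (hf : IsShockDatum f) (hK : 0 < K) {V : ℕ → ℝ → ℝ → ℝ} {ℓ : ℕ}
    (hV : ∀ j ≤ ℓ, HasExp (beta₃ f) ((j : ℤ) + 1) K (V j) fun k => outerComponent f k j) (n : ℕ) :
    ∀ j ≤ ℓ, HasExp (beta₃ f) ((n : ℤ) + j) K (famPow V n j) fun k => outerPow f n k j := by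
  have hβ := beta₃_pos hf
  induction n with
  | zero =>
    intro j _
    by_cases hj : j = 0
    · subst hj
      refine (hasExp_one (beta₃ f) hK).congr (fun T _ X => ?_) fun k T _ X => ?_
      · rw [famPow_zero, if_pos rfl]
      · rw [outerPow_zero]
        simp
    · refine HasExp.zero.congr (fun T _ X => ?_) fun k T _ X => ?_
      · rw [famPow_zero, if_neg hj]
      · rw [outerPow_zero, if_neg fun h => hj h.2]
  | succ n ih =>
    intro j hj
    have h1 : HasExp (beta₃ f) (((n + 1 : ℕ) : ℤ) + j) K
        (fun T X => ∑ q ∈ Finset.HasAntidiagonal.antidiagonal j, V q.1 T X * famPow V n q.2 T X)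
        (fun k T X => ∑ q ∈ Finset.HasAntidiagonal.antidiagonal j,
          ∑ p ∈ Finset.HasAntidiagonal.antidiagonal k,
            outerComponent f p.1 q.1 T X * outerPow f n p.2 q.2 T X) := by
      refine HasExp.sum fun q hq => ?_
      have hq' := Finset.HasAntidiagonal.mem_antidiagonal.1 hq
      have := (hV q.1 (by omega)).mul hβ (ih q.2 (by omega))
      rwa [show ((q.1 : ℤ) + 1) + (n + q.2) = ((n + 1 : ℕ) : ℤ) + j by push_cast; omega] at this
    have h2 := ((ih j hj).dX hβ).const_mul hβ (-2)
    rw [show (n : ℤ) + j + 1 = ((n + 1 : ℕ) : ℤ) + j by push_cast; omega] at h2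
    refine (h1.add h2).congr (fun T _ X => ?_) fun k T _ X => ?_
    · rw [famPow_succ]
      ring
    · rw [outerPow_succ, Finset.sum_comm]
      ring

/-- The coefficients of the characteristic polynomials, summed over the orders in the viscosity. -/
noncomputable def tiltCoeff (C : ℕ → ℕ → ℝ) (n j : ℕ) : ℝ :=
  ∑ k ∈ Finset.range (j + 1), charCoeff C n k j

theorem charCoeff_of_ne (C : ℕ → ℕ → ℝ) {n k j : ℕ} (h : 4 * k + n ≠ j + 3) :
    charCoeff C n k j = 0 := if_neg fun h' => h h'.2

theorem charCoeff_zero (C : ℕ → ℕ → ℝ) (n k : ℕ) : charCoeff C n k 0 = 0 := if_neg fun h => by omega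

/-- A constant has order 0, and a nonzero coefficient occurs only for 4k = j + 3 - n, where the
required order is exactly 0. -/
theorem hasExp_tiltCoeff {β : ℝ} (hβ : 0 < β) (C : ℕ → ℕ → ℝ) (n j K : ℕ) :
    HasExp β ((j : ℤ) + 3 - n) K (fun _ _ => tiltCoeff C n j) (fun k _ _ => charCoeff C n k j) := by
  have hc : ∀ k : ℕ, Sym β ((j : ℤ) + 3 - n - 4 * k) (fun _ _ => charCoeff C n k j) := fun k => by
    by_cases h : 4 * k + n = j + 3
    · exact (Sym.const _).mono hβ (by omega)
    · rw [charCoeff_of_ne C h]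
      exact Sym.zero
  refine ⟨?_, hc⟩
  -- The sum over k ≤ j loses nothing: 4k ≤ j + 3 and j ≥ 1 imply k ≤ j.
  have h0 : ∀ k, j + 1 ≤ k → charCoeff C n k j = 0 := fun k hk => by
    by_cases hj : j = 0
    · rw [hj, charCoeff_zero]
    · exact charCoeff_of_ne C (by omega)
  have hsum : ∀ N, j + 1 ≤ N → tiltCoeff C n j = ∑ k ∈ Finset.range N, charCoeff C n k j := by
    intro N hN
    exact Finset.sum_subset (Finset.range_subset_range.2 hN) fun k _ hk =>
      h0 k (by have := Finset.mem_range.not.1 hk; omega)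
  refine (Sym.sum (s := Finset.Ico K (K + j + 1)) fun k hk => (hc k).mono hβ ?_).congr
    fun T _ X => ?_
  · have := (Finset.mem_Ico.1 hk).1
    omega
  · rw [hsum (K + j + 1) (by omega), ← Finset.sum_range_add_sum_Ico _ (by omega : K ≤ K + j + 1)]
    ring

theorem sum_antidiagonal_sub (a a' b b' : ℕ → ℝ) (ℓ : ℕ) (ha : ∀ j < ℓ, a j = a' j)
    (hb : ∀ j < ℓ, b j = b' j) :
    ∑ p ∈ Finset.HasAntidiagonal.antidiagonal ℓ, a p.1 * b p.2 -
      ∑ p ∈ Finset.HasAntidiagonal.antidiagonal ℓ, a' p.1 * b' p.2 =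
      (a ℓ - a' ℓ) * b' 0 + a 0 * (b ℓ - b' ℓ) := by
  cases ℓ with
  | zero =>
    simp
    ring
  | succ ℓ =>
    have key : ∀ c d : ℕ → ℝ, ∑ p ∈ Finset.HasAntidiagonal.antidiagonal (ℓ + 1), c p.1 * d p.2 =
        ∑ i ∈ Finset.range ℓ, c (i + 1) * d (ℓ + 1 - (i + 1)) + c 0 * d (ℓ + 1) +
          c (ℓ + 1) * d 0 := fun c d => by
      rw [Finset.Nat.sum_antidiagonal_eq_sum_range_succ_mk, Finset.sum_range_succ,
        Finset.sum_range_succ']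
      simp only [Nat.sub_self, Nat.sub_zero]
    have : ∀ i ∈ Finset.range ℓ, a (i + 1) * b (ℓ + 1 - (i + 1)) =
        a' (i + 1) * b' (ℓ + 1 - (i + 1)) := fun i hi => by
      have := Finset.mem_range.1 hi
      rw [ha _ (by omega), hb _ (by omega)]
    rw [key, key, Finset.sum_congr rfl this, ha 0 (by omega), hb 0 (by omega)]
    ring

/-- The increment of `famPow V 3` when the `ℓ`-th member of the family changes. -/
theorem famPow_three_sub {J : Set ℝ} (hJ : IsOpen J) {U V : ℕ → ℝ → ℝ → ℝ}
    (hU : ∀ j, SmoothFor J (U j)) (hV : ∀ j, SmoothFor J (V j)) {ℓ : ℕ} (h : ∀ j < ℓ, U j = V j)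
    {E : ℝ → ℝ → ℝ} (hE : E = fun T X => U ℓ T X - V ℓ T X) {T : ℝ} (hT : T ∈ J) (X : ℝ) :
    famPow U 3 ℓ T X - famPow V 3 ℓ T X =
      E T X * (V 0 T X * V 0 T X - 2 * deriv (V 0 T) X) +
      U 0 T X * ((U 0 T X + V 0 T X) * E T X - 2 * deriv (E T) X) -
      2 * (deriv (fun x => (U 0 T x + V 0 T x) * E T x) X - 2 * deriv (fun x => deriv (E T) x) X) := by
  have h1 : ∀ (W : ℕ → ℝ → ℝ → ℝ) (j : ℕ), famPow W 1 j = W j := fun W j =>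
    funext fun T => funext fun X => famPow_one W j T X
  have hlow2 : ∀ j < ℓ, famPow U 2 j = famPow V 2 j := by
    intro j hj
    funext T X
    rw [famPow_succ, famPow_succ]
    simp only [h1]
    rw [h j hj, Finset.sum_congr rfl fun p hp => by
      have := Finset.HasAntidiagonal.mem_antidiagonal.1 hp
      rw [h p.1 (by omega), h p.2 (by omega)]]
  have hEs : SmoothFor J E := by
    rw [hE]
    exact (hU ℓ).sub (hV ℓ)
  have h2 : ∀ x, famPow U 2 ℓ T x - famPow V 2 ℓ T x =
      (U 0 T x + V 0 T x) * E T x - 2 * deriv (E T) x := by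
    intro x
    rw [famPow_succ, famPow_succ]
    simp only [h1]
    have hd : deriv (E T) x = deriv (U ℓ T) x - deriv (V ℓ T) x := by
      rw [hE]
      exact (((hU ℓ).hasDerivAt hT x).sub ((hV ℓ).hasDerivAt hT x)).deriv
    have := sum_antidiagonal_sub (fun j => U j T x) (fun j => V j T x) (fun j => U j T x)
      (fun j => V j T x) ℓ (fun j hj => by rw [h j hj]) (fun j hj => by rw [h j hj])
    rw [hd]
    simp only [hE]
    linear_combination this
  have hd2 : deriv (famPow U 2 ℓ T) X - deriv (famPow V 2 ℓ T) X =
      deriv (fun x => (U 0 T x + V 0 T x) * E T x) X - 2 * deriv (fun x => deriv (E T) x) X := by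
    have hl := ((smoothFor_famPow hJ hU 2 ℓ).hasDerivAt hT X).sub
      ((smoothFor_famPow hJ hV 2 ℓ).hasDerivAt hT X)
    have hr := (((((hU 0).add (hV 0)).mul hEs).hasDerivAt hT X)).sub
      (((hEs.dX hJ).hasDerivAt hT X).const_mul 2)
    refine hl.unique (hr.congr_of_eventuallyEq (.of_forall fun x => ?_))
    exact h2 x
  have hV2 : famPow V 2 0 T X = V 0 T X * V 0 T X - 2 * deriv (V 0 T) X := by
    rw [famPow_succ]
    simp [h1]
  have h3 := sum_antidiagonal_sub (fun j => U j T X) (fun j => V j T X)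
    (fun j => famPow U 2 j T X) (fun j => famPow V 2 j T X) ℓ (fun j hj => by rw [h j hj])
    (fun j hj => by rw [hlow2 j hj])
  simp only [h2 X, hV2] at h3
  rw [famPow_succ, famPow_succ]
  have hEX : U ℓ T X - V ℓ T X = E T X := by rw [hE]
  rw [hEX] at h3
  linear_combination h3 - 2 * hd2

/-- The series of the inner solutions with coefficients matched to the outer expansion. -/
noncomputable def tiltFamily (C : ℕ → ℕ → ℝ) : ℕ → Polynomial ℝ :=
  tiltPoly fun j => ∑ n ∈ Finset.range (j + 4), Polynomial.C (tiltCoeff C n j) * Polynomial.X ^ n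

theorem tiltFamily_zero (C : ℕ → ℕ → ℝ) : tiltFamily C 0 = 1 := tiltPoly_zero _

/-! ### Improvement of decay for the difference between inner solution and outer partial sum. -/

section Bootstrap

variable {C : ℕ → ℕ → ℝ}

theorem famPow_innerSol_equation {β : ℝ} (hβ : 0 < β) (C : ℕ → ℕ → ℝ) (ℓ : ℕ) (T X : ℝ) :
    (if ℓ = 0 then X else 0) - T * innerSol β (tiltFamily C) ℓ T X +
      β * famPow (innerSol β (tiltFamily C)) 3 ℓ T X =
      ∑ n ∈ Finset.range (ℓ + 4), ∑ p ∈ Finset.HasAntidiagonal.antidiagonal ℓ,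
        tiltCoeff C n p.1 * famPow (innerSol β (tiltFamily C)) n p.2 T X := by
  rw [← famPow_one (innerSol β (tiltFamily C)) ℓ]
  refine famPow_equation hβ (fun n j hj => ?_) (fun n => ?_) rfl ℓ T X
  · exact Finset.sum_eq_zero fun k _ => charCoeff_of_ne C (by omega)
  · exact Finset.sum_eq_zero fun k _ => charCoeff_zero C n k

/-- The equation for the difference of the inner solution and the partial sum of the outer
expansion. -/
theorem sym_difference_equation (hf : IsShockDatum f)
    (hC : ∀ k ℓ, k + ℓ ≠ 0 → (ℓ + 3 < 4 * k → C k ℓ = 0) ∧ ∀ y : ℝ,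
      Tendsto (fun T => (-T + 3 * beta₃ f * y ^ 2) * outerComponent f k ℓ T
        (T * y - beta₃ f * y ^ 3)) atBot (𝓝 (C k ℓ * y ^ (ℓ + 3 - 4 * k))))
    (hK : 0 < K) (ℓ : ℕ)
    (ih : ∀ j < ℓ, HasExp (beta₃ f) ((j : ℤ) + 1) K (innerSol (beta₃ f) (tiltFamily C) j)
      fun k => outerComponent f k j)
    {V : ℕ → ℝ → ℝ → ℝ} (hV : V = Function.update (innerSol (beta₃ f) (tiltFamily C)) ℓ
      fun T X => ∑ k ∈ Finset.range K, outerComponent f k ℓ T X) :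
    Sym (beta₃ f) ((ℓ : ℤ) + 3 - 4 * K) (fun T X =>
      -T * (innerSol (beta₃ f) (tiltFamily C) ℓ T X - V ℓ T X) +
      beta₃ f * (famPow (innerSol (beta₃ f) (tiltFamily C)) 3 ℓ T X - famPow V 3 ℓ T X)) := by
  have hβ := beta₃_pos hf
  set U := innerSol (beta₃ f) (tiltFamily C) with hU
  have hVlt : ∀ j < ℓ, V j = U j := fun j hj => by
    rw [hV, Function.update_of_ne hj.ne]
  have hVℓ : V ℓ = fun T X => ∑ k ∈ Finset.range K, outerComponent f k ℓ T X := by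
    rw [hV, Function.update_self]
  have hVexp : ∀ j ≤ ℓ, HasExp (beta₃ f) ((j : ℤ) + 1) K (V j) fun k => outerComponent f k j := by
    intro j hj
    rcases hj.lt_or_eq with h | rfl
    · rw [hVlt j h]
      exact ih j h
    · refine ⟨Sym.zero.congr fun T _ X => by rw [hVℓ, sub_self], fun k =>
        ((profilePoly_outerComponent_zero hf k j).sym hβ)⟩
  have h3 := (hasExp_famPow hf hK hVexp 3 ℓ le_rfl).1.const_mul hβ (-beta₃ f)
  have hsum : HasExp (beta₃ f) ((ℓ : ℤ) + 3) K
      (fun T X => ∑ n ∈ Finset.range (ℓ + 4), ∑ q ∈ Finset.HasAntidiagonal.antidiagonal ℓ,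
        tiltCoeff C n q.1 * famPow U n q.2 T X)
      (fun k T X => ∑ n ∈ Finset.range (ℓ + 4), ∑ q ∈ Finset.HasAntidiagonal.antidiagonal ℓ,
        ∑ p ∈ Finset.HasAntidiagonal.antidiagonal k,
          charCoeff C n p.1 q.1 * outerPow f n p.2 q.2 T X) := by
    refine HasExp.sum fun n _ => HasExp.sum fun q hq => ?_
    have hq' := Finset.HasAntidiagonal.mem_antidiagonal.1 hq
    -- The coefficients vanish at index 0, so only U_j with j < ℓ enters here, and for these the
    -- expansion is already known.
    by_cases h0 : q.1 = 0
    · refine HasExp.zero.congr (fun T _ X => ?_) fun k T _ X => ?_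
      · rw [h0, tiltCoeff, Finset.sum_eq_zero fun k _ => charCoeff_zero C n k, zero_mul]
      · exact Finset.sum_eq_zero fun p _ => by rw [h0, charCoeff_zero, zero_mul]
    · have hlt : q.2 < ℓ := by omega
      have h1 := (hasExp_tiltCoeff hβ C n q.1 K).mul hβ (hasExp_famPow hf hK
        (V := U) (fun j hj => ih j (hj.trans_lt hlt)) n q.2 le_rfl)
      rwa [show (q.1 : ℤ) + 3 - n + (n + q.2) = (ℓ : ℤ) + 3 by omega] at h1
  refine ((hsum.1.mono hβ (s := (ℓ : ℤ) + 3 - 4 * K) (by omega)).add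
    (h3.mono hβ (s := (ℓ : ℤ) + 3 - 4 * K) (by push_cast; omega))).congr fun T hT X => ?_
  have e1 := famPow_innerSol_equation hβ C ℓ T X
  rw [← hU] at e1
  have e2 : ∑ k ∈ Finset.range K, ∑ n ∈ Finset.range (ℓ + 4),
      ∑ q ∈ Finset.HasAntidiagonal.antidiagonal ℓ, ∑ p ∈ Finset.HasAntidiagonal.antidiagonal k,
        charCoeff C n p.1 q.1 * outerPow f n p.2 q.2 T X =
      (if ℓ = 0 then X else 0) - T * V ℓ T X +
        beta₃ f * ∑ k ∈ Finset.range K, outerPow f 3 k ℓ T X := by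
    have hk : ∀ k ∈ Finset.range K, ∑ n ∈ Finset.range (ℓ + 4),
        ∑ q ∈ Finset.HasAntidiagonal.antidiagonal ℓ, ∑ p ∈ Finset.HasAntidiagonal.antidiagonal k,
          charCoeff C n p.1 q.1 * outerPow f n p.2 q.2 T X =
        (if k = 0 then (if ℓ = 0 then X else 0) else 0) - T * outerComponent f k ℓ T X +
          beta₃ f * outerPow f 3 k ℓ T X := fun k _ => by
      rw [← ite_and, outerPow_equation hf hC k ℓ hT X]
      exact Finset.sum_congr rfl fun n _ => Finset.sum_comm
    rw [Finset.sum_congr rfl hk, Finset.sum_add_distrib, Finset.sum_sub_distrib, ← Finset.mul_sum,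
      ← Finset.mul_sum, Finset.sum_ite_eq' (Finset.range K) 0, if_pos (Finset.mem_range.2 hK), hVℓ]
  beta_reduce
  rw [e2, ← e1]
  ring

/-- A solution of the difference equation gains decay. -/
theorem sym_gain {β : ℝ} (hβ : 0 < β) {r s : ℤ} {E U V : ℝ → ℝ → ℝ} (hE : Sym β r E)
    (hU : Sym β (-3) (fun T X => U T X - profile β T X))
    (hV : Sym β (-3) (fun T X => V T X - profile β T X))
    (heq : Sym β s (fun T X => -T * E T X + β * (E T X * (V T X * V T X - 2 * deriv (V T) X) +
      U T X * ((U T X + V T X) * E T X - 2 * deriv (E T) X) -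
      2 * (deriv (fun x => (U T x + V T x) * E T x) X - 2 * deriv (fun x => deriv (E T) x) X)))) :
    Sym β (max (r - 4) (s - 2)) E := by
  have hu := sym_profile hβ
  have hU1 : Sym β 1 U := ((hU.mono hβ (by norm_num)).add hu).congr fun T _ X => by ring
  have hV1 : Sym β 1 V := ((hV.mono hβ (by norm_num)).add hu).congr fun T _ X => by ring
  -- Replacing U and V by 𝔲 in the undifferentiated coefficients of E leaves (-T + 3β𝔲²) E. All
  -- errors, and all terms with a derivative, have order r - 2.
  have h1 : Sym β (r - 2) (fun T X => E T X * ((V T X - profile β T X) *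
      (V T X + profile β T X))) := (hE.mul hβ (hV.mul hβ (hV1.add hu))).mono hβ (by omega)
  have h2 : Sym β (r - 2) (fun T X => E T X * deriv (V T) X) :=
    (hE.mul hβ hV1.dX).mono hβ (by omega)
  have h3 : Sym β (r - 2) (fun T X => E T X * ((U T X - profile β T X) *
      (U T X + profile β T X) + (U T X - profile β T X) * V T X +
      profile β T X * (V T X - profile β T X))) :=
    (hE.mul hβ (((hU.mul hβ (hU1.add hu)).add (hU.mul hβ hV1)).add
      ((hu.mul hβ hV).mono hβ (by norm_num)))).mono hβ (by omega)
  have h4 : Sym β (r - 2) (fun T X => U T X * deriv (E T) X) :=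
    (hU1.mul hβ hE.dX).mono hβ (by omega)
  have h5 : Sym β (r - 2) (fun T X => deriv (fun x => (U T x + V T x) * E T x) X) :=
    (((hU1.add hV1).mul hβ hE).dX).mono hβ (by omega)
  have h6 : Sym β (r - 2) (fun T X => deriv (fun x => deriv (E T) x) X) :=
    (hE.dX.dX).mono hβ (by omega)
  have hrest := ((((h1.add (h2.const_mul hβ (-2))).add h3).add (h4.const_mul hβ (-2))).add
    (h5.const_mul hβ (-2))).add (h6.const_mul hβ 4)
  have htot := (heq.mono hβ (le_max_right (r - 2) s)).add
    ((hrest.const_mul hβ (-β)).mono hβ (le_max_left (r - 2) s))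
  -- Multiplication by 𝔪 recovers E and lowers the order by another 2.
  refine (((sym_slope hβ).mul hβ htot).mono hβ (by omega)).congr fun T hT X => ?_
  linear_combination (-E T X) * slope_mul_width hβ hT X

theorem sym_outer_partial_sum_zero_sub (hf : IsShockDatum f) (hK : 0 < K) :
    Sym (beta₃ f) (-3) (fun T X => ∑ k ∈ Finset.range K, outerComponent f k 0 T X -
      profile (beta₃ f) T X) := by
  have hβ := beta₃_pos hf
  obtain ⟨K, rfl⟩ : ∃ J, K = J + 1 := ⟨K - 1, by omega⟩
  refine (Sym.sum (s := Finset.range K) (G := fun k => outerComponent f (k + 1) 0) (r := -3)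
    fun k _ => ((profilePoly_outerComponent_zero hf (k + 1) 0).sym hβ).mono hβ
      (by push_cast; omega)).congr fun T _ X => ?_
  rw [Finset.sum_range_succ', outerComponent_zero_zero]
  ring

/-- Induction over ℓ. For fixed ℓ, the difference E starts with some finite order, and each use of
`sym_gain` lowers it by 4 until the order ℓ + 1 - 4K of the truncation is reached. -/
theorem hasExp_innerSol (hf : IsShockDatum f)
    (hC : ∀ k ℓ, k + ℓ ≠ 0 → (ℓ + 3 < 4 * k → C k ℓ = 0) ∧ ∀ y : ℝ,
      Tendsto (fun T => (-T + 3 * beta₃ f * y ^ 2) * outerComponent f k ℓ T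
        (T * y - beta₃ f * y ^ 3)) atBot (𝓝 (C k ℓ * y ^ (ℓ + 3 - 4 * k))))
    (hK : 0 < K) (ℓ : ℕ) :
    HasExp (beta₃ f) ((ℓ : ℤ) + 1) K (innerSol (beta₃ f) (tiltFamily C) ℓ)
      fun k => outerComponent f k ℓ := by
  have hβ := beta₃_pos hf
  induction ℓ using Nat.strong_induction_on with
  | _ ℓ ih =>
  set U := innerSol (beta₃ f) (tiltFamily C) with hU
  set S : ℝ → ℝ → ℝ := fun T X => ∑ k ∈ Finset.range K, outerComponent f k ℓ T X with hS
  set V := Function.update U ℓ S with hV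
  have hUs : ∀ j, SmoothFor (Iio 0) (U j) := fun j =>
    (smoothFor_innerSol hβ (tiltFamily_zero C) j).mono (subset_univ _)
  have hSs : SmoothFor (Iio 0) S := SmoothFor.sum fun k _ => smoothFor_outerComponent hf k ℓ
  have hVs : ∀ j, SmoothFor (Iio 0) (V j) := fun j => by
    by_cases hj : j = ℓ
    · rw [hj, hV, Function.update_self]
      exact hSs
    · rw [hV, Function.update_of_ne hj]
      exact hUs j
  have hVℓ : V ℓ = S := by rw [hV, Function.update_self]
  have hlt : ∀ j < ℓ, U j = V j := fun j hj => by rw [hV, Function.update_of_ne hj.ne]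
  have hout : ∀ k : ℕ, Sym (beta₃ f) ((ℓ : ℤ) + 1 - 4 * k) (outerComponent f k ℓ) := fun k =>
    (profilePoly_outerComponent_zero hf k ℓ).sym hβ
  have hU0 : Sym (beta₃ f) (-3) (fun T X => U 0 T X - profile (beta₃ f) T X) :=
    sym_innerSol_zero_sub_profile hβ (tiltFamily_zero C)
  have hV0 : Sym (beta₃ f) (-3) (fun T X => V 0 T X - profile (beta₃ f) T X) := by
    by_cases h0 : ℓ = 0
    · subst h0
      rw [hVℓ]
      exact sym_outer_partial_sum_zero_sub hf hK
    · rw [← hlt 0 (by omega)]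
      exact hU0
  set E : ℝ → ℝ → ℝ := fun T X => U ℓ T X - V ℓ T X with hE
  have heq := sym_difference_equation hf hC hK ℓ ih hV
  have heq' := heq.congr (h := fun T X => -T * E T X + beta₃ f *
      (E T X * (V 0 T X * V 0 T X - 2 * deriv (V 0 T) X) +
      U 0 T X * ((U 0 T X + V 0 T X) * E T X - 2 * deriv (E T) X) -
      2 * (deriv (fun x => (U 0 T x + V 0 T x) * E T x) X - 2 * deriv (fun x => deriv (E T) x) X)))
    fun T hT X => by rw [← famPow_three_sub isOpen_Iio hUs hVs hlt hE hT X]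
  have hloop : ∀ (N : ℕ) (r : ℤ), r ≤ (ℓ : ℤ) + 1 - 4 * K + 4 * N → Sym (beta₃ f) r E →
      Sym (beta₃ f) ((ℓ : ℤ) + 1 - 4 * K) E := by
    intro N
    induction N with
    | zero => exact fun r hr h => h.mono hβ (by simpa using hr)
    | succ N ihN =>
      intro r hr h
      have := sym_gain hβ h hU0 hV0 heq'
      by_cases hle : r - 4 ≤ (ℓ : ℤ) + 3 - 4 * K - 2
      · exact this.mono hβ (by omega)
      · exact ihN _ (by push_cast at hr; omega) this
  obtain ⟨r, hr⟩ := exists_sym_innerSol hβ (tiltFamily_zero C) ℓ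
  have hE0 : Sym (beta₃ f) (max r ((ℓ : ℤ) + 1)) E := by
    refine (hr.mono hβ (le_max_left _ _)).sub hβ ?_
    rw [hVℓ]
    exact Sym.sum fun k _ => (hout k).mono hβ (le_trans (by omega) (le_max_right r ((ℓ : ℤ) + 1)))
  refine ⟨(hloop (max r ((ℓ : ℤ) + 1) - ((ℓ : ℤ) + 1 - 4 * K)).toNat _ (by omega) hE0).congr
    fun T _ X => ?_, hout⟩
  simp only [hE, hVℓ, hS]

theorem farFieldBound_innerSol (hf : IsShockDatum f)
    (hC : ∀ k ℓ, k + ℓ ≠ 0 → (ℓ + 3 < 4 * k → C k ℓ = 0) ∧ ∀ y : ℝ,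
      Tendsto (fun T => (-T + 3 * beta₃ f * y ^ 2) * outerComponent f k ℓ T
        (T * y - beta₃ f * y ^ 3)) atBot (𝓝 (C k ℓ * y ^ (ℓ + 3 - 4 * k)))) (ℓ i k : ℕ) :
    FarFieldBound f (innerSol (beta₃ f) (tiltFamily C) ℓ) ℓ i k := by
  -- K = k + 1 terms give the order ℓ + 1 - 4(k + 1) - 3i, the exponent of the far-field bound.
  obtain ⟨D, hD⟩ := ((hasExp_innerSol hf hC (Nat.succ_pos k) ℓ).1 i).2 i le_rfl
  refine ⟨D, fun T X hz => (hD T X hz).trans_eq ?_⟩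
  rw [innerDist]
  congr 2
  push_cast
  ring

end Bootstrap

end Expansion

/-! ### Uniqueness for the heat equation -/

/-- The maximum principle with a weak differential inequality at the positive maxima. -/
theorem nonpos_of_weak_max {Z : ℝ → ℝ → ℝ} {a b p q : ℝ}
    (hcont : ContinuousOn (fun z : ℝ × ℝ => Z z.1 z.2) (Icc a b ×ˢ Icc p q))
    (hT : ∀ T ∈ Ioc a b, ∀ X ∈ Ioo p q, DifferentiableAt ℝ (fun s => Z s X) T)
    (h0 : ∀ X ∈ Icc p q, Z a X ≤ 0)
    (hp : ∀ T ∈ Icc a b, Z T p ≤ 0) (hq : ∀ T ∈ Icc a b, Z T q ≤ 0)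
    (hmax : ∀ T ∈ Ioc a b, ∀ X ∈ Ioo p q, 0 < Z T X → deriv (Z T) X = 0 →
      iteratedDeriv 2 (Z T) X ≤ 0 → deriv (fun s => Z s X) T ≤ 0) :
    ∀ T ∈ Icc a b, ∀ X ∈ Icc p q, Z T X ≤ 0 := by
  -- Subtracting ε(T - a) turns the weak inequality at the maxima into a strict one.
  have key : ∀ ε > 0, ∀ T ∈ Icc a b, ∀ X ∈ Icc p q, Z T X - ε * (T - a) ≤ 0 := by
    intro ε hε
    have hsub : ∀ T : ℝ, (fun x => Z T x - ε * (T - a)) = fun x => -(ε * (T - a)) + Z T x :=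
      fun T => funext fun x => by ring
    refine nonpos_of_no_positive_max (Z := fun T X => Z T X - ε * (T - a))
      (hcont.sub (by fun_prop)) (fun T hTm X hX => (hT T hTm X hX).sub (by fun_prop))
      (fun X hX => by simpa using h0 X hX)
      (fun T hTm => ?_) (fun T hTm => ?_) fun T hTm X hX hpos h1 h2 h3 => ?_
    · have := mul_nonneg hε.le (sub_nonneg.2 hTm.1)
      linarith [hp T hTm]
    · have := mul_nonneg hε.le (sub_nonneg.2 hTm.1)
      linarith [hq T hTm]
    · have hpos' : 0 < Z T X := by
        have := mul_nonneg hε.le (sub_nonneg.2 hTm.1.le)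
        linarith
      rw [hsub, deriv_const_add] at h1
      rw [hsub] at h2
      have h2' : iteratedDeriv 2 (Z T) X ≤ 0 := by
        have hd : deriv (fun x => -(ε * (T - a)) + Z T x) = deriv (Z T) :=
          funext fun x => deriv_const_add _
        simp only [iteratedDeriv_succ, iteratedDeriv_zero] at h2 ⊢
        rwa [hd] at h2
      have h4 := hmax T hTm X hX hpos' h1 h2'
      have h5 : HasDerivAt (fun s => Z s X - ε * (s - a)) (deriv (fun s => Z s X) T - ε * 1) T :=
        (hT T hTm X hX).hasDerivAt.sub (((hasDerivAt_id T).sub_const a).const_mul ε)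
      rw [h5.deriv] at h3
      linarith
  intro T hTm X hX
  by_contra! hpos
  have h1 := key (Z T X / (2 * (T - a + 1))) (by have := hTm.1; have : 0 < T - a + 1 := by linarith
                                                 positivity) T hTm X hX
  have h2 : 0 < T - a + 1 := by linarith [hTm.1]
  have h3 : Z T X / (2 * (T - a + 1)) * (T - a) ≤ Z T X / 2 := by
    rw [div_mul_eq_mul_div, div_le_div_iff₀ (by positivity) (by norm_num)]
    nlinarith
  linarith

/-- `Ψ` is a solution of the heat equation for the times in `J`. -/
def IsHeat (J : Set ℝ) (Ψ : ℝ → ℝ → ℝ) : Prop :=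
  ContinuousOn (fun z : ℝ × ℝ => Ψ z.1 z.2) (J ×ˢ univ) ∧ ∃ Φ₁ Φ₂ : ℝ → ℝ → ℝ, ∀ T ∈ J, ∀ X : ℝ,
    HasDerivAt (Ψ T) (Φ₁ T X) X ∧ HasDerivAt (Φ₁ T) (Φ₂ T X) X ∧
      HasDerivAt (fun s => Ψ s X) (Φ₂ T X) T

namespace IsHeat

variable {J : Set ℝ} {Ψ Φ : ℝ → ℝ → ℝ}

theorem sub (hΨ : IsHeat J Ψ) (hΦ : IsHeat J Φ) : IsHeat J (fun T X => Ψ T X - Φ T X) := by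
  obtain ⟨hc, a, b, h⟩ := hΨ
  obtain ⟨hc', a', b', h'⟩ := hΦ
  exact ⟨hc.sub hc', fun T X => a T X - a' T X, fun T X => b T X - b' T X, fun T hT X =>
    ⟨(h T hT X).1.sub (h' T hT X).1, (h T hT X).2.1.sub (h' T hT X).2.1,
      (h T hT X).2.2.sub (h' T hT X).2.2⟩⟩

theorem const_mul (c : ℝ) (hΨ : IsHeat J Ψ) : IsHeat J (fun T X => c * Ψ T X) := by
  obtain ⟨hc, a, b, h⟩ := hΨ
  exact ⟨continuousOn_const.mul hc, fun T X => c * a T X, fun T X => c * b T X, fun T hT X =>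
    ⟨(h T hT X).1.const_mul c, (h T hT X).2.1.const_mul c, (h T hT X).2.2.const_mul c⟩⟩

theorem const (c : ℝ) : IsHeat J (fun _ _ => c) :=
  ⟨continuousOn_const, fun _ _ => 0, fun _ _ => 0, fun T _ X =>
    ⟨hasDerivAt_const X c, hasDerivAt_const X 0, hasDerivAt_const T c⟩⟩

theorem mono {J' : Set ℝ} (hΨ : IsHeat J Ψ) (h : J' ⊆ J) : IsHeat J' Ψ := by
  obtain ⟨hc, a, b, hab⟩ := hΨ
  exact ⟨hc.mono (prod_mono h Subset.rfl), a, b, fun T hT X => hab T (h hT) X⟩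

theorem nonpos {a b p q : ℝ} (hΨ : IsHeat (Icc a b) Ψ) (h0 : ∀ X ∈ Icc p q, Ψ a X ≤ 0)
    (hp : ∀ T ∈ Icc a b, Ψ T p ≤ 0) (hq : ∀ T ∈ Icc a b, Ψ T q ≤ 0) :
    ∀ T ∈ Icc a b, ∀ X ∈ Icc p q, Ψ T X ≤ 0 := by
  obtain ⟨hc, Φ₁, Φ₂, h⟩ := hΨ
  refine nonpos_of_weak_max (hc.mono (prod_mono Subset.rfl (subset_univ _)))
    (fun T hT X _ => (h T (Ioc_subset_Icc_self hT) X).2.2.differentiableAt) h0 hp hq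
    fun T hT X _ _ _ h2 => ?_
  have hT' := Ioc_subset_Icc_self hT
  have e : deriv (Ψ T) = Φ₁ T := funext fun x => (h T hT' x).1.deriv
  simp only [iteratedDeriv_succ, iteratedDeriv_zero, e, (h T hT' X).2.1.deriv] at h2
  rw [(h T hT' X).2.2.deriv]
  exact h2

end IsHeat

/-- The Gaussian solutions of the heat equation, forward for `t + c > 0`, backward for `t + c < 0`. -/
noncomputable def gaussian (c Y t X : ℝ) : ℝ :=
  Real.exp (-(1 / 2) * Real.log (t + c) - (X - Y) ^ 2 / (4 * (t + c)))

/-- Since `Real.log` is the logarithm of the absolute value, the same formula and computation cover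
both signs of t + c. -/
theorem isHeat_gaussian {c Y : ℝ} {J : Set ℝ} (hJ : ∀ t ∈ J, t + c ≠ 0) :
    IsHeat J (gaussian c Y) := by
  refine ⟨?_, fun t X => -(X - Y) / (2 * (t + c)) * gaussian c Y t X,
    fun t X => (-1 / (2 * (t + c)) + (X - Y) ^ 2 / (4 * (t + c) ^ 2)) * gaussian c Y t X,
    fun t ht X => ?_⟩
  · refine ContinuousOn.rexp (ContinuousOn.sub (continuousOn_const.mul
      (ContinuousOn.log (by fun_prop) fun z hz => hJ z.1 hz.1))
      (ContinuousOn.div (by fun_prop) (by fun_prop) fun z hz => ?_))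
    have := hJ z.1 hz.1
    positivity
  · have h0 := hJ t ht
    have hX : ∀ X, HasDerivAt (gaussian c Y t) (-(X - Y) / (2 * (t + c)) * gaussian c Y t X) X := by
      intro X
      have h1 : HasDerivAt (fun X : ℝ => -(1 / 2) * Real.log (t + c) - (X - Y) ^ 2 / (4 * (t + c)))
          (-(2 * (X - Y) / (4 * (t + c)))) X := by
        have := ((((hasDerivAt_id X).sub_const Y).pow 2).div_const (4 * (t + c))).const_sub
          (-(1 / 2) * Real.log (t + c))
        simpa using this
      refine h1.exp.congr_deriv ?_
      rw [gaussian]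
      field_simp
      ring
    refine ⟨hX X, ?_, ?_⟩
    · have h2 := (((hasDerivAt_id X).sub_const Y).neg.div_const (2 * (t + c))).mul (hX X)
      refine h2.congr_deriv ?_
      simp
      field_simp
      ring
    · have h3 : HasDerivAt (fun s : ℝ => s + c) 1 t := (hasDerivAt_id t).add_const c
      have h4 := ((h3.log h0).const_mul (-(1 / 2))).sub
        ((hasDerivAt_const t ((X - Y) ^ 2)).div (h3.const_mul 4) (by positivity))
      refine h4.exp.congr_deriv ?_
      simp only [gaussian]
      simp
      field_simp
      ring

/-- A solution of the heat equation that vanishes initially and grows at most like a Gaussian is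
nonpositive for a short time. -/
theorem IsHeat.nonpos_of_le_exp_sq {Ψ : ℝ → ℝ → ℝ} {a b A α : ℝ} (hα : 0 ≤ α)
    (hΨ : IsHeat (Icc a b) Ψ) (hb : b ≤ a + (16 * (α + 1))⁻¹) (h0 : ∀ X, Ψ a X ≤ 0)
    (hle : ∀ T ∈ Icc a b, ∀ X, Ψ T X ≤ A * Real.exp (α * X ^ 2)) :
    ∀ T ∈ Icc a b, ∀ X, Ψ T X ≤ 0 := by
  -- The barrier is a backward Gaussian that becomes singular at time a + 2δ. On [a, b] it grows at
  -- least like exp(X²/(8δ)) = exp(2(α + 1)X²), faster than the solution.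
  set δ := (16 * (α + 1))⁻¹ with hδ
  have hδ0 : 0 < δ := by positivity
  have hδα : 16 * (α + 1) * δ = 1 := mul_inv_cancel₀ (by positivity)
  set c := -(a + 2 * δ) with hc
  have hneg : ∀ t ∈ Icc a b, -(2 * δ) ≤ t + c ∧ t + c ≤ -δ := fun t ht => by
    constructor <;> linarith [ht.1, ht.2]
  have hlow : ∀ t ∈ Icc a b, ∀ X, Real.exp (-(1 / 2) * Real.log (2 * δ)) *
      Real.exp (2 * (α + 1) * X ^ 2) ≤ gaussian c 0 t X := by
    intro t ht X
    obtain ⟨h1, h2⟩ := hneg t ht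
    rw [← Real.exp_add, gaussian]
    refine Real.exp_le_exp.2 ?_
    have hl : Real.log (t + c) ≤ Real.log (2 * δ) := by
      rw [← Real.log_neg_eq_log]
      exact Real.log_le_log (by linarith) (by linarith)
    have hq : 2 * (α + 1) * X ^ 2 ≤ -((X - 0) ^ 2 / (4 * (t + c))) := by
      rw [sub_zero, ← div_neg, le_div_iff₀ (by linarith)]
      have : 2 * (α + 1) * (-(4 * (t + c))) ≤ 1 := by nlinarith
      nlinarith [sq_nonneg X]
    linarith
  intro T hT X
  set B := Real.exp (-(1 / 2) * Real.log (2 * δ)) with hB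
  have hB0 : 0 < B := Real.exp_pos _
  have key : ∀ ε > 0, Ψ T X - ε * gaussian c 0 T X ≤ 0 := by
    intro ε hε
    set L := |X| + 1 + |A| / (ε * B) with hL
    have hL1 : 1 ≤ L := by
      have : 0 ≤ |A| / (ε * B) := by positivity
      have := abs_nonneg X
      linarith
    have hbd : ∀ t ∈ Icc a b, ∀ x, x ^ 2 = L ^ 2 → Ψ t x - ε * gaussian c 0 t x ≤ 0 := by
      intro t ht x hx
      have h1 := hle t ht x
      have h2 := mul_le_mul_of_nonneg_left (hlow t ht x) hε.le
      rw [hx] at h1 h2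
      have h3 : A ≤ ε * B * Real.exp (L ^ 2) := by
        have h4 : |A| / (ε * B) ≤ Real.exp (L ^ 2) := by
          have := Real.add_one_le_exp (L ^ 2)
          have := abs_nonneg X
          nlinarith
        rw [div_le_iff₀ (by positivity)] at h4
        linarith [le_abs_self A]
      have h5 : A * Real.exp (α * L ^ 2) ≤ ε * B * Real.exp (L ^ 2) * Real.exp (α * L ^ 2) :=
        mul_le_mul_of_nonneg_right h3 (Real.exp_pos _).le
      have h6 : Real.exp (L ^ 2) * Real.exp (α * L ^ 2) ≤ Real.exp (2 * (α + 1) * L ^ 2) := by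
        rw [← Real.exp_add]
        exact Real.exp_le_exp.2 (by nlinarith [sq_nonneg L])
      have h7 := mul_le_mul_of_nonneg_left h6 (by positivity : 0 ≤ ε * B)
      linarith
    have hheat : IsHeat (Icc a b) (fun t x => Ψ t x - ε * gaussian c 0 t x) :=
      hΨ.sub ((isHeat_gaussian fun t ht => by linarith [(hneg t ht).2]).const_mul ε)
    refine hheat.nonpos (p := -L) (q := L) (fun x _ => ?_) (fun t ht => hbd t ht _ (by ring))
      (fun t ht => hbd t ht _ rfl) T hT X ?_
    · have : 0 < ε * gaussian c 0 a x := mul_pos hε (Real.exp_pos _)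
      linarith [h0 x]
    · have : 0 ≤ |A| / (ε * B) := by positivity
      exact ⟨by linarith [neg_abs_le X], by linarith [le_abs_self X]⟩
  have hg : 0 < gaussian c 0 T X := Real.exp_pos _
  by_contra! hpos
  have := key (Ψ T X / (2 * gaussian c 0 T X)) (by positivity)
  rw [div_mul_eq_mul_div, mul_div_mul_right _ _ hg.ne'] at this
  linarith

/-- Tychonoff's uniqueness theorem. -/
theorem IsHeat.eq_zero {Ψ : ℝ → ℝ → ℝ} {R A α : ℝ} (hα : 0 ≤ α) (hΨ : IsHeat (Icc 0 R) Ψ)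
    (h0 : ∀ X, Ψ 0 X = 0) (hle : ∀ T ∈ Icc 0 R, ∀ X, |Ψ T X| ≤ A * Real.exp (α * X ^ 2)) :
    ∀ T ∈ Icc 0 R, ∀ X, Ψ T X = 0 := by
  set δ := (16 * (α + 1))⁻¹ with hδ
  have hδ0 : 0 < δ := by positivity
  -- The short-time result is iterated; the step δ depends only on α.
  have key : ∀ n : ℕ, ∀ T ∈ Icc 0 R, T ≤ n * δ → ∀ X, Ψ T X = 0 := by
    intro n
    induction n with
    | zero =>
      intro T hT hn X
      have : T = 0 := le_antisymm (by simpa using hn) hT.1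
      rw [this, h0]
    | succ n ih =>
      intro T hT hn X
      by_cases hTn : T ≤ n * δ
      · exact ih T hT hTn X
      · have hn0 : 0 ≤ n * δ := by positivity
        have hsub : Icc (n * δ) T ⊆ Icc 0 R := Icc_subset_Icc hn0 hT.2
        have hz : ∀ X, Ψ (n * δ) X = 0 := ih _ (hsub (left_mem_Icc.2 (not_le.1 hTn).le)) le_rfl
        have hb : T ≤ n * δ + (16 * (α + 1))⁻¹ := by
          push_cast at hn
          linarith
        have hm : T ∈ Icc (n * δ) T := right_mem_Icc.2 (not_le.1 hTn).le
        refine le_antisymm ((hΨ.mono hsub).nonpos_of_le_exp_sq hα hb (fun X => (hz X).le)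
          (fun t ht X => (le_abs_self _).trans (hle t (hsub ht) X)) T hm X) ?_
        have h2 := (((hΨ.mono hsub).const_mul (-1))).nonpos_of_le_exp_sq (A := A) hα hb
          (fun X => by rw [hz X]; simp)
          (fun t ht X => by
            have := (neg_le_abs _).trans (hle t (hsub ht) X)
            linarith) T hm X
        linarith
  intro T hT X
  obtain ⟨n, hn⟩ := exists_nat_ge (T / δ)
  exact key n T hT (by rwa [div_le_iff₀ hδ0] at hn) X

/-! ### Growth of positive solutions of the heat equation -/

theorem exists_mul_pow_le_exp (K : ℝ) (N : ℕ) : ∃ C : ℝ, 5 ≤ C ∧ ∀ Y : ℝ,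
    K * (2 + |Y|) ^ N ≤ Real.exp (C * (1 + Y ^ 2)) := by
  refine ⟨|K| + 2 * N + 5, le_add_of_nonneg_left (by positivity), fun Y => ?_⟩
  have h1 : 2 + |Y| ≤ Real.exp (2 * (1 + Y ^ 2)) := by
    have := Real.add_one_le_exp (2 * (1 + Y ^ 2))
    nlinarith [sq_nonneg (|Y| - 1), sq_abs Y]
  have h2 : (2 + |Y|) ^ N ≤ Real.exp (2 * N * (1 + Y ^ 2)) := by
    refine (pow_le_pow_left₀ (by positivity) h1 N).trans_eq ?_
    rw [← Real.exp_nat_mul]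
    ring_nf
  have h3 : |K| ≤ Real.exp (|K| * (1 + Y ^ 2)) := by
    have := Real.add_one_le_exp (|K| * (1 + Y ^ 2))
    nlinarith [mul_nonneg (abs_nonneg K) (sq_nonneg Y)]
  calc K * (2 + |Y|) ^ N ≤ |K| * (2 + |Y|) ^ N :=
        mul_le_mul_of_nonneg_right (le_abs_self K) (by positivity)
    _ ≤ Real.exp (|K| * (1 + Y ^ 2)) * Real.exp (2 * N * (1 + Y ^ 2)) :=
        mul_le_mul h3 h2 (by positivity) (Real.exp_pos _).le
    _ = Real.exp ((|K| + 2 * N) * (1 + Y ^ 2)) := by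
        rw [← Real.exp_add]
        ring_nf
    _ ≤ _ := Real.exp_le_exp.2 (by nlinarith [sq_nonneg Y])

/-- A bound for the logarithmic derivative gives a lower bound near each point. -/
theorem exp_neg_one_mul_le {g : ℝ → ℝ} (hd : Differentiable ℝ g) (hpos : ∀ x, 0 < g x) {Y r κ : ℝ}
    (hκ : κ * r ≤ 1) (hκ0 : 0 ≤ κ) (hg : ∀ x, |x - Y| ≤ r → |deriv g x| ≤ κ * g x) {x : ℝ}
    (hx : |x - Y| ≤ r) : Real.exp (-1) * g Y ≤ g x := by
  have hr : 0 ≤ r := (abs_nonneg _).trans hx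
  have hmem : ∀ z, z ∈ Icc (Y - r) (Y + r) ↔ |z - Y| ≤ r := fun z => by
    rw [abs_le, mem_Icc]
    constructor <;> rintro ⟨h1, h2⟩ <;> constructor <;> linarith
  have h := (convex_Icc (Y - r) (Y + r)).norm_image_sub_le_of_norm_hasDerivWithin_le
    (f := fun z => Real.log (g z)) (f' := fun z => deriv g z / g z) (C := κ)
    (fun z _ => ((hd z).hasDerivAt.log (hpos z).ne').hasDerivWithinAt)
    (fun z hz => by
      rw [Real.norm_eq_abs, abs_div, abs_of_pos (hpos z), div_le_iff₀ (hpos z)]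
      exact hg z ((hmem z).1 hz)) ((hmem x).2 hx) ((hmem Y).2 (by simpa using hr))
  rw [Real.norm_eq_abs, Real.norm_eq_abs, abs_sub_comm Y x] at h
  have h2 : κ * |x - Y| ≤ 1 := (mul_le_mul_of_nonneg_left hx hκ0).trans hκ
  have h3 : -1 + Real.log (g Y) ≤ Real.log (g x) := by
    linarith [le_abs_self (Real.log (g Y) - Real.log (g x))]
  have h4 := Real.exp_le_exp.2 h3
  rwa [Real.exp_add, Real.exp_log (hpos _), Real.exp_log (hpos _)] at h4

/-- A positive solution of the heat equation is bounded below by a spreading Gaussian that starts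
below it. -/
theorem IsHeat.gaussian_le {Ψ : ℝ → ℝ → ℝ} (hΨ : IsHeat univ Ψ) (hpos : ∀ T X, 0 < Ψ T X)
    {s Y m q x : ℝ} (hm : 0 ≤ m) (hq : q = 1 + Y ^ 2) (hx : 1024 ≤ x) (hqx : Real.exp q ≤ x)
    (hlow : ∀ z, |z - Y| ≤ √x⁻¹ → m ≤ Ψ s z) : m ≤ 2 * x * Real.exp q * Ψ (s + 1) 0 := by
  have hx0 : 0 < x := by linarith
  -- The Gaussian starts from a point source at time s - τ. Since τ^(-1/2) = x, its multiple by x⁻¹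
  -- has height 1 at time s and is below η = exp(-x/4) beyond the radius x^(-1/2). So m(x⁻¹ gaussian
  -- - η) lies below Ψ initially.
  set τ := (x ^ 2)⁻¹ with hτ
  have hτ0 : 0 < τ := by positivity
  have hτ1 : τ ≤ 1 := inv_le_one_of_one_le₀ (by nlinarith)
  have hlog : Real.log τ = -(2 * Real.log x) := by
    rw [hτ, Real.log_inv, Real.log_pow]
    norm_num
  have hxe : x⁻¹ = Real.exp (-Real.log x) := by rw [Real.exp_neg, Real.exp_log hx0]
  set c := τ - s with hc
  set η := Real.exp (-(x / 4)) with hη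
  have hgs : ∀ t ∈ Icc s (s + 1), τ ≤ t + c ∧ t + c ≤ 2 := fun t ht => by
    constructor <;> linarith [ht.1, ht.2]
  have hG : ∀ t ∈ Icc s (s + 1), ∀ z, x⁻¹ * gaussian c Y t z ≤ Real.exp (-((z - Y) ^ 2 / 8)) := by
    intro t ht z
    obtain ⟨h1, h2⟩ := hgs t ht
    have h3 : Real.log τ ≤ Real.log (t + c) := Real.log_le_log hτ0 h1
    rw [hxe, gaussian, ← Real.exp_add]
    refine Real.exp_le_exp.2 ?_
    have h4 : (z - Y) ^ 2 / 8 ≤ (z - Y) ^ 2 / (4 * (t + c)) :=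
      div_le_div_of_nonneg_left (sq_nonneg _) (by linarith) (by linarith)
    linarith
  -- At this distance the Gaussian stays below η until time s + 1, so the comparison function is
  -- nonpositive on the lateral boundary.
  set L := 2 * x + |Y| with hL
  have hLx : 2 * x ≤ L := by linarith [abs_nonneg Y]
  have hheat : IsHeat (Icc s (s + 1))
      (fun t z => m * (x⁻¹ * gaussian c Y t z - η) - Ψ t z) :=
    ((((isHeat_gaussian fun t ht => by linarith [(hgs t ht).1]).const_mul x⁻¹).sub
      (IsHeat.const η)).const_mul m).sub (hΨ.mono (subset_univ _))
  have hside : ∀ t ∈ Icc s (s + 1), ∀ z, (z - Y) ^ 2 = L ^ 2 →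
      m * (x⁻¹ * gaussian c Y t z - η) - Ψ t z ≤ 0 := by
    intro t ht z hz
    have h1 := hG t ht z
    have h2 : Real.exp (-((z - Y) ^ 2 / 8)) ≤ η := Real.exp_le_exp.2 (by
      rw [hz]
      nlinarith)
    have h3 := mul_le_mul_of_nonneg_left (h1.trans h2) hm
    linarith [hpos t z, mul_sub m (x⁻¹ * gaussian c Y t z) η]
  have h0 := hheat.nonpos (p := Y - L) (q := Y + L) (fun z _ => ?_)
    (fun t ht => hside t ht _ (by ring)) (fun t ht => hside t ht _ (by ring)) (s + 1)
    (right_mem_Icc.2 (by linarith)) 0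
    ⟨by linarith [le_abs_self Y], by linarith [neg_abs_le Y]⟩
  · have hg : x⁻¹ * Real.exp (-q) ≤ x⁻¹ * gaussian c Y (s + 1) 0 := by
      refine mul_le_mul_of_nonneg_left (Real.exp_le_exp.2 ?_) (by positivity)
      have e : s + 1 + c = 1 + τ := by rw [hc]; ring
      have h2 : Real.log (1 + τ) ≤ 1 := by
        have := Real.log_le_sub_one_of_pos (by linarith : 0 < 1 + τ)
        linarith
      have h3 : (0 - Y) ^ 2 / (4 * (1 + τ)) ≤ Y ^ 2 := by
        rw [div_le_iff₀ (by linarith)]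
        nlinarith [sq_nonneg Y]
      rw [e, hq]
      linarith
    -- The loss η is at most half of the Gaussian at time s + 1 and position 0: x ≥ 1024 gives η ≤
    -- 1/(2x²), and exp q ≤ x does the rest.
    have hη2 : η ≤ x⁻¹ * Real.exp (-q) / 2 := by
      have h1 : x⁻¹ ≤ Real.exp (-q) := by
        rw [Real.exp_neg]
        exact inv_anti₀ (Real.exp_pos q) hqx
      have h2 : 2 * x ^ 2 ≤ Real.exp (x / 4) := by
        have := Real.pow_div_factorial_le_exp (x / 4) (by positivity) 3
        have h6 : (Nat.factorial 3 : ℝ) = 6 := by norm_num [Nat.factorial]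
        rw [h6] at this
        nlinarith [sq_nonneg x]
      have h3 : η ≤ (2 * x ^ 2)⁻¹ := by
        rw [hη, Real.exp_neg]
        exact inv_anti₀ (by positivity) h2
      have h4 : x⁻¹ * x⁻¹ ≤ x⁻¹ * Real.exp (-q) := mul_le_mul_of_nonneg_left h1 (by positivity)
      have h5 : (2 * x ^ 2)⁻¹ = x⁻¹ * x⁻¹ / 2 := by
        field_simp
      linarith
    have h1 : m * (x⁻¹ * Real.exp (-q) / 2) ≤ Ψ (s + 1) 0 := by
      have := mul_le_mul_of_nonneg_left (by linarith :
        x⁻¹ * Real.exp (-q) / 2 ≤ x⁻¹ * gaussian c Y (s + 1) 0 - η) hm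
      linarith
    have h2 := mul_le_mul_of_nonneg_left h1 (by positivity : 0 ≤ 2 * x * Real.exp q)
    rw [Real.exp_neg] at h2
    calc m = 2 * x * Real.exp q * (m * (x⁻¹ * (Real.exp q)⁻¹ / 2)) := by
          field_simp
      _ ≤ _ := h2
  · have hz0 : x⁻¹ * gaussian c Y s z = Real.exp (-((z - Y) ^ 2 / (4 * τ))) := by
      rw [hxe, gaussian, ← Real.exp_add,
        show s + c = τ by rw [hc]; ring, hlog]
      ring_nf
    rw [hz0]
    by_cases hzr : |z - Y| ≤ √x⁻¹
    · have h1 : Real.exp (-((z - Y) ^ 2 / (4 * τ))) ≤ 1 :=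
        Real.exp_le_one_iff.2 (neg_nonpos.2 (by positivity))
      have h2 : m * (Real.exp (-((z - Y) ^ 2 / (4 * τ))) - η) ≤ m * 1 :=
        mul_le_mul_of_nonneg_left (by linarith [Real.exp_pos (-(x / 4))]) hm
      linarith [hlow z hzr]
    · have h1 : Real.exp (-((z - Y) ^ 2 / (4 * τ))) ≤ η := by
        refine Real.exp_le_exp.2 (neg_le_neg ?_)
        have h2 : x⁻¹ ≤ (z - Y) ^ 2 := by
          rw [← sq_abs, ← Real.sq_sqrt (by positivity : 0 ≤ x⁻¹)]
          exact pow_le_pow_left₀ (Real.sqrt_nonneg _) (not_le.1 hzr).le 2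
        rw [le_div_iff₀ (by positivity)]
        have h3 : x / 4 * (4 * τ) = x⁻¹ := by
          rw [hτ]
          field_simp
        rw [h3]
        exact h2
      have h2 := mul_le_mul_of_nonneg_left h1 hm
      linarith [hpos s z, mul_sub m (Real.exp (-((z - Y) ^ 2 / (4 * τ)))) η]

/-- A large value at (T, Y) stays large on a small interval by the bound for the logarithmic
derivative. The heat flow then carries a Gaussian fraction of it to (T + 1, 0), where the solution
is bounded on compact time intervals. Hence growth no faster than Gaussian. -/
theorem IsHeat.exists_le_exp_sq {Ψ : ℝ → ℝ → ℝ} (hΨ : IsHeat univ Ψ) (hpos : ∀ T X, 0 < Ψ T X)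
    {R K : ℝ} {N : ℕ} (hK : 0 ≤ K)
    (hgrad : ∀ T ∈ Icc 0 R, ∀ X, |deriv (Ψ T) X| ≤ K * (1 + |X|) ^ N * Ψ T X) :
    ∃ A α : ℝ, 0 ≤ α ∧ ∀ T ∈ Icc 0 R, ∀ X, Ψ T X ≤ A * Real.exp (α * X ^ 2) := by
  obtain ⟨C, hC5, hC⟩ := exists_mul_pow_le_exp K N
  have hcont : ContinuousOn (fun T => Ψ (T + 1) 0) (Icc 0 R) := by
    have h1 : Continuous (fun z : ℝ × ℝ => Ψ z.1 z.2) := by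
      rw [← continuousOn_univ, ← univ_prod_univ]
      exact hΨ.1
    exact (h1.comp (by fun_prop : Continuous fun T : ℝ => (T + 1, (0 : ℝ)))).continuousOn
  obtain ⟨B, hB⟩ := isCompact_Icc.exists_bound_of_continuousOn hcont
  refine ⟨2 * Real.exp 1 * B * Real.exp (2 * C + 1), 2 * C + 1, by linarith, fun T hT Y => ?_⟩
  set q := 1 + Y ^ 2 with hq
  have hq1 : 1 ≤ q := by nlinarith [sq_nonneg Y]
  -- The radius x^(-1/2) = exp(-Cq) is so small that the logarithmic derivative, at most exp(Cq)
  -- there, changes log Ψ by at most 1.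
  set x := Real.exp (2 * C * q) with hx
  have hx0 : 0 < x := Real.exp_pos _
  have hx1024 : 1024 ≤ x := by
    have h1 : (2 : ℝ) ≤ Real.exp 1 := by have := Real.add_one_le_exp 1; linarith
    have h2 := pow_le_pow_left₀ (by norm_num) h1 10
    rw [← Real.exp_nat_mul] at h2
    have h3 : Real.exp (((10 : ℕ) : ℝ) * 1) ≤ x := Real.exp_le_exp.2 (by push_cast; nlinarith)
    norm_num at h2 h3
    linarith
  have hr : √x⁻¹ = Real.exp (-(C * q)) := by
    rw [hx, ← Real.exp_neg, Real.sqrt_eq_iff_mul_self_eq (Real.exp_pos _).le (Real.exp_pos _).le,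
      ← Real.exp_add]
    ring_nf
  have hr1 : √x⁻¹ ≤ 1 := by
    rw [hr]
    exact Real.exp_le_one_iff.2 (by nlinarith)
  have hheat := hΨ
  obtain ⟨-, Φ₁, Φ₂, hd⟩ := hΨ
  have hlow : ∀ z, |z - Y| ≤ √x⁻¹ → Real.exp (-1) * Ψ T Y ≤ Ψ T z := by
    intro z hz
    refine exp_neg_one_mul_le (κ := K * (2 + |Y|) ^ N) (r := √x⁻¹)
      (fun z => (hd T (mem_univ T) z).1.differentiableAt) (hpos T) ?_ (by positivity)
      (fun w hw => (hgrad T hT w).trans ?_) hz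
    · rw [hr]
      refine (mul_le_mul_of_nonneg_right (hC Y) (Real.exp_pos _).le).trans ?_
      rw [← Real.exp_add]
      simp [hq]
    · have h1 : |w| ≤ 1 + |Y| := by
        have := abs_add_le (w - Y) Y
        rw [sub_add_cancel] at this
        linarith
      refine mul_le_mul_of_nonneg_right (mul_le_mul_of_nonneg_left ?_ hK) (hpos T w).le
      exact pow_le_pow_left₀ (by positivity) (by linarith) N
  have h1 := hheat.gaussian_le hpos (s := T) (Y := Y)
    (mul_nonneg (Real.exp_pos (-1)).le (hpos T Y).le) hq hx1024
    (Real.exp_le_exp.2 (by nlinarith)) hlow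
  have h2 : Ψ (T + 1) 0 ≤ B := (le_abs_self _).trans (hB T hT)
  have h3 := h1.trans (mul_le_mul_of_nonneg_left h2 (by positivity))
  have h4 := mul_le_mul_of_nonneg_left h3 (Real.exp_pos 1).le
  rw [← mul_assoc, ← Real.exp_add, show (1 : ℝ) + -1 = 0 by norm_num, Real.exp_zero, one_mul] at h4
  refine h4.trans_eq ?_
  have e : x * Real.exp q = Real.exp (2 * C + 1) * Real.exp ((2 * C + 1) * Y ^ 2) := by
    rw [hx, ← Real.exp_add, ← Real.exp_add, hq]
    ring_nf
  linear_combination (2 * Real.exp 1 * B) * e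

/-! ### Forward uniqueness for the Burgers equation -/

section ClassicalBurgers

variable {V W : ℝ → ℝ → ℝ}

theorem IsClassicalOn.hasDerivAt {J : Set ℝ} (hV : IsClassicalOn J V) {T : ℝ} (hT : T ∈ J) (X : ℝ) :
    HasDerivAt (V T) (deriv (V T) X) X :=
  ((hV.2.1 T hT).differentiable (by norm_num) X).hasDerivAt

theorem IsClassicalOn.hasDerivAt_deriv {J : Set ℝ} (hV : IsClassicalOn J V) {T : ℝ} (hT : T ∈ J)
    (X : ℝ) : HasDerivAt (deriv (V T)) (iteratedDeriv 2 (V T) X) X := by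
  have h1 : ContDiff ℝ (1 + 1) (V T) := by
    rw [one_add_one_eq_two]
    exact hV.2.1 T hT
  have h := ((contDiff_succ_iff_deriv.1 h1).2.2.differentiable (by norm_num) X).hasDerivAt
  simpa only [iteratedDeriv_succ, iteratedDeriv_zero] using h

/-- The solutions of the viscous Burgers equation with unit viscosity. -/
def IsBurgers (V : ℝ → ℝ → ℝ) : Prop :=
  IsClassicalOn univ V ∧ ∀ T X : ℝ, deriv (fun s => V s X) T =
    -(V T X * deriv (V T) X) + iteratedDeriv 2 (V T) X

/-- The potential of a solution of the Burgers equation. -/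
noncomputable def potential (V : ℝ → ℝ → ℝ) (T X : ℝ) : ℝ :=
  (∫ x in (0 : ℝ)..X, V T x) + ∫ s in (0 : ℝ)..T, (deriv (V s) 0 - V s 0 ^ 2 / 2)

namespace IsBurgers

theorem continuous (hV : IsBurgers V) : Continuous fun z : ℝ × ℝ => V z.1 z.2 := by
  rw [← continuousOn_univ, ← univ_prod_univ]
  exact hV.1.2.2.1

theorem continuous_deriv_time (hV : IsBurgers V) :
    Continuous fun z : ℝ × ℝ => deriv (fun s => V s z.2) z.1 := by
  rw [← continuousOn_univ, ← univ_prod_univ]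
  exact hV.1.2.2.2.1

theorem continuous_deriv (hV : IsBurgers V) : Continuous fun z : ℝ × ℝ => deriv (V z.1) z.2 := by
  rw [← continuousOn_univ, ← univ_prod_univ]
  exact hV.1.2.2.2.2.1

theorem hasDerivAt_potential (hV : IsBurgers V) (T X : ℝ) : HasDerivAt (potential V T) (V T X) X := by
  have hc : Continuous (V T) := hV.continuous.comp (by fun_prop : Continuous fun x : ℝ => (T, x))
  exact (hc.integral_hasStrictDerivAt 0 X).hasDerivAt.add_const _

/-- By the conservation form of the equation, the time derivative of ∫_0^X V is the increment of V_X
- V²/2 from 0 to X. The second integral in `potential` supplies the boundary term at 0. -/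
theorem hasDerivAt_potential_time (hV : IsBurgers V) (T X : ℝ) :
    HasDerivAt (fun s => potential V s X) (deriv (V T) X - V T X ^ 2 / 2) T := by
  have hc : ∀ T, Continuous (V T) := fun T =>
    hV.continuous.comp (by fun_prop : Continuous fun x : ℝ => (T, x))
  have hcT : ∀ T, Continuous fun x => deriv (fun s => V s x) T := fun T =>
    hV.continuous_deriv_time.comp (by fun_prop : Continuous fun x : ℝ => (T, x))
  have h0 : Continuous fun s => deriv (V s) 0 - V s 0 ^ 2 / 2 := by
    have h1 := hV.continuous_deriv.comp (by fun_prop : Continuous fun s : ℝ => (s, (0 : ℝ)))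
    have h2 := hV.continuous.comp (by fun_prop : Continuous fun s : ℝ => (s, (0 : ℝ)))
    exact h1.sub ((h2.pow 2).div_const 2)
  obtain ⟨B, hB⟩ := ((isCompact_Icc (a := T - 1) (b := T + 1)).prod
    (isCompact_uIcc (a := 0) (b := X))).exists_bound_of_continuousOn
      hV.continuous_deriv_time.continuousOn
  have h1 := (intervalIntegral.hasDerivAt_integral_of_dominated_loc_of_deriv_le
    (μ := volume) (F := V) (F' := fun s x => deriv (fun s => V s x) s) (a := 0) (b := X)
    (bound := fun _ => B) (Icc_mem_nhds (by linarith : T - 1 < T) (by linarith : T < T + 1))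
    (.of_forall fun s => (hc s).aestronglyMeasurable) ((hc T).intervalIntegrable _ _)
    (hcT T).aestronglyMeasurable
    (.of_forall fun x hx s hs => hB (s, x) ⟨hs, uIoc_subset_uIcc hx⟩)
    intervalIntegrable_const
    (.of_forall fun x _ s _ => (hV.1.1 s (mem_univ s) x).hasDerivAt)).2
  have h2 : ∫ x in (0 : ℝ)..X, deriv (fun s => V s x) T =
      (deriv (V T) X - V T X ^ 2 / 2) - (deriv (V T) 0 - V T 0 ^ 2 / 2) := by
    refine intervalIntegral.integral_eq_sub_of_hasDerivAt (f := fun x => deriv (V T) x - V T x ^ 2 / 2)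
      (fun x _ => ?_) ((hcT T).intervalIntegrable _ _)
    refine ((hV.1.hasDerivAt_deriv (mem_univ T) x).sub
      (((hV.1.hasDerivAt (mem_univ T) x).pow 2).div_const 2)).congr_deriv ?_
    rw [hV.2]
    simp
    ring
  rw [h2] at h1
  refine (h1.add (h0.integral_hasStrictDerivAt 0 T).hasDerivAt).congr_deriv ?_
  ring

theorem continuous_potential (hV : IsBurgers V) :
    Continuous fun z : ℝ × ℝ => potential V z.1 z.2 := by
  have h1 : Continuous fun z : ℝ × ℝ => ∫ x in (0 : ℝ)..z.2, V z.1 x :=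
    intervalIntegral.continuous_parametric_intervalIntegral_of_continuous
      (f := fun (z : ℝ × ℝ) x => V z.1 x)
      (hV.continuous.comp (by fun_prop : Continuous fun w : (ℝ × ℝ) × ℝ => (w.1.1, w.2)))
      continuous_snd
  have h0 : Continuous fun s => deriv (V s) 0 - V s 0 ^ 2 / 2 := by
    have h1 := hV.continuous_deriv.comp (by fun_prop : Continuous fun s : ℝ => (s, (0 : ℝ)))
    have h2 := hV.continuous.comp (by fun_prop : Continuous fun s : ℝ => (s, (0 : ℝ)))
    exact h1.sub ((h2.pow 2).div_const 2)
  exact h1.add ((intervalIntegral.continuous_primitive (fun a b => h0.intervalIntegrable a b) 0).comp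
    continuous_fst)

theorem hasDerivAt_exp_potential (hV : IsBurgers V) (T X : ℝ) :
    HasDerivAt (fun x => Real.exp (-(1 / 2) * potential V T x))
      (-(1 / 2) * V T X * Real.exp (-(1 / 2) * potential V T X)) X :=
  ((hV.hasDerivAt_potential T X).const_mul (-(1 / 2))).exp.congr_deriv (by ring)

/-- The Cole-Hopf transformation. -/
theorem isHeat_exp_potential (hV : IsBurgers V) :
    IsHeat univ fun T X => Real.exp (-(1 / 2) * potential V T X) := by
  refine ⟨(continuous_const.mul hV.continuous_potential).rexp.continuousOn,
    fun T X => -(1 / 2) * V T X * Real.exp (-(1 / 2) * potential V T X),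
    fun T X => (-(1 / 2) * deriv (V T) X + V T X ^ 2 / 4) * Real.exp (-(1 / 2) * potential V T X),
    fun T _ X => ⟨hV.hasDerivAt_exp_potential T X, ?_, ?_⟩⟩
  · refine (((hV.1.hasDerivAt (mem_univ T) X).const_mul (-(1 / 2))).mul
      (hV.hasDerivAt_exp_potential T X)).congr_deriv ?_
    ring
  · refine ((hV.hasDerivAt_potential_time T X).const_mul (-(1 / 2))).exp.congr_deriv ?_
    ring

/-- The logarithmic derivative of the transformed solution is -V/2, so polynomial growth of V is
exactly the gradient hypothesis. -/
theorem exists_exp_potential_le (hV : IsBurgers V) (hg : HasPolynomialGrowth V) (R : ℝ) :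
    ∃ A α : ℝ, 0 ≤ α ∧ ∀ T ∈ Icc 0 R, ∀ X,
      Real.exp (-(1 / 2) * potential V T X) ≤ A * Real.exp (α * X ^ 2) := by
  obtain ⟨C, N, hC⟩ := hg R
  refine hV.isHeat_exp_potential.exists_le_exp_sq (K := |C|) (N := N) (fun T X => Real.exp_pos _)
    (abs_nonneg C) fun T hT X => ?_
  rw [(hV.hasDerivAt_exp_potential T X).deriv, abs_mul, abs_of_pos (Real.exp_pos _)]
  refine mul_le_mul_of_nonneg_right ?_ (Real.exp_pos _).le
  have hV1 := hC T ⟨by linarith [hT.1, hT.2], hT.2⟩ X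
  have hV2 : C * (1 + |X|) ^ N ≤ |C| * (1 + |X|) ^ N :=
    mul_le_mul_of_nonneg_right (le_abs_self C) (by positivity)
  rw [abs_mul]
  norm_num
  linarith [abs_nonneg (V T X)]

/-- Two solutions of the Burgers equation of polynomial growth with the same initial values
coincide at all later times. -/
theorem eq_of_initial_eq (hV : IsBurgers V) (hW : IsBurgers W) (hgV : HasPolynomialGrowth V)
    (hgW : HasPolynomialGrowth W) (h0 : ∀ X, V 0 X = W 0 X) {T : ℝ} (hT : 0 ≤ T) (X : ℝ) :
    V T X = W T X := by
  obtain ⟨A, α, hα, hA⟩ := hV.exists_exp_potential_le hgV T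
  obtain ⟨B, γ, hγ, hB⟩ := hW.exists_exp_potential_le hgW T
  have hm : T ∈ Icc 0 T := right_mem_Icc.2 hT
  have hA0 : 0 ≤ A := by
    have := (Real.exp_pos _).le.trans (hA T hm X)
    exact nonneg_of_mul_nonneg_left this (Real.exp_pos _)
  have hB0 : 0 ≤ B := by
    have := (Real.exp_pos _).le.trans (hB T hm X)
    exact nonneg_of_mul_nonneg_left this (Real.exp_pos _)
  have h1 := ((hV.isHeat_exp_potential.sub hW.isHeat_exp_potential).mono
    (subset_univ (Icc 0 T))).eq_zero (A := A + B) (α := max α γ) (le_max_of_le_left hα)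
    (fun X => by
      have : potential V 0 X = potential W 0 X := by
        simp only [potential, intervalIntegral.integral_same, add_zero]
        exact intervalIntegral.integral_congr fun x _ => h0 x
      rw [this, sub_self]) (fun t ht x => by
      have e1 : A * Real.exp (α * x ^ 2) ≤ A * Real.exp (max α γ * x ^ 2) :=
        mul_le_mul_of_nonneg_left (Real.exp_le_exp.2
          (mul_le_mul_of_nonneg_right (le_max_left _ _) (sq_nonneg x))) hA0
      have e2 : B * Real.exp (γ * x ^ 2) ≤ B * Real.exp (max α γ * x ^ 2) :=
        mul_le_mul_of_nonneg_left (Real.exp_le_exp.2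
          (mul_le_mul_of_nonneg_right (le_max_right _ _) (sq_nonneg x))) hB0
      have e3 := hA t ht x
      have e4 := hB t ht x
      have e5 := Real.exp_pos (-(1 / 2) * potential V t x)
      have e6 := Real.exp_pos (-(1 / 2) * potential W t x)
      rw [abs_le, add_mul]
      constructor <;> linarith) T hm
  have h2 : (fun x => Real.exp (-(1 / 2) * potential V T x)) =
      fun x => Real.exp (-(1 / 2) * potential W T x) := funext fun x => sub_eq_zero.1 (h1 x)
  have h3 := hV.hasDerivAt_exp_potential T X
  rw [h2] at h3
  have h4 := h3.unique (hW.hasDerivAt_exp_potential T X)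
  have h5 := congrFun h2 X
  rw [h5] at h4
  have h6 := mul_right_cancel₀ (Real.exp_pos _).ne' h4
  linarith

end IsBurgers

end ClassicalBurgers

end ShockFormation

namespace ShockFormation

open Filter Topology Set MeasureTheory
open Polynomial (eval derivative)

/-! ### Growth of the inner solutions and variance bounds -/

section Growth

variable {V W : ℝ → ℝ → ℝ}

theorem one_add_abs_pow_le (C : ℝ) {N M : ℕ} (h : N ≤ M) (X : ℝ) :
    C * (1 + |X|) ^ N ≤ |C| * (1 + |X|) ^ M :=
  mul_le_mul (le_abs_self C) (pow_le_pow_right₀ (by linarith [abs_nonneg X]) h) (by positivity)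
    (abs_nonneg C)

theorem HasPolynomialGrowth.add (hV : HasPolynomialGrowth V) (hW : HasPolynomialGrowth W) :
    HasPolynomialGrowth fun T X => V T X + W T X := by
  intro R
  obtain ⟨C, N, hC⟩ := hV R
  obtain ⟨D, M, hD⟩ := hW R
  refine ⟨|C| + |D|, max N M, fun T hT X => (abs_add_le _ _).trans ?_⟩
  rw [add_mul]
  exact add_le_add ((hC T hT X).trans (one_add_abs_pow_le C (le_max_left N M) X))
    ((hD T hT X).trans (one_add_abs_pow_le D (le_max_right N M) X))

theorem HasPolynomialGrowth.mul (hV : HasPolynomialGrowth V) (hW : HasPolynomialGrowth W) :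
    HasPolynomialGrowth fun T X => V T X * W T X := by
  intro R
  obtain ⟨C, N, hC⟩ := hV R
  obtain ⟨D, M, hD⟩ := hW R
  refine ⟨|C| * |D|, N + M, fun T hT X => ?_⟩
  rw [abs_mul, pow_add, mul_mul_mul_comm]
  exact mul_le_mul ((hC T hT X).trans (one_add_abs_pow_le C le_rfl X))
    ((hD T hT X).trans (one_add_abs_pow_le D le_rfl X)) (abs_nonneg _) (by positivity)

theorem HasPolynomialGrowth.const (c : ℝ) : HasPolynomialGrowth fun _ _ => c :=
  fun _ => ⟨|c|, 0, fun _ _ _ => by simp⟩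

theorem HasPolynomialGrowth.sub (hV : HasPolynomialGrowth V) (hW : HasPolynomialGrowth W) :
    HasPolynomialGrowth fun T X => V T X - W T X := by
  have := hV.add ((HasPolynomialGrowth.const (-1)).mul hW)
  simpa [sub_eq_add_neg] using this

theorem HasPolynomialGrowth.sum {ι : Type*} {s : Finset ι} {G : ι → ℝ → ℝ → ℝ}
    (hG : ∀ i ∈ s, HasPolynomialGrowth (G i)) : HasPolynomialGrowth fun T X => ∑ i ∈ s, G i T X := by
  classical
  induction s using Finset.induction_on with
  | empty => simpa using HasPolynomialGrowth.const 0
  | insert a s ha ih =>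
    simp only [Finset.sum_insert ha]
    exact (hG a (Finset.mem_insert_self a s)).add
      (ih fun i hi => hG i (Finset.mem_insert_of_mem hi))

end Growth

section MeanGrowth

variable {β : ℝ}

/-- Integration by parts against y^(2i+1), where the quartic term of y · phase dominates y² up to a
multiple of 1 + X². Unlike the bounds in terms of 𝔇, this holds across T = 0. -/
theorem exists_mean_even_le (hβ : 0 < β) (R : ℝ) (i : ℕ) : ∃ C : ℝ, 0 ≤ C ∧ ∀ T ∈ Icc (-R) R, ∀ X,
    mean β (Polynomial.X ^ (2 * i)) T X ≤ C * (1 + X ^ 2) ^ i := by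
  induction i with
  | zero => exact ⟨1, zero_le_one, fun T _ X => by simp [mean_one hβ]⟩
  | succ i ih =>
    obtain ⟨C, hC0, hC⟩ := ih
    -- The total coefficient of y²: 1 from the left side, 1/4 from |Xy|/2 ≤ (X² + y²)/4, and |R|/2
    -- from the time term. The maximum of κy² - βy⁴/2 is κ²/(2β).
    set κ := 5 / 4 + |R| / 2 with hκ
    set B := 1 + κ ^ 2 / (2 * β) with hB
    have hB1 : 0 ≤ κ ^ 2 / (2 * β) := by positivity
    refine ⟨(2 * i + 1 + B) * C, by positivity, fun T hT X => ?_⟩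
    have hpt : mean β (Polynomial.X ^ (2 * (i + 1))) T X ≤
        mean β (Polynomial.X ^ (2 * i + 1) * phase β T X +
          Polynomial.C (B * (1 + X ^ 2)) * Polynomial.X ^ (2 * i)) T X := by
      refine mean_mono hβ (fun y => ?_) T X
      simp only [Polynomial.eval_add, Polynomial.eval_mul, Polynomial.eval_pow, Polynomial.eval_X,
        Polynomial.eval_C, eval_phase]
      have hT' : T ≤ |R| := hT.2.trans (le_abs_self R)
      have h1 : y ^ 2 ≤ y * (X / 2 - T / 2 * y + β / 2 * y ^ 3) + B * (1 + X ^ 2) := by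
        have h2 : 0 ≤ β / 2 * (y ^ 2 - κ / β) ^ 2 := by positivity
        have h3 : β / 2 * (y ^ 2 - κ / β) ^ 2 = β / 2 * y ^ 4 - κ * y ^ 2 + κ ^ 2 / (2 * β) := by
          field_simp
          ring
        have h4 : 0 ≤ κ ^ 2 / (2 * β) * X ^ 2 := by positivity
        have h5 := mul_nonneg (sub_nonneg.2 hT') (sq_nonneg y)
        nlinarith [sq_nonneg (X + y)]
      have h2 : 0 ≤ y ^ (2 * i) := by
        rw [pow_mul]
        positivity
      have h3 := mul_le_mul_of_nonneg_right h1 h2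
      calc y ^ (2 * (i + 1)) = y ^ 2 * y ^ (2 * i) := by ring
        _ ≤ _ := h3
        _ = _ := by ring
    rw [mean_add hβ, ← mean_derivative hβ, mean_C_mul, Polynomial.derivative_X_pow, mean_C_mul,
      Nat.add_sub_cancel] at hpt
    have h1 := hC T hT X
    have h2 : (1 : ℝ) ≤ 1 + X ^ 2 := by nlinarith [sq_nonneg X]
    have h3 : 0 ≤ mean β (Polynomial.X ^ (2 * i)) T X := mean_nonneg hβ (fun y => by
      rw [Polynomial.eval_pow, pow_mul]
      positivity) T X
    calc _ ≤ _ := hpt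
      _ ≤ (2 * i + 1 + B) * (1 + X ^ 2) * mean β (Polynomial.X ^ (2 * i)) T X := by
        push_cast
        have : 0 ≤ (2 * (i : ℝ) + 1) * X ^ 2 * mean β (Polynomial.X ^ (2 * i)) T X := by positivity
        nlinarith
      _ ≤ (2 * i + 1 + B) * (1 + X ^ 2) * (C * (1 + X ^ 2) ^ i) :=
        mul_le_mul_of_nonneg_left h1 (by positivity)
      _ = _ := by ring

theorem hasPolynomialGrowth_mean (hβ : 0 < β) (p : Polynomial ℝ) :
    HasPolynomialGrowth (mean β p) := by
  induction p using Polynomial.induction_on' with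
  | add p q hp hq =>
    have : mean β (p + q) = fun T X => mean β p T X + mean β q T X :=
      funext fun T => funext fun X => mean_add hβ p q T X
    rw [this]
    exact hp.add hq
  | monomial n a =>
    have : mean β (Polynomial.monomial n a) = fun T X => a * mean β (Polynomial.X ^ n) T X :=
      funext fun T => funext fun X => by
        rw [← Polynomial.C_mul_X_pow_eq_monomial, mean_C_mul]
    rw [this]
    refine (HasPolynomialGrowth.const a).mul fun R => ?_
    obtain ⟨C, hC0, hC⟩ := exists_mean_even_le hβ R n
    refine ⟨1 + C, 2 * n, fun T hT X => ?_⟩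
    have h1 : ∀ s : ℝ, s ^ 2 = 1 → s * mean β (Polynomial.X ^ n) T X ≤
        1 + mean β (Polynomial.X ^ (2 * n)) T X := by
      intro s hs
      rw [← mean_C_mul, ← mean_one hβ T X, ← mean_add hβ]
      refine mean_mono hβ (fun y => ?_) T X
      simp only [Polynomial.eval_add, Polynomial.eval_mul, Polynomial.eval_pow, Polynomial.eval_X,
        Polynomial.eval_C, Polynomial.eval_one]
      rw [mul_comm 2 n, pow_mul]
      nlinarith [sq_nonneg (s - y ^ n), sq_nonneg (y ^ n)]
    have h2 : 1 + mean β (Polynomial.X ^ (2 * n)) T X ≤ (1 + C) * (1 + |X|) ^ (2 * n) := by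
      have h3 := hC T hT X
      have h4 : (1 + X ^ 2) ^ n ≤ (1 + |X|) ^ (2 * n) := by
        rw [pow_mul]
        refine pow_le_pow_left₀ (by positivity) ?_ n
        nlinarith [abs_nonneg X, sq_abs X]
      have h5 : (1 : ℝ) ≤ (1 + |X|) ^ (2 * n) := one_le_pow₀ (by linarith [abs_nonneg X])
      nlinarith [mul_le_mul_of_nonneg_left h4 hC0]
    rw [abs_le]
    constructor
    · have := h1 (-1) (by norm_num)
      linarith
    · have := h1 1 (by norm_num)
      linarith

theorem hasPolynomialGrowth_innerSol (hβ : 0 < β) {P : ℕ → Polynomial ℝ} (hP : P 0 = 1) (ℓ : ℕ) :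
    HasPolynomialGrowth (innerSol β P ℓ) := by
  induction ℓ using Nat.strong_induction_on with
  | _ ℓ ih =>
    have : innerSol β P ℓ = fun T X => mean β (Polynomial.X * P ℓ) T X -
        ∑ j ∈ Finset.range ℓ, innerSol β P j T X * mean β (P (ℓ - j)) T X :=
      funext fun T => funext fun X => innerSol_eq_mean hβ hP ℓ T X
    rw [this]
    exact (hasPolynomialGrowth_mean hβ _).sub (HasPolynomialGrowth.sum fun j hj =>
      (ih j (Finset.mem_range.1 hj)).mul (hasPolynomialGrowth_mean hβ _))

end MeanGrowth

/-! ### The slope of U_0 as a variance, and its bounds. -/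

section Variance

variable {β : ℝ} {P : ℕ → Polynomial ℝ}

/-- The variance of the normalized weight. -/
noncomputable def variance (β T X : ℝ) : ℝ := mean β (shift (mean β Polynomial.X T X) ^ 2) T X

theorem variance_nonneg (hβ : 0 < β) (T X : ℝ) : 0 ≤ variance β T X :=
  mean_nonneg hβ (fun y => by rw [Polynomial.eval_pow]; positivity) T X

theorem variance_eq (hβ : 0 < β) (T X : ℝ) : variance β T X =
    mean β (Polynomial.X * Polynomial.X) T X - mean β Polynomial.X T X * mean β Polynomial.X T X := by
  set a := mean β Polynomial.X T X with ha
  have : shift a ^ 2 = Polynomial.X * Polynomial.X - Polynomial.C (2 * a) * Polynomial.X +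
      Polynomial.C (a ^ 2) * 1 := by
    rw [shift, Polynomial.C_mul, Polynomial.C_pow, show Polynomial.C (2 : ℝ) = 2 from map_ofNat _ 2]
    ring
  rw [variance, ← ha, this, mean_add hβ, mean_sub hβ, mean_C_mul, mean_C_mul, mean_one hβ, ← ha]
  ring

theorem innerSol_zero (hβ : 0 < β) (hP : P 0 = 1) (T X : ℝ) :
    innerSol β P 0 T X = mean β Polynomial.X T X := by
  rw [innerSol_eq_mean hβ hP, hP]
  simp

theorem deriv_innerSol_zero (hβ : 0 < β) (hP : P 0 = 1) (T X : ℝ) :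
    deriv (innerSol β P 0 T) X = -(1 / 2) * variance β T X := by
  have : innerSol β P 0 T = mean β Polynomial.X T := funext fun X => innerSol_zero hβ hP T X
  rw [this, (hasDerivAt_mean hβ Polynomial.X T X).deriv, variance_eq hβ]

/-- Integration by parts against y - a with a the mean of y. The phase is expanded about a, and its
constant term drops out because y - a has mean 0. -/
theorem mean_sq_mul_eq_one (hβ : 0 < β) (T X : ℝ) :
    mean β (shift (mean β Polynomial.X T X) ^ 2 * (Polynomial.C (-T / 2) + Polynomial.C (β / 2) *
      (Polynomial.C (3 * mean β Polynomial.X T X ^ 2) + Polynomial.C (3 * mean β Polynomial.X T X) *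
        shift (mean β Polynomial.X T X) + shift (mean β Polynomial.X T X) ^ 2))) T X = 1 := by
  set a := mean β Polynomial.X T X with ha
  set q := shift a ^ 2 * (Polynomial.C (-T / 2) + Polynomial.C (β / 2) *
      (Polynomial.C (3 * a ^ 2) + Polynomial.C (3 * a) * shift a + shift a ^ 2)) with hq
  have h0 : mean β (shift a) T X = 0 := by
    rw [shift, mean_sub hβ, ← mul_one (Polynomial.C a), mean_C_mul, mean_one hβ, ← ha]
    ring
  have h1 : shift a * phase β T X = Polynomial.C (X / 2 - T / 2 * a + β / 2 * a ^ 3) * shift a + q := by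
    refine Polynomial.funext fun y => ?_
    simp only [hq, Polynomial.eval_mul, Polynomial.eval_add, Polynomial.eval_C, Polynomial.eval_pow,
      eval_shift, eval_phase]
    ring
  have h2 := mean_derivative hβ (shift a) T X
  have h3 : derivative (shift a) = 1 := by simp [shift]
  rw [h3, mean_one hβ, h1, mean_add hβ, mean_C_mul, h0, mul_zero, zero_add] at h2
  exact h2.symm

/-- The quadratic form 3a² + 3aw + w² with w = y - a is nonnegative. For T < 0 this gives -∂_X U_0 ≤
1/|T|, the bound behind uniqueness in the past. -/
theorem neg_time_mul_variance_le (hβ : 0 < β) (T X : ℝ) : -T * (1 / 2 * variance β T X) ≤ 1 := by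
  refine le_trans ?_ (mean_sq_mul_eq_one hβ T X).le
  rw [variance, ← mul_assoc, ← mean_C_mul]
  refine mean_mono hβ (fun y => ?_) T X
  simp only [Polynomial.eval_mul, Polynomial.eval_add, Polynomial.eval_C, Polynomial.eval_pow,
    eval_shift]
  set a := mean β Polynomial.X T X
  have : 0 ≤ (y - a) ^ 2 * (β / 2 * (3 * a ^ 2 + 3 * a * (y - a) + (y - a) ^ 2)) := by
    have : 0 ≤ 3 * a ^ 2 + 3 * a * (y - a) + (y - a) ^ 2 := by
      nlinarith [sq_nonneg (a + (y - a) / 2), sq_nonneg (y - a)]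
    positivity
  nlinarith

/-- For nonnegative T the quartic part takes over: it dominates κ(y - a)² up to a constant, so the
slope of U_0 stays bounded below. -/
theorem exists_variance_le (hβ : 0 < β) (R : ℝ) :
    ∃ C : ℝ, 0 ≤ C ∧ ∀ T ≤ R, ∀ X, variance β T X ≤ C := by
  set κ := |R| / 2 + 1 with hκ
  refine ⟨1 + 2 * κ ^ 2 / β, by positivity, fun T hT X => ?_⟩
  have h1 : mean β (shift (mean β Polynomial.X T X) ^ 2 - Polynomial.C (2 * κ ^ 2 / β) * 1) T X ≤ 1 := by
    rw [← mean_sq_mul_eq_one hβ T X]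
    refine mean_mono hβ (fun y => ?_) T X
    simp only [Polynomial.eval_mul, Polynomial.eval_add, Polynomial.eval_C, Polynomial.eval_pow,
      eval_shift, Polynomial.eval_sub, Polynomial.eval_one]
    set a := mean β Polynomial.X T X
    set w := y - a
    have h2 : w ^ 2 / 4 ≤ 3 * a ^ 2 + 3 * a * w + w ^ 2 := by nlinarith [sq_nonneg (a + w / 2)]
    have h3 : w ^ 2 * (β / 2 * (w ^ 2 / 4)) ≤ w ^ 2 * (β / 2 * (3 * a ^ 2 + 3 * a * w + w ^ 2)) :=
      mul_le_mul_of_nonneg_left (mul_le_mul_of_nonneg_left h2 (by positivity)) (sq_nonneg w)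
    have h4 : 0 ≤ β / 8 * (w ^ 2 - 4 * κ / β) ^ 2 := by positivity
    have h5 : β / 8 * (w ^ 2 - 4 * κ / β) ^ 2 = w ^ 2 * (β / 2 * (w ^ 2 / 4)) - κ * w ^ 2 +
        2 * κ ^ 2 / β := by
      field_simp
      ring
    have h6 : T ≤ |R| := hT.trans (le_abs_self R)
    have h7 := mul_nonneg (sub_nonneg.2 h6) (sq_nonneg w)
    nlinarith
  rw [mean_sub hβ, mean_C_mul, mean_one hβ] at h1
  change variance β T X - _ ≤ 1 at h1
  linarith

/-- The square of the mean of y is at most the mean of y², which is O(1 + X²). -/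
theorem exists_abs_innerSol_zero_le (hβ : 0 < β) (hP : P 0 = 1) (R : ℝ) :
    ∃ C : ℝ, 0 ≤ C ∧ ∀ T ∈ Icc (-R) R, ∀ X, |innerSol β P 0 T X| ≤ C * (1 + |X|) := by
  obtain ⟨C, hC0, hC⟩ := exists_mean_even_le hβ R 1
  refine ⟨C + 1, by positivity, fun T hT X => ?_⟩
  have h1 := variance_nonneg hβ T X
  rw [variance_eq hβ] at h1
  have h2 := hC T hT X
  rw [mul_one, pow_one, sq] at h2
  rw [innerSol_zero hβ hP]
  refine abs_le_of_sq_le_sq ?_ (by positivity)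
  have h3 : C * (1 + X ^ 2) ≤ ((C + 1) * (1 + |X|)) ^ 2 := by
    have h4 : 1 + X ^ 2 ≤ (1 + |X|) ^ 2 := by nlinarith [abs_nonneg X, sq_abs X]
    have h5 : C ≤ (C + 1) ^ 2 := by nlinarith
    rw [mul_pow]
    exact mul_le_mul h5 h4 (by positivity) (by positivity)
  nlinarith

end Variance

end ShockFormation

namespace ShockFormation

open Filter Topology Set MeasureTheory

/-! ### Uniqueness -/

section Difference

variable {J : Set ℝ} {U : ℕ → ℝ → ℝ → ℝ} {V : ℝ → ℝ → ℝ} {ℓ : ℕ}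

/-- The equation for the difference of two solutions of the `ℓ`-th equation. -/
theorem deriv_time_sub (hU : ∀ j, SmoothFor univ (U j)) (hUs : SolvesInnerEquation univ U ℓ)
    (hV : IsClassicalOn J V) (hVs : SolvesInnerEquation J (Function.update U ℓ V) ℓ)
    {T : ℝ} (hT : T ∈ J) (X : ℝ) :
    deriv (fun s => V s X - U ℓ s X) T =
      -(1 / 2) * (deriv (fun x => V T x - U ℓ T x) X * (U 0 T X + Function.update U ℓ V 0 T X) +
        (V T X - U ℓ T X) * (deriv (U 0 T) X + deriv (Function.update U ℓ V 0 T) X)) +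
      iteratedDeriv 2 (fun x => V T x - U ℓ T x) X := by
  set W := Function.update U ℓ V with hW
  have hWℓ : W ℓ = V := Function.update_self ..
  have hWne : ∀ j, j ≠ ℓ → W j = U j := fun j hj => Function.update_of_ne hj ..
  have dU : ∀ j x, HasDerivAt (U j T) (deriv (U j T) x) x := fun j x =>
    (hU j).hasDerivAt (mem_univ T) x
  have dV : ∀ x, HasDerivAt (V T) (deriv (V T) x) x := fun x => hV.hasDerivAt hT x
  have dW : ∀ j x, HasDerivAt (W j T) (deriv (W j T) x) x := fun j x => by
    by_cases hj : j = ℓ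
    · rw [hj, hWℓ]
      exact dV x
    · rw [hWne j hj]
      exact dU j x
  have e1 := hUs T (mem_univ T) X
  have e2 := hVs T hT X
  rw [hWℓ] at e2
  have et : deriv (fun s => V s X - U ℓ s X) T =
      deriv (fun s => V s X) T - deriv (fun s => U ℓ s X) T :=
    ((hV.1 T hT X).hasDerivAt.sub ((hU ℓ).hasDerivAt_time (mem_univ T) X)).deriv
  have edx : ∀ x, deriv (fun x => V T x - U ℓ T x) x = deriv (V T) x - deriv (U ℓ T) x := fun x =>
    ((dV x).sub (dU ℓ x)).deriv
  have exx : iteratedDeriv 2 (fun x => V T x - U ℓ T x) X =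
      iteratedDeriv 2 (V T) X - iteratedDeriv 2 (U ℓ T) X :=
    iteratedDeriv_sub (hV.2.1 T hT).contDiffAt
      (((hU ℓ).contDiff (mem_univ T)).of_le two_le_smooth).contDiffAt
  have hsum : ∀ (G : ℕ → ℝ → ℝ → ℝ), (∀ j x, HasDerivAt (G j T) (deriv (G j T) x) x) →
      HasDerivAt (fun x => ∑ p ∈ Finset.HasAntidiagonal.antidiagonal ℓ, G p.1 T x * G p.2 T x)
        (∑ p ∈ Finset.HasAntidiagonal.antidiagonal ℓ, deriv (fun x => G p.1 T x * G p.2 T x) X) X :=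
    fun G hG => HasDerivAt.fun_sum fun p _ =>
      ((hG p.1 X).mul (hG p.2 X)).differentiableAt.hasDerivAt
  have hdiff : (fun x => ∑ p ∈ Finset.HasAntidiagonal.antidiagonal ℓ, W p.1 T x * W p.2 T x -
      ∑ p ∈ Finset.HasAntidiagonal.antidiagonal ℓ, U p.1 T x * U p.2 T x) =
      fun x => (V T x - U ℓ T x) * (U 0 T x + W 0 T x) := by
    funext x
    have := sum_antidiagonal_sub (fun j => W j T x) (fun j => U j T x) (fun j => W j T x)
      (fun j => U j T x) ℓ (fun j hj => by rw [hWne j hj.ne]) (fun j hj => by rw [hWne j hj.ne])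
    rw [hWℓ] at this
    linear_combination this
  have h1 := (hsum W dW).sub (hsum U dU)
  have h2 := ((dV X).sub (dU ℓ X)).mul ((dU 0 X).add (dW 0 X))
  have h4 := h1.unique (h2.congr_of_eventuallyEq (.of_forall fun x => congrFun hdiff x))
  simp only [Pi.sub_apply, Pi.add_apply] at h4
  rw [et, e1, e2, exx, edx]
  linear_combination (-(1 / 2)) * h4

/-- At a critical point of the difference the nonlinear case ℓ = 0 looks like the linear one: V_X =
∂_X U_0 there, so the sum of the two slopes is 2 ∂_X U_0. -/
theorem deriv_time_sub_of_deriv_eq_zero (hU : ∀ j, SmoothFor univ (U j))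
    (hUs : SolvesInnerEquation univ U ℓ) (hV : IsClassicalOn J V)
    (hVs : SolvesInnerEquation J (Function.update U ℓ V) ℓ) {T : ℝ} (hT : T ∈ J) {X : ℝ}
    (h0 : deriv (fun x => V T x - U ℓ T x) X = 0) :
    deriv (fun s => V s X - U ℓ s X) T = -((V T X - U ℓ T X) * deriv (U 0 T) X) +
      iteratedDeriv 2 (fun x => V T x - U ℓ T x) X := by
  rw [deriv_time_sub hU hUs hV hVs hT X, h0]
  have : deriv (Function.update U ℓ V 0 T) X = deriv (U 0 T) X := by
    by_cases hℓ : (0 : ℕ) = ℓ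
    · subst hℓ
      rw [Function.update_self]
      have h1 := ((hV.hasDerivAt hT X).sub ((hU 0).hasDerivAt (mem_univ T) X)).deriv
      have h2 : deriv (V T - U 0 T) X = 0 := h0
      linarith
    · rw [Function.update_of_ne hℓ]
  rw [this]
  ring

theorem IsClassicalOn.sub {W : ℝ → ℝ → ℝ} (hV : IsClassicalOn J V) (hW : IsClassicalOn J W) :
    IsClassicalOn J (fun T X => V T X - W T X) := by
  have ht : ∀ T ∈ J, ∀ X, deriv (fun s => V s X - W s X) T =
      deriv (fun s => V s X) T - deriv (fun s => W s X) T := fun T hT X =>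
    ((hV.1 T hT X).hasDerivAt.sub (hW.1 T hT X).hasDerivAt).deriv
  have hx : ∀ T ∈ J, ∀ X, deriv (fun x => V T x - W T x) X =
      deriv (V T) X - deriv (W T) X := fun T hT X =>
    ((hV.hasDerivAt hT X).sub (hW.hasDerivAt hT X)).deriv
  have hxx : ∀ T ∈ J, ∀ X, iteratedDeriv 2 (fun x => V T x - W T x) X =
      iteratedDeriv 2 (V T) X - iteratedDeriv 2 (W T) X := fun T hT X =>
    iteratedDeriv_sub (hV.2.1 T hT).contDiffAt (hW.2.1 T hT).contDiffAt
  exact ⟨fun T hT X => (hV.1 T hT X).sub (hW.1 T hT X),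
    fun T hT => (hV.2.1 T hT).sub (hW.2.1 T hT), hV.2.2.1.sub hW.2.2.1,
    (hV.2.2.2.1.sub hW.2.2.2.1).congr fun z hz => ht z.1 hz.1 z.2,
    (hV.2.2.2.2.1.sub hW.2.2.2.2.1).congr fun z hz => hx z.1 hz.1 z.2,
    (hV.2.2.2.2.2.sub hW.2.2.2.2.2).congr fun z hz => hxx z.1 hz.1 z.2⟩

end Difference

/-! ### Uniqueness tools for T < 0. -/

section Past

variable {β : ℝ}

/-- From X = 𝔲(T - β𝔲²) one reads off |X| ≤ |𝔲| 𝔇². So 𝔇 tends to infinity with |X|, uniformly in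
time. -/
theorem abs_le_dist_cube (hβ : 0 < β) {T : ℝ} (hT : T < 0) (X : ℝ) :
    |X| ≤ √(3 * β)⁻¹ * dist β T X ^ 3 := by
  have hs := profile_spec hβ hT.le X
  set y := profile β T X with hy
  have h1 : |X| ≤ |y| * dist β T X ^ 2 := by
    rw [dist_sq_eq hβ, ← hy]
    have h2 : |X| ≤ |T| * |y| + β * |y| ^ 3 := by
      rw [← hs]
      refine (abs_sub _ _).trans ?_
      rw [abs_mul, abs_mul, abs_pow, abs_of_pos hβ]
    have h3 : |y| * (|T| + 3 * β * y ^ 2) = |T| * |y| + 3 * (β * |y| ^ 3) := by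
      rw [← sq_abs y]
      ring
    have : 0 ≤ β * |y| ^ 3 := by positivity
    linarith
  calc |X| ≤ |y| * dist β T X ^ 2 := h1
    _ ≤ √(3 * β)⁻¹ * dist β T X * dist β T X ^ 2 :=
      mul_le_mul_of_nonneg_right (abs_profile_le_dist hβ) (sq_nonneg _)
    _ = _ := by ring

/-- A maximum principle for decaying functions in the past. -/
theorem nonpos_of_decay (hβ : 0 < β) {Z : ℝ → ℝ → ℝ} {C : ℝ} (hZ : IsClassicalOn (Iio 0) Z)
    (hmax : ∀ T < 0, ∀ X, 0 < Z T X → deriv (Z T) X = 0 → iteratedDeriv 2 (Z T) X ≤ 0 →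
      -T * deriv (fun s => Z s X) T ≤ Z T X)
    (hb : ∀ T X, (T, X) ∈ rectangleCompl → |Z T X| ≤ C * dist β T X ^ (-3 : ℤ)) :
    ∀ T < 0, ∀ X, Z T X ≤ 0 := by
  intro T₀ hT₀ X₀
  by_contra! hpos
  -- The maximum principle is applied to -TZ - ε, whose supposed value at (T₀, X₀) is ε > 0.
  set ε := -T₀ * Z T₀ X₀ / 2 with hε
  have hε0 : 0 < ε := by
    have : 0 < -T₀ := by linarith
    positivity
  -- At the initial time a = -s² one has 𝔇 ≥ s, hence -aZ ≤ |C|/s ≤ ε.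
  set s := 1 + |C| / ε - T₀ with hs
  have hq : 0 ≤ |C| / ε := by positivity
  have hs1 : 1 ≤ s := by linarith
  set a := -s ^ 2 with ha
  have hsT : -T₀ ≤ s ^ 2 := by nlinarith
  have haT : a ≤ T₀ := by linarith
  have ha1 : a ≤ -1 := by nlinarith
  set κ := √(3 * β)⁻¹ with hκ
  have hκ0 : 0 ≤ κ := Real.sqrt_nonneg _
  -- On |X| = L ≥ 1 the point lies outside the rectangle and 𝔇³ ≥ L/κ, so that -TZ ≤ s²|C| 𝔇⁻³ ≤ ε.
  set L := |X₀| + 1 + s ^ 2 * |C| * κ / ε with hL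
  have hq2 : 0 ≤ s ^ 2 * |C| * κ / ε := by positivity
  have hL1 : 1 ≤ L := by linarith [abs_nonneg X₀]
  have hneg : ∀ T ∈ Icc a T₀, T < 0 := fun T hT => hT.2.trans_lt hT₀
  have hZC : ∀ T X, (T, X) ∈ rectangleCompl → Z T X ≤ |C| * (dist β T X ^ 3)⁻¹ := by
    intro T X hz
    have hd := dist_pos (X := X) hβ (time_neg_of_mem hz)
    refine (le_abs_self _).trans ((hb T X hz).trans ?_)
    exact mul_le_mul_of_nonneg_right (le_abs_self C) (by positivity)
  have hside : ∀ T ∈ Icc a T₀, ∀ X, |X| = L → -T * Z T X - ε ≤ 0 := by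
    intro T hT X hX
    have hTn := hneg T hT
    have hz : (T, X) ∈ rectangleCompl := ⟨hTn, fun h => by
      have := abs_lt.2 ⟨h.2.1, h.2.2⟩
      linarith⟩
    have hd := dist_pos (X := X) hβ hTn
    have h1 := hZC T X hz
    have h2 := abs_le_dist_cube hβ hTn X
    rw [hX] at h2
    have h3 : |C| * s ^ 2 * (dist β T X ^ 3)⁻¹ ≤ ε := by
      rw [← div_eq_mul_inv, div_le_iff₀ (by positivity)]
      have h4 : s ^ 2 * |C| * κ / ε ≤ κ * dist β T X ^ 3 := by linarith [abs_nonneg X₀]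
      rw [div_le_iff₀ hε0] at h4
      have hκpos : 0 < κ := Real.sqrt_pos.2 (by positivity)
      have h5 : κ * (|C| * s ^ 2) ≤ κ * (ε * dist β T X ^ 3) := by linarith
      exact le_of_mul_le_mul_left h5 hκpos
    have h6 : -T * Z T X ≤ s ^ 2 * (|C| * (dist β T X ^ 3)⁻¹) :=
      (mul_le_mul_of_nonneg_left h1 (by linarith)).trans
        (mul_le_mul_of_nonneg_right (by linarith [hT.1]) (by positivity))
    linarith
  have hdx : ∀ T X, HasDerivAt (Z T) (deriv (Z T) X) X →
      deriv (fun x => -T * Z T x - ε) X = -T * deriv (Z T) X := fun T X h =>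
    ((h.const_mul (-T)).sub_const ε).deriv
  have key := nonpos_of_weak_max (Z := fun T X => -T * Z T X - ε) (a := a) (b := T₀) (p := -L) (q := L)
    ?_ ?_ ?_ (fun T hT => hside T hT (-L) (by rw [abs_neg, abs_of_nonneg (by linarith)]))
    (fun T hT => hside T hT L (abs_of_nonneg (by linarith))) ?_ T₀ (right_mem_Icc.2 haT) X₀
    ⟨by linarith [neg_abs_le X₀], by linarith [le_abs_self X₀]⟩
  · have : -T₀ * Z T₀ X₀ = 2 * ε := by rw [hε]; ring
    linarith
  · exact (continuousOn_fst.neg.mul (hZ.2.2.1.mono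
      (prod_mono (fun T hT => hneg T hT) (subset_univ _)))).sub continuousOn_const
  · intro T hT X _
    have := hZ.1 T (hneg T (Ioc_subset_Icc_self hT)) X
    fun_prop
  · intro X _
    have han : a < 0 := by linarith
    have hz : (a, X) ∈ rectangleCompl := ⟨han, fun h => by
      have : -1 < a := h.1.1
      linarith⟩
    have h1 := hZC a X hz
    have hd : s ≤ dist β a X := by
      have := sqrt_le_dist (X := X) (T := a) hβ
      rwa [ha, abs_neg, abs_pow, sq_abs, Real.sqrt_sq (by linarith)] at this
    have h2 : (dist β a X ^ 3)⁻¹ ≤ (s ^ 3)⁻¹ :=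
      inv_anti₀ (by positivity) (pow_le_pow_left₀ (by linarith) hd 3)
    have h3 : -a * Z a X ≤ s ^ 2 * (|C| * (s ^ 3)⁻¹) := by
      rw [ha, neg_neg]
      exact mul_le_mul_of_nonneg_left (h1.trans (mul_le_mul_of_nonneg_left h2 (abs_nonneg C)))
        (sq_nonneg s)
    have h4 : s ^ 2 * (|C| * (s ^ 3)⁻¹) ≤ ε := by
      have hs0 : 0 < s := by linarith
      rw [show s ^ 2 * (|C| * (s ^ 3)⁻¹) = |C| / s by field_simp, div_le_iff₀ hs0]
      have : |C| / ε ≤ s := by linarith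
      rw [div_le_iff₀ hε0] at this
      linarith
    linarith
  · intro T hT X _ h0 h1 h2
    have hTn := hneg T (Ioc_subset_Icc_self hT)
    have hTp : 0 < -T := by linarith
    have hd := hZ.hasDerivAt hTn
    have hdd := hZ.hasDerivAt_deriv hTn X
    have e1 : deriv (fun x => -T * Z T x - ε) = fun x => -T * deriv (Z T) x :=
      funext fun x => hdx T x (hd x)
    have hz0 : 0 < Z T X := by
      have : 0 < -T * Z T X := by linarith
      exact pos_of_mul_pos_right this hTp.le
    have hz1 : deriv (Z T) X = 0 := by
      rw [e1] at h1
      exact (mul_eq_zero.1 h1).resolve_left hTp.ne'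
    have hz2 : iteratedDeriv 2 (Z T) X ≤ 0 := by
      simp only [iteratedDeriv_succ (n := 1), iteratedDeriv_one] at h2 hdd ⊢
      rw [e1, (hdd.const_mul (-T)).deriv] at h2
      exact nonpos_of_mul_nonpos_right h2 hTp
    have h3 := hmax T hTn X hz0 hz1 hz2
    -- The time derivative of -TZ is -Z - T ∂_T Z, and `hmax` says that this is nonpositive.
    have h4 : HasDerivAt (fun s => -s * Z s X - ε) (-1 * Z T X + -T * deriv (fun s => Z s X) T) T :=
      ((hasDerivAt_id T).neg.mul (hZ.1 T hTn X).hasDerivAt).sub_const ε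
    rw [h4.deriv]
    linarith

end Past

/-! ### Uniqueness tool for T ≥ 0 in the linear equations. -/

section Future

/-- A maximum principle for functions of polynomial growth, for an equation with a drift of linear
growth. -/
theorem nonpos_of_growth {Z b c : ℝ → ℝ → ℝ} {R K C : ℝ} {N : ℕ} (hK : 0 ≤ K)
    (hZ : IsClassicalOn univ Z) (h0 : ∀ X, Z 0 X ≤ 0)
    (heq : ∀ T ∈ Icc 0 R, ∀ X, deriv (fun s => Z s X) T =
      iteratedDeriv 2 (Z T) X - b T X * deriv (Z T) X + c T X * Z T X)
    (hb : ∀ T ∈ Icc 0 R, ∀ X, |b T X| ≤ K * (1 + |X|)) (hc : ∀ T ∈ Icc 0 R, ∀ X, c T X ≤ K)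
    (hC : ∀ T ∈ Icc 0 R, ∀ X, |Z T X| ≤ C * (1 + |X|) ^ N) :
    ∀ T ∈ Icc 0 R, ∀ X, Z T X ≤ 0 := by
  intro T₀ hT₀ X₀
  -- The barrier outgrows the solution. Both W'' and the drift term, with its coefficient of linear
  -- growth, are bounded by multiples of W.
  set W : ℝ → ℝ := fun X => (1 + X ^ 2) ^ (N + 1) with hW
  set W₁ : ℝ → ℝ := fun X => 2 * (N + 1) * (X * (1 + X ^ 2) ^ N) with hW₁
  set W₂ : ℝ → ℝ := fun X => 2 * (N + 1) * ((1 + X ^ 2) ^ N +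
    X * (N * (1 + X ^ 2) ^ (N - 1) * (2 * X))) with hW₂
  have hbase : ∀ X : ℝ, HasDerivAt (fun x : ℝ => 1 + x ^ 2) (2 * X) X := fun X => by
    simpa using (hasDerivAt_pow 2 X).const_add 1
  have dW : ∀ X, HasDerivAt W (W₁ X) X := fun X => by
    refine ((hbase X).pow (N + 1)).congr_deriv ?_
    simp only [hW₁, Nat.add_sub_cancel]
    push_cast
    ring
  have dW₁ : ∀ X, HasDerivAt W₁ (W₂ X) X := fun X => by
    refine (((hasDerivAt_id X).mul ((hbase X).pow N)).const_mul (2 * ((N : ℝ) + 1))).congr_deriv ?_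
    simp [hW₂]
  have hWpos : ∀ X, 0 < W X := fun X => by positivity
  have hp : ∀ X : ℝ, 0 < (1 + X ^ 2) ^ N := fun X => by positivity
  set M : ℝ := 2 * (N + 1) * (1 + 2 * N) with hM
  set M' : ℝ := 4 * (N + 1) * K with hM'
  have bW₂ : ∀ X, W₂ X ≤ M * W X := by
    intro X
    have h1 : X * (N * (1 + X ^ 2) ^ (N - 1) * (2 * X)) ≤ 2 * N * (1 + X ^ 2) ^ N := by
      cases N with
      | zero => simp
      | succ n =>
        rw [Nat.add_sub_cancel, pow_succ (1 + X ^ 2) n]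
        have : 0 < (1 + X ^ 2) ^ n := by positivity
        have : 0 ≤ ((n + 1 : ℕ) : ℝ) * (1 + X ^ 2) ^ n := by positivity
        nlinarith
    have h2 : (1 + X ^ 2) ^ N ≤ W X := by
      simp only [hW]
      exact pow_le_pow_right₀ (by nlinarith [sq_nonneg X]) (Nat.le_succ N)
    calc W₂ X ≤ 2 * (N + 1) * ((1 + X ^ 2) ^ N + 2 * N * (1 + X ^ 2) ^ N) :=
          mul_le_mul_of_nonneg_left (by linarith) (by positivity)
      _ = M * (1 + X ^ 2) ^ N := by rw [hM]; ring
      _ ≤ _ := mul_le_mul_of_nonneg_left h2 (by positivity)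
  have bW₁ : ∀ T ∈ Icc 0 R, ∀ X, -(b T X * W₁ X) ≤ M' * W X := by
    intro T hT X
    have h1 : |W₁ X| = 2 * (N + 1) * (|X| * (1 + X ^ 2) ^ N) := by
      simp only [hW₁]
      rw [abs_mul, abs_mul X, abs_of_pos (hp X),
        abs_of_nonneg (by positivity : (0 : ℝ) ≤ 2 * (N + 1))]
    have h2 : (1 + |X|) * |X| ≤ 2 * (1 + X ^ 2) := by nlinarith [sq_nonneg (|X| - 1), sq_abs X]
    calc -(b T X * W₁ X) ≤ |b T X| * |W₁ X| := by
          rw [← abs_mul]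
          exact neg_le_abs _
      _ ≤ K * (1 + |X|) * (2 * (N + 1) * (|X| * (1 + X ^ 2) ^ N)) := by
          rw [h1]
          exact mul_le_mul_of_nonneg_right (hb T hT X) (by positivity)
      _ = 2 * (N + 1) * K * (1 + X ^ 2) ^ N * ((1 + |X|) * |X|) := by ring
      _ ≤ 2 * (N + 1) * K * (1 + X ^ 2) ^ N * (2 * (1 + X ^ 2)) :=
          mul_le_mul_of_nonneg_left h2 (by positivity)
      _ = M' * W X := by
          simp only [hM', hW]
          ring
  set γ := M + M' with hγ
  have hγ0 : 0 ≤ γ := by positivity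
  -- The factor exp(-KT) absorbs the zeroth-order term, and exp(γT) W is a supersolution of the
  -- remaining equation.
  have key : ∀ ε > 0, Real.exp (-K * T₀) * Z T₀ X₀ - ε * (Real.exp (γ * T₀) * W X₀) ≤ 0 := by
    intro ε hε
    set L := |X₀| + 1 + |C| * 2 ^ N / ε with hL
    have hq : 0 ≤ |C| * 2 ^ N / ε := by positivity
    have hL1 : 1 ≤ L := by linarith [abs_nonneg X₀]
    have hside : ∀ T ∈ Icc 0 R, ∀ X, |X| = L →
        Real.exp (-K * T) * Z T X - ε * (Real.exp (γ * T) * W X) ≤ 0 := by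
      intro T hT X hX
      have e1 : Real.exp (-K * T) ≤ 1 := Real.exp_le_one_iff.2 (by nlinarith [hT.1])
      have e2 : 1 ≤ Real.exp (γ * T) := Real.one_le_exp (mul_nonneg hγ0 hT.1)
      have hX2 : X ^ 2 = L ^ 2 := by rw [← sq_abs, hX]
      have h1 : |Z T X| ≤ |C| * (2 ^ N * (1 + L ^ 2) ^ N) := by
        refine (hC T hT X).trans ((mul_le_mul_of_nonneg_right (le_abs_self C)
          (by positivity)).trans (mul_le_mul_of_nonneg_left ?_ (abs_nonneg C)))
        rw [hX, ← mul_pow]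
        exact pow_le_pow_left₀ (by linarith) (by nlinarith) N
      have h2 : |C| * 2 ^ N ≤ ε * (1 + L ^ 2) := by
        have h3 : |C| * 2 ^ N / ε ≤ 1 + L ^ 2 := by nlinarith [abs_nonneg X₀]
        rw [div_le_iff₀ hε] at h3
        linarith
      have h3 : |C| * (2 ^ N * (1 + L ^ 2) ^ N) ≤ ε * W X := by
        have h4 := mul_le_mul_of_nonneg_right h2 (by positivity : 0 ≤ (1 + L ^ 2) ^ N)
        simp only [hW]
        rw [hX2, pow_succ (1 + L ^ 2) N]
        linarith
      have h4 : Real.exp (-K * T) * Z T X ≤ |Z T X| := by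
        have h5 : Real.exp (-K * T) * Z T X ≤ Real.exp (-K * T) * |Z T X| :=
          mul_le_mul_of_nonneg_left (le_abs_self _) (Real.exp_pos _).le
        have h6 : Real.exp (-K * T) * |Z T X| ≤ 1 * |Z T X| :=
          mul_le_mul_of_nonneg_right e1 (abs_nonneg _)
        linarith
      have h5 : W X ≤ Real.exp (γ * T) * W X := le_mul_of_one_le_left (hWpos X).le e2
      have h6 := mul_le_mul_of_nonneg_left h5 hε.le
      linarith
    have hmem : Icc 0 T₀ ⊆ Icc 0 R := Icc_subset_Icc le_rfl hT₀.2
    have hdZ : ∀ T X, HasDerivAt (Z T) (deriv (Z T) X) X := fun T X => hZ.hasDerivAt (mem_univ T) X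
    have hdx : ∀ T, deriv (fun x => Real.exp (-K * T) * Z T x - ε * (Real.exp (γ * T) * W x)) =
        fun x => Real.exp (-K * T) * deriv (Z T) x - ε * (Real.exp (γ * T) * W₁ x) := fun T =>
      funext fun x => (((hdZ T x).const_mul _).sub (((dW x).const_mul _).const_mul ε)).deriv
    refine nonpos_of_weak_max
      (Z := fun T X => Real.exp (-K * T) * Z T X - ε * (Real.exp (γ * T) * W X))
      (a := 0) (b := T₀) (p := -L) (q := L) ?_ ?_ ?_
      (fun T hT => hside T (hmem hT) (-L) (by rw [abs_neg, abs_of_nonneg (by linarith)]))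
      (fun T hT => hside T (hmem hT) L (abs_of_nonneg (by linarith))) ?_ T₀
      (right_mem_Icc.2 hT₀.1) X₀ ⟨by linarith [neg_abs_le X₀], by linarith [le_abs_self X₀]⟩
    · have h1 := hZ.2.2.1.mono (prod_mono (subset_univ (Icc 0 T₀)) (subset_univ (Icc (-L) L)))
      refine ContinuousOn.sub (ContinuousOn.mul (by fun_prop) h1) ?_
      simp only [hW]
      fun_prop
    · intro T _ X _
      have := hZ.1 T (mem_univ T) X
      fun_prop
    · intro X _
      have := hWpos X
      simp only [mul_zero, Real.exp_zero, one_mul]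
      have := mul_pos hε this
      linarith [h0 X]
    · intro T hT X _ hpos h1 h2
      have hT' := hmem (Ioc_subset_Icc_self hT)
      have hE : 0 < Real.exp (-K * T) := Real.exp_pos _
      have hE2 : 0 < Real.exp (γ * T) := Real.exp_pos _
      rw [hdx] at h1
      have h2' : Real.exp (-K * T) * iteratedDeriv 2 (Z T) X -
          ε * (Real.exp (γ * T) * W₂ X) ≤ 0 := by
        have hdd := hZ.hasDerivAt_deriv (mem_univ T) X
        simp only [iteratedDeriv_succ (n := 1), iteratedDeriv_one] at h2 hdd ⊢
        rw [hdx] at h2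
        exact (((hdd.const_mul (Real.exp (-K * T))).sub
          (((dW₁ X).const_mul (Real.exp (γ * T))).const_mul ε)).deriv).symm.trans_le h2
      have hE1d : HasDerivAt (fun s => Real.exp (-K * s)) (Real.exp (-K * T) * -K) T := by
        simpa using ((hasDerivAt_id T).const_mul (-K)).exp
      have hE2d : HasDerivAt (fun s => Real.exp (γ * s)) (Real.exp (γ * T) * γ) T := by
        simpa using ((hasDerivAt_id T).const_mul γ).exp
      have h3 := ((hE1d.mul (hZ.1 T (mem_univ T) X).hasDerivAt).sub
        ((hE2d.mul_const (W X)).const_mul ε)).deriv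
      refine h3.trans_le ?_
      have hz : 0 ≤ Real.exp (-K * T) * Z T X := by
        have : 0 < ε * (Real.exp (γ * T) * W X) := by
          have := hWpos X
          positivity
        linarith
      have h4 := mul_nonneg (sub_nonneg.2 (hc T hT' X)) hz
      have h5 : ε * Real.exp (γ * T) * (W₂ X + -(b T X * W₁ X)) ≤
          ε * Real.exp (γ * T) * (M * W X + M' * W X) :=
        mul_le_mul_of_nonneg_left (add_le_add (bW₂ X) (bW₁ T hT' X)) (by positivity)
      have h6 : b T X * (Real.exp (-K * T) * deriv (Z T) X) =
          b T X * (ε * (Real.exp (γ * T) * W₁ X)) := by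
        rw [sub_eq_zero.1 h1]
      rw [heq T hT' X]
      have h7 : ε * Real.exp (γ * T) * (M * W X + M' * W X) =
          ε * (Real.exp (γ * T) * γ * W X) := by
        rw [hγ]
        ring
      linarith
  by_contra! hpos
  set B := Real.exp (γ * T₀) * W X₀ with hB
  have hB0 : 0 < B := mul_pos (Real.exp_pos _) (hWpos X₀)
  set z := Real.exp (-K * T₀) * Z T₀ X₀ with hz
  have hz0 : 0 < z := mul_pos (Real.exp_pos _) hpos
  have := key (z / (2 * B)) (by positivity)
  rw [div_mul_eq_mul_div, mul_div_mul_right _ _ hB0.ne'] at this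
  linarith

end Future

/-! ### Uniqueness of the inner solutions. -/

section InnerExpansion

variable {f : ℝ → ℝ} {U : ℕ → ℝ → ℝ → ℝ} {V : ℝ → ℝ → ℝ} {ℓ : ℕ}

theorem SolvesInnerEquation.mono {J J' : Set ℝ} (h : SolvesInnerEquation J U ℓ) (hJ : J' ⊆ J) :
    SolvesInnerEquation J' U ℓ := fun T hT => h T (hJ hT)

theorem IsClassicalOn.mono {J J' : Set ℝ} (h : IsClassicalOn J V) (hJ : J' ⊆ J) :
    IsClassicalOn J' V :=
  have hp : J' ×ˢ (univ : Set ℝ) ⊆ J ×ˢ univ := prod_mono hJ Subset.rfl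
  ⟨fun T hT => h.1 T (hJ hT), fun T hT => h.2.1 T (hJ hT), h.2.2.1.mono hp, h.2.2.2.1.mono hp,
    h.2.2.2.2.1.mono hp, h.2.2.2.2.2.mono hp⟩

/-- Two functions with the same far field are close to each other there. -/
theorem FarFieldBound.exists_abs_sub_le (hf : IsShockDatum f) {k : ℕ} (hk : (ℓ : ℝ) / 4 ≤ k)
    {W : ℝ → ℝ → ℝ} (hV : FarFieldBound f V ℓ 0 k) (hW : FarFieldBound f W ℓ 0 k) :
    ∃ C : ℝ, ∀ T X, (T, X) ∈ rectangleCompl →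
      |V T X - W T X| ≤ C * dist (beta₃ f) T X ^ (-3 : ℤ) := by
  have hβ := beta₃_pos hf
  have hk' : ℓ ≤ 4 * k := by
    rw [div_le_iff₀ (by norm_num)] at hk
    have : (ℓ : ℝ) ≤ ((4 * k : ℕ) : ℝ) := by
      push_cast
      linarith
    exact_mod_cast this
  obtain ⟨C, hC⟩ := hV
  obtain ⟨D, hD⟩ := hW
  obtain ⟨c, hc, hcd⟩ := exists_le_dist hβ
  refine ⟨(|C| + |D|) * (c ^ (4 * k - ℓ))⁻¹, fun T X hz => ?_⟩
  have h1 := hC T X hz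
  have h2 := hD T X hz
  simp only [iteratedDeriv_zero, innerDist] at h1 h2
  have hd := dist_pos (X := X) hβ (time_neg_of_mem hz)
  set p := dist (beta₃ f) T X ^ (-(3 * ((0 : ℕ) : ℤ) + 4 * (k : ℤ) - (ℓ : ℤ) + 3)) with hp
  have hp0 : 0 < p := by positivity
  -- The surplus exponent 4k - ℓ ≥ 0 is absorbed by the lower bound for 𝔇.
  have hpe : p ≤ (c ^ (4 * k - ℓ))⁻¹ * dist (beta₃ f) T X ^ (-3 : ℤ) := by
    have e : p = (dist (beta₃ f) T X ^ (4 * k - ℓ))⁻¹ * dist (beta₃ f) T X ^ (-3 : ℤ) := by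
      rw [hp, ← zpow_natCast, ← zpow_neg, ← zpow_add₀ hd.ne']
      congr 1
      push_cast [Nat.cast_sub hk']
      ring
    rw [e]
    exact mul_le_mul_of_nonneg_right (inv_anti₀ (by positivity)
      (pow_le_pow_left₀ hc.le (hcd T X hz) _)) (by positivity)
  have h3 : |V T X - W T X| ≤ (|C| + |D|) * p := by
    have h4 : V T X - W T X = (V T X - innerPartialSum f k ℓ T X) -
        (W T X - innerPartialSum f k ℓ T X) := by ring
    rw [h4, add_mul]
    exact (abs_sub _ _).trans (add_le_add
      (h1.trans (mul_le_mul_of_nonneg_right (le_abs_self C) hp0.le))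
      (h2.trans (mul_le_mul_of_nonneg_right (le_abs_self D) hp0.le)))
  refine h3.trans ?_
  rw [mul_assoc]
  exact mul_le_mul_of_nonneg_left hpe (by positivity)

/-- The family of solutions of the inner hierarchy that match the outer expansion with the
coefficients `C`. -/
noncomputable def innerFamily (f : ℝ → ℝ) (C : ℕ → ℕ → ℝ) : ℕ → ℝ → ℝ → ℝ :=
  innerSol (beta₃ f) (tiltFamily C)

theorem smoothFor_innerFamily (hf : IsShockDatum f) (C : ℕ → ℕ → ℝ) (j : ℕ) :
    SmoothFor univ (innerFamily f C j) := smoothFor_innerSol (beta₃_pos hf) (tiltFamily_zero C) j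

theorem solvesInnerEquation_innerFamily (hf : IsShockDatum f) (C : ℕ → ℕ → ℝ) (j : ℕ) :
    SolvesInnerEquation univ (innerFamily f C) j :=
  solvesInnerEquation_innerSol (beta₃_pos hf) (tiltFamily_zero C) j

theorem deriv_sub_swap (g h : ℝ → ℝ) (x : ℝ) :
    deriv (fun x => g x - h x) x = -deriv (fun x => h x - g x) x := by
  rw [← deriv.fun_neg]
  simp only [neg_sub]

theorem iteratedDeriv_sub_swap (n : ℕ) (g h : ℝ → ℝ) (x : ℝ) :
    iteratedDeriv n (fun x => g x - h x) x = -iteratedDeriv n (fun x => h x - g x) x := by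
  rw [← iteratedDeriv_fun_neg]
  simp only [neg_sub]

/-- Uniqueness in the past. -/
theorem eq_innerFamily_past (hf : IsShockDatum f) (C : ℕ → ℕ → ℝ) {k : ℕ} (hk : (ℓ : ℝ) / 4 ≤ k)
    (hfar : FarFieldBound f (innerFamily f C ℓ) ℓ 0 k) (hV : IsClassicalOn (Iio 0) V)
    (hVs : SolvesInnerEquation (Iio 0) (Function.update (innerFamily f C) ℓ V) ℓ)
    (hVf : FarFieldBound f V ℓ 0 k) : ∀ T < 0, ∀ X, V T X = innerFamily f C ℓ T X := by
  have hβ := beta₃_pos hf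
  have hU := smoothFor_innerFamily hf C
  have hUℓ := ((hU ℓ).mono (subset_univ (Iio 0))).isClassicalOn isOpen_Iio
  obtain ⟨D, hD⟩ := hVf.exists_abs_sub_le hf hk hfar
  obtain ⟨D', hD'⟩ := hfar.exists_abs_sub_le hf hk hVf
  have hrate : ∀ T X, -T * -deriv (innerFamily f C 0 T) X ≤ 1 := fun T X => by
    rw [innerFamily, deriv_innerSol_zero hβ (tiltFamily_zero C)]
    have := neg_time_mul_variance_le hβ T X
    linarith
  have heq : ∀ T < 0, ∀ X, deriv (fun x => V T x - innerFamily f C ℓ T x) X = 0 →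
      deriv (fun s => V s X - innerFamily f C ℓ s X) T =
        -((V T X - innerFamily f C ℓ T X) * deriv (innerFamily f C 0 T) X) +
          iteratedDeriv 2 (fun x => V T x - innerFamily f C ℓ T x) X := fun T hT X =>
    deriv_time_sub_of_deriv_eq_zero hU (solvesInnerEquation_innerFamily hf C ℓ) hV hVs hT
  have h1 := nonpos_of_decay hβ (hV.sub hUℓ) (fun T hT X hpos h0 h2 => by
    rw [heq T hT X h0]
    have h3 := mul_le_mul_of_nonneg_left (hrate T X) hpos.le
    have h4 := mul_nonneg_of_nonpos_of_nonpos hT.le h2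
    linarith) hD
  have h1' := nonpos_of_decay hβ (hUℓ.sub hV) (fun T hT X hpos h0 h2 => by
    rw [deriv_sub_swap, neg_eq_zero] at h0
    rw [iteratedDeriv_sub_swap] at h2
    rw [deriv_sub_swap, heq T hT X h0]
    have h3 := mul_le_mul_of_nonneg_left (hrate T X) hpos.le
    have h4 := mul_nonneg_of_nonpos_of_nonpos hT.le h2
    linarith) hD'
  exact fun T hT X => by linarith [h1 T hT X, h1' T hT X]

/-- Uniqueness in the future for `ℓ ≥ 1`, where the equation is linear. -/
theorem eq_innerFamily_future_of_ne_zero (hf : IsShockDatum f) (C : ℕ → ℕ → ℝ) (hℓ : ℓ ≠ 0)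
    (hV : IsClassicalOn univ V) (hVg : HasPolynomialGrowth V)
    (hVs : SolvesInnerEquation univ (Function.update (innerFamily f C) ℓ V) ℓ)
    (h0 : ∀ X, V 0 X = innerFamily f C ℓ 0 X) :
    ∀ T, 0 ≤ T → ∀ X, V T X = innerFamily f C ℓ T X := by
  intro T₀ hT₀
  have hβ := beta₃_pos hf
  have hU := smoothFor_innerFamily hf C
  have hUℓ := (hU ℓ).isClassicalOn isOpen_univ
  have hUg : HasPolynomialGrowth (innerFamily f C ℓ) :=
    hasPolynomialGrowth_innerSol hβ (tiltFamily_zero C) ℓ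
  obtain ⟨A, hA0, hA⟩ := exists_abs_innerSol_zero_le hβ (tiltFamily_zero C) T₀
  obtain ⟨B, hB0, hB⟩ := exists_variance_le hβ T₀
  obtain ⟨D, N, hD⟩ := hVg.sub hUg T₀
  have hmem : ∀ T ∈ Icc 0 T₀, T ∈ Icc (-T₀) T₀ := fun T hT => ⟨by linarith [hT.1], hT.2⟩
  have heq : ∀ T X, deriv (fun s => V s X - innerFamily f C ℓ s X) T =
      iteratedDeriv 2 (fun x => V T x - innerFamily f C ℓ T x) X -
        innerFamily f C 0 T X * deriv (fun x => V T x - innerFamily f C ℓ T x) X +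
        -deriv (innerFamily f C 0 T) X * (V T X - innerFamily f C ℓ T X) := fun T X => by
    rw [deriv_time_sub hU (solvesInnerEquation_innerFamily hf C ℓ) hV hVs (mem_univ T) X,
      Function.update_of_ne (Ne.symm hℓ)]
    ring
  have hb : ∀ T ∈ Icc 0 T₀, ∀ X, |innerFamily f C 0 T X| ≤ (A + B) * (1 + |X|) := fun T hT X =>
    (hA T (hmem T hT) X).trans (mul_le_mul_of_nonneg_right (by linarith) (by positivity))
  have hc : ∀ T ∈ Icc 0 T₀, ∀ X, -deriv (innerFamily f C 0 T) X ≤ A + B := fun T hT X => by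
    rw [innerFamily, deriv_innerSol_zero hβ (tiltFamily_zero C)]
    linarith [hB T hT.2 X, variance_nonneg hβ T X]
  have h1 := nonpos_of_growth (add_nonneg hA0 hB0) (hV.sub hUℓ)
    (fun X => (sub_eq_zero.2 (h0 X)).le) (fun T _ X => heq T X) hb hc
    (fun T hT X => hD T (hmem T hT) X)
  have h2 := nonpos_of_growth (add_nonneg hA0 hB0) (hUℓ.sub hV)
    (fun X => (sub_eq_zero.2 (h0 X).symm).le) (fun T _ X => by
      rw [deriv_sub_swap, heq, iteratedDeriv_sub_swap 2 (innerFamily f C ℓ T),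
        deriv_sub_swap (innerFamily f C ℓ T)]
      ring) hb hc
    (fun T hT X => by
      rw [abs_sub_comm]
      exact hD T (hmem T hT) X)
  have hm : T₀ ∈ Icc 0 T₀ := right_mem_Icc.2 hT₀
  exact fun X => by linarith [h1 T₀ hm X, h2 T₀ hm X]

/-- The zeroth equation of the inner hierarchy is the viscous Burgers equation. -/
theorem SolvesInnerEquation.isBurgers {U : ℕ → ℝ → ℝ → ℝ} (hU : IsClassicalOn univ (U 0))
    (h : SolvesInnerEquation univ U 0) : IsBurgers (U 0) := by
  refine ⟨hU, fun T X => ?_⟩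
  have hd := hU.hasDerivAt (mem_univ T) X
  rw [h T (mem_univ T) X, Finset.Nat.antidiagonal_zero, Finset.sum_singleton, (hd.fun_mul hd).deriv]
  ring

/-- Uniqueness on the whole plane. -/
theorem eq_innerFamily (hf : IsShockDatum f) (C : ℕ → ℕ → ℝ) {k : ℕ} (hk : (ℓ : ℝ) / 4 ≤ k)
    (hfar : FarFieldBound f (innerFamily f C ℓ) ℓ 0 k) (hV : IsClassicalOn univ V)
    (hVg : HasPolynomialGrowth V)
    (hVs : SolvesInnerEquation univ (Function.update (innerFamily f C) ℓ V) ℓ)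
    (hVf : FarFieldBound f V ℓ 0 k) : V = innerFamily f C ℓ := by
  have hβ := beta₃_pos hf
  have hUℓ := (smoothFor_innerFamily hf C ℓ).isClassicalOn isOpen_univ
  have hpast := eq_innerFamily_past hf C hk hfar (hV.mono (subset_univ _))
    (hVs.mono (subset_univ _)) hVf
  have h0 : ∀ X, V 0 X = innerFamily f C ℓ 0 X := fun X =>
    -- Equality at T = 0 follows from equality in the past by continuity in time.
    tendsto_nhds_unique_of_eventuallyEq
      ((hV.1 0 (mem_univ _) X).continuousAt.tendsto.mono_left nhdsWithin_le_nhds)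
      ((hUℓ.1 0 (mem_univ _) X).continuousAt.tendsto.mono_left nhdsWithin_le_nhds)
      (eventually_mem_nhdsWithin.mono fun T (hT : T ∈ Iio (0 : ℝ)) => hpast T hT X)
  funext T X
  rcases lt_or_ge T 0 with hT | hT
  · exact hpast T hT X
  · by_cases hℓ : ℓ = 0
    · subst hℓ
      have hW : IsBurgers (Function.update (innerFamily f C) 0 V 0) :=
        hVs.isBurgers (by rwa [Function.update_self])
      rw [Function.update_self] at hW
      exact hW.eq_of_initial_eq
        (SolvesInnerEquation.isBurgers hUℓ (solvesInnerEquation_innerFamily hf C 0)) hVg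
        (hasPolynomialGrowth_innerSol hβ (tiltFamily_zero C) 0) h0 hT X
    · exact eq_innerFamily_future_of_ne_zero hf C hℓ hV hVg hVs h0 T hT X

/-- The `ℓ`-th equation involves only the first `ℓ + 1` functions. -/
theorem SolvesInnerEquation.congr {J : Set ℝ} {U W : ℕ → ℝ → ℝ → ℝ}
    (h : SolvesInnerEquation J U ℓ) (hUW : ∀ j ≤ ℓ, U j = W j) : SolvesInnerEquation J W ℓ := by
  intro T hT X
  rw [← hUW ℓ le_rfl, h T hT X]
  congr 2
  refine Finset.sum_congr rfl fun p hp => ?_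
  have hp' := Finset.HasAntidiagonal.mem_antidiagonal.1 hp
  rw [hUW p.1 (by lia), hUW p.2 (by lia)]

end InnerExpansion

end ShockFormation

theorem proposition3p2 (f : ℝ → ℝ) (hf : ShockFormation.IsShockDatum f) :
    ∃ U : ℕ → ℝ → ℝ → ℝ,
      -- existence of the solutions with all the bounds
      ShockFormation.IsInnerExpansion f U ∧
      -- uniqueness
      (∀ W : ℕ → ℝ → ℝ → ℝ, ShockFormation.IsInnerExpansion f W → W = U) ∧
      -- uniqueness of each single term if the bounds hold for some `k ≥ ℓ / 4` and `i ∈ {0, 1}`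
      (∀ (ℓ : ℕ) (V : ℝ → ℝ → ℝ),
        ShockFormation.IsClassicalOn Set.univ V →
        ShockFormation.HasPolynomialGrowth V →
        ShockFormation.SolvesInnerEquation Set.univ (Function.update U ℓ V) ℓ →
        (∃ k : ℕ, (ℓ : ℝ) / 4 ≤ k ∧
          ∀ i ∈ ({0, 1} : Set ℕ), ShockFormation.FarFieldBound f V ℓ i k) →
        V = U ℓ) ∧
      -- the same in the past half-plane, without any assumption on the growth
      (∀ (ℓ : ℕ) (V : ℝ → ℝ → ℝ),
        ShockFormation.IsClassicalOn (Set.Iio 0) V →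
        ShockFormation.SolvesInnerEquation (Set.Iio 0) (Function.update U ℓ V) ℓ →
        (∃ k : ℕ, (ℓ : ℝ) / 4 ≤ k ∧
          ∀ i ∈ ({0, 1} : Set ℕ), ShockFormation.FarFieldBound f V ℓ i k) →
        ∀ T < 0, ∀ X : ℝ, V T X = U ℓ T X) := by
  obtain ⟨C, hC⟩ := ShockFormation.exists_outerCoeff hf
  have hfar : ∀ ℓ i k, ShockFormation.FarFieldBound f (ShockFormation.innerFamily f C ℓ) ℓ i k :=
    ShockFormation.farFieldBound_innerSol hf hC
  refine ⟨ShockFormation.innerFamily f C, fun ℓ => ⟨ShockFormation.smoothFor_univ_iff.1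
    (ShockFormation.smoothFor_innerFamily hf C ℓ), ShockFormation.hasPolynomialGrowth_innerSol
      (ShockFormation.beta₃_pos hf) (ShockFormation.tiltFamily_zero C) ℓ,
    ShockFormation.solvesInnerEquation_innerFamily hf C ℓ, hfar ℓ⟩, fun W hW => ?_,
    fun ℓ V hV hVg hVs ⟨k, hk, hVf⟩ => ShockFormation.eq_innerFamily hf C hk (hfar ℓ 0 k) hV hVg hVs
      (hVf 0 (by simp)),
    fun ℓ V hV hVs ⟨k, hk, hVf⟩ => ShockFormation.eq_innerFamily_past hf C hk (hfar ℓ 0 k) hV hVs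
      (hVf 0 (by simp))⟩
  funext ℓ
  -- The ℓ-th equation for W contains lower terms of W. By induction they are those of U, so
  -- uniqueness of a single term applies, with k = ℓ as an admissible choice.
  induction ℓ using Nat.strong_induction_on with
  | _ ℓ ih =>
    obtain ⟨hs, hg, he, hb⟩ := hW ℓ
    refine ShockFormation.eq_innerFamily hf C (k := ℓ) ?_ (hfar ℓ 0 ℓ)
      ((ShockFormation.smoothFor_univ_iff.2 hs).isClassicalOn isOpen_univ) hg
      (he.congr fun j hj => ?_) (hb 0 ℓ)
    · have : (0 : ℝ) ≤ ℓ := Nat.cast_nonneg ℓ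
      linarith
    · rcases hj.eq_or_lt with rfl | hj
      · rw [Function.update_self]
      · rw [Function.update_of_ne hj.ne, ih j hj]
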